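/- Let $M^7$ be a smooth $7$-manifold with a $G_2$-structure $\varphi$, i.e. a smooth $3$-form which at every point $p$ is identified, by some linear isomorphism $T_pM\cong\mathbb{R}^7$, with $$\varphi_0=dx_{123}+dx_1(dx_{45}+dx_{67})+dx_2(dx_{46}-dx_{57})-dx_3(dx_{47}+dx_{56}).$$ Let $g$, $*$ and $\nabla$ be the induced metric, Hodge star and Levi-Civita connection, and define $\chi\in\Omega^3(M,TM)$ by $g(\chi(x,y,z),w)=*\varphi(x,y,z,w)$. Let $L^3\subset M$ be a compact (embedded, without boundary) associative submanifold, i.e. an oriented $3$-submanifold with $\varphi|_{TL}=\mathrm{vol}_L$, with normal bundle $\nu$. For a small smooth normal section $V\in C^\infty(L,\nu)$ let $\exp_V:L\to M$, $\exp_V(x)=\exp_x(V_x)$, let $P_V$ be the parallel transport along the geodesics $t\mapsto \exp_x(tV_x)$, $0\le t\le 1$, and let $$F(V)=\Big(P_V^{-1}\big((\exp_V^*\chi)(e_1,e_2,e_3)\big)\Big)^{\perp}\in C^\infty(L,\nu),$$ where $\{e_1,e_2,e_3\}$ is a local oriented orthonormal frame of $TL$ and $\perp$ is the orthogonal projection $TM|_L\to\nu$.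 If $d{*}\varphi=0$, then the linearization $D=(dF)_0:C^\infty(L,\nu)\to C^\infty(L,\nu)$, $DV=\frac{d}{dt}\big|_{t=0}F(tV)$, exists as a linear operator on $C^\infty(L,\nu)$ and is $L^2$-self-adjoint: $$\int_L g(DV,W)\,\mathrm{vol}_L=\int_L g(V,DW)\,\mathrm{vol}_L\qquad\text{for all }V,W\in C^\infty(L,\nu).$$ In particular, this holds if $\varphi$ is torsion-free ($d\varphi=d{*}\varphi=0$) and if $\varphi$ is nearly parallel ($d\varphi=4{*}\varphi$). -/

import Mathlib

open scoped Manifold ContDiff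

noncomputable section

/-- The model space `ℝ⁷`. -/
abbrev R7 : Type := EuclideanSpace ℝ (Fin 7)

/-- The model space `ℝ³`. -/
abbrev R3 : Type := EuclideanSpace ℝ (Fin 3)

/-! ### The model forms on `ℝ⁷` -/

/-- The constant form `dx_{s 0} ∧ … ∧ dx_{s (k-1)}` on `ℝ⁷` (coordinates are numbered from `0`):
its value on `v` is the determinant of the matrix with entries `dx_{s b} (v a)`. -/
def dxForm {k : ℕ} (s : Fin k → Fin 7) : R7 [⋀^Fin k]→L[ℝ] ℝ :=
  { (Matrix.detRowAlternating (R := ℝ) (n := Fin k)).compLinearMap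
      (LinearMap.pi fun b => (EuclideanSpace.proj (𝕜 := ℝ) (s b)).toLinearMap :
        R7 →ₗ[ℝ] (Fin k → ℝ)) with
    cont := by
      change Continuous fun v : Fin k → R7 =>
        Matrix.det (Matrix.of fun a b => (v a) (s b))
      refine Continuous.matrix_det ?_
      fun_prop }

/-- The standard `G₂` three-form
`φ₀ = dx₁₂₃ + dx₁(dx₄₅ + dx₆₇) + dx₂(dx₄₆ - dx₅₇) - dx₃(dx₄₇ + dx₅₆)`. -/
def phi0 : R7 [⋀^Fin 3]→L[ℝ] ℝ :=
  dxForm ![0, 1, 2] + dxForm ![0, 3, 4] + dxForm ![0, 5, 6] + dxForm ![1, 3, 5]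
    - dxForm ![1, 4, 6] - dxForm ![2, 3, 6] - dxForm ![2, 4, 5]

/-- The Hodge dual
`*φ₀ = dx₄₅₆₇ + dx₂₃(dx₆₇ + dx₄₅) + dx₁₃(dx₅₇ - dx₄₆) - dx₁₂(dx₅₆ + dx₄₇)`. -/
def starPhi0 : R7 [⋀^Fin 4]→L[ℝ] ℝ :=
  dxForm ![3, 4, 5, 6] + dxForm ![1, 2, 5, 6] + dxForm ![1, 2, 3, 4] + dxForm ![0, 2, 4, 6]
    - dxForm ![0, 2, 3, 5] - dxForm ![0, 1, 4, 5] - dxForm ![0, 1, 3, 6]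

/-! ### Differential forms on a 7-manifold -/

section Forms

variable {M : Type*} [TopologicalSpace M] [ChartedSpace R7 M]

/-- The coordinate expression of a `k`-form in the chart around `x₀`: its pullback under the
inverse of the chart. -/
def formInChart {k : ℕ} (α : ∀ p : M, TangentSpace (𝓡 7) p [⋀^Fin k]→L[ℝ] ℝ) (x₀ : M) (y : R7) :
    R7 [⋀^Fin k]→L[ℝ] ℝ :=
  (α ((extChartAt (𝓡 7) x₀).symm y)).compContinuousLinearMap
    (mfderiv 𝓘(ℝ, R7) (𝓡 7) (extChartAt (𝓡 7) x₀).symm y : R7 →L[ℝ] _)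

/-- A `k`-form is smooth if all its coordinate expressions are. -/
def IsSmoothForm {k : ℕ} (α : ∀ p : M, TangentSpace (𝓡 7) p [⋀^Fin k]→L[ℝ] ℝ) : Prop :=
  ∀ x₀ : M, ContDiffOn ℝ ∞ (formInChart α x₀) (extChartAt (𝓡 7) x₀).target

/-- `dα = β`, where the exterior derivative is computed in charts. -/
def ExtDerivEq {k : ℕ} (α : ∀ p : M, TangentSpace (𝓡 7) p [⋀^Fin k]→L[ℝ] ℝ)
    (β : ∀ p : M, TangentSpace (𝓡 7) p [⋀^Fin (k + 1)]→L[ℝ] ℝ) : Prop :=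
  ∀ x₀ : M, ∀ y ∈ (extChartAt (𝓡 7) x₀).target,
    extDeriv (formInChart α x₀) y = formInChart β x₀ y

end Forms

/-! ### `G₂`-structures -/

/-- A `G₂`-structure: a smooth three-form `φ` that is identified with `φ₀` at each point by a linear
isomorphism of the tangent space with `ℝ⁷`. (The stabilizer of `φ₀` lies in `SO(7)`, so `φ`
determines an orientation, the one that makes all these isomorphisms oriented.) -/
structure G2Structure (M : Type*) [TopologicalSpace M] [ChartedSpace R7 M] where
  /-- the three-form `φ` -/
  form : ∀ p : M, TangentSpace (𝓡 7) p [⋀^Fin 3]→L[ℝ] ℝ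
  smooth : IsSmoothForm form
  exists_frame : ∀ p : M, ∃ u : TangentSpace (𝓡 7) p ≃L[ℝ] R7,
    form p = phi0.compContinuousLinearMap (u : TangentSpace (𝓡 7) p →L[ℝ] R7)

namespace G2Structure

section Ambient

variable {M : Type*} [TopologicalSpace M] [ChartedSpace R7 M] (G : G2Structure M)

/-- An isomorphism `T_p M ≅ ℝ⁷` that identifies `φ_p` with `φ₀`. -/
def frame (p : M) : TangentSpace (𝓡 7) p ≃L[ℝ] R7 := (G.exists_frame p).choose

/-- The Riemannian metric `g` induced by `φ`: the standard one of `ℝ⁷`, transported. -/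
def metric (p : M) (v w : TangentSpace (𝓡 7) p) : ℝ := inner ℝ (G.frame p v) (G.frame p w)

/-- The four-form `*φ`. -/
def starForm (p : M) : TangentSpace (𝓡 7) p [⋀^Fin 4]→L[ℝ] ℝ :=
  starPhi0.compContinuousLinearMap (G.frame p : TangentSpace (𝓡 7) p →L[ℝ] R7)

/-- `d*φ = 0`. -/
def IsCoclosed : Prop := ExtDerivEq G.starForm (fun _ => 0)

/-- `φ` is torsion-free: `dφ = d*φ = 0`. -/
def IsTorsionFree : Prop := ExtDerivEq G.form (fun _ => 0) ∧ ExtDerivEq G.starForm (fun _ => 0)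

/-- `φ` is nearly parallel: `dφ = 4 *φ`. -/
def IsNearlyParallel : Prop := ExtDerivEq G.form (fun p => (4 : ℝ) • G.starForm p)

/-- The vector-valued three-form `χ` with `g(χ(x,y,z), w) = *φ(x,y,z,w)`, written out in the
orthonormal basis of `T_p M` that the frame maps to the standard basis. -/
def chi (p : M) (x y z : TangentSpace (𝓡 7) p) : TangentSpace (𝓡 7) p :=
  ∑ k : Fin 7,
    G.starForm p ![x, y, z, (G.frame p).symm (EuclideanSpace.single k 1)] •
      (G.frame p).symm (EuclideanSpace.single k 1)

/-! #### The Levi-Civita connection along curves, geodesics, parallel transport -/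

/-- The metric coefficients in the chart around `x₀`. -/
def metricInChart (x₀ : M) (y v w : R7) : ℝ :=
  G.metric ((extChartAt (𝓡 7) x₀).symm y)
    (mfderiv 𝓘(ℝ, R7) (𝓡 7) (extChartAt (𝓡 7) x₀).symm y v)
    (mfderiv 𝓘(ℝ, R7) (𝓡 7) (extChartAt (𝓡 7) x₀).symm y w)

/-- Christoffel symbols of the first kind of the Levi-Civita connection in the chart around `x₀`:
`g(∇_u v, w) = ½ (∂_u g(v,w) + ∂_v g(u,w) - ∂_w g(u,v))` for constant vector fields. -/
def christoffel (x₀ : M) (y u v w : R7) : ℝ :=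
  (1 / 2) * (fderiv ℝ (fun y' => G.metricInChart x₀ y' v w) y u
    + fderiv ℝ (fun y' => G.metricInChart x₀ y' u w) y v
    - fderiv ℝ (fun y' => G.metricInChart x₀ y' u v) y w)

/-- The components of a tangent vector in the chart around `x₀`. -/
def coordVector (x₀ : M) (X : TangentBundle (𝓡 7) M) : R7 :=
  mfderiv (𝓡 7) 𝓘(ℝ, R7) (extChartAt (𝓡 7) x₀) X.proj X.2

/-- For a vector field `X` along the curve `γ = π ∘ X`, the number `g(∇_{d/dt} X, w)` at time `t`,
computed in the chart around `γ t`; the vector `w` is given by its components in that chart. -/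
def covDerivPairing (X : ℝ → TangentBundle (𝓡 7) M) (t : ℝ) (w : R7) : ℝ :=
  let x₀ : M := (X t).proj
  let y : R7 := extChartAt (𝓡 7) x₀ (X t).proj
  G.metricInChart x₀ y (deriv (fun s => coordVector x₀ (X s)) t) w
    + G.christoffel x₀ y (deriv (fun s => extChartAt (𝓡 7) x₀ (X s).proj) t)
        (coordVector x₀ (X t)) w

/-- The velocity of a curve, as a curve in the tangent bundle. -/
def velocity (γ : ℝ → M) (t : ℝ) : TangentBundle (𝓡 7) M :=
  ⟨γ t, mfderiv 𝓘(ℝ, ℝ) (𝓡 7) γ t (1 : ℝ)⟩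

variable [IsManifold (𝓡 7) ∞ M]

/-- The vector field `X` along the curve `π ∘ X` is parallel on the open set `J` of times. -/
def IsParallelOn (X : ℝ → TangentBundle (𝓡 7) M) (J : Set ℝ) : Prop :=
  ContMDiffOn 𝓘(ℝ, ℝ) (𝓡 7).tangent 1 X J ∧ ∀ t ∈ J, ∀ w : R7, G.covDerivPairing X t w = 0

/-- `γ` is a geodesic on the open set `J` of times. -/
def IsGeodesicOn (γ : ℝ → M) (J : Set ℝ) : Prop := G.IsParallelOn (velocity γ) J

/-- `γ` is a geodesic, defined on the open set `J ⊇ [0,1]`, with initial velocity `v ∈ T_p M`. -/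
def IsGeodesicFrom (p : M) (v : TangentSpace (𝓡 7) p) (γ : ℝ → M) (J : Set ℝ) : Prop :=
  IsOpen J ∧ Set.Icc 0 1 ⊆ J ∧ G.IsGeodesicOn γ J ∧
    velocity γ 0 = (⟨p, v⟩ : TangentBundle (𝓡 7) M)

open Classical in
/-- The exponential map `exp_p v` (with value `p` if there is no geodesic with initial velocity `v`
that exists until time `1`). -/
def expMap (p : M) (v : TangentSpace (𝓡 7) p) : M :=
  if h : ∃ q : M, ∃ (γ : ℝ → M) (J : Set ℝ), G.IsGeodesicFrom p v γ J ∧ γ 1 = q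
  then h.choose else p

/-- `Y` is the parallel transport of `z ∈ T_p M` along the geodesic `t ↦ exp_p (t v)`,
`0 ≤ t ≤ 1`. -/
def IsTransport (p : M) (v z : TangentSpace (𝓡 7) p) (Y : TangentBundle (𝓡 7) M) : Prop :=
  ∃ (γ : ℝ → M) (J : Set ℝ) (X : ℝ → TangentBundle (𝓡 7) M),
    G.IsGeodesicFrom p v γ J ∧ G.IsParallelOn X J ∧ (∀ t ∈ J, (X t).proj = γ t) ∧
      X 0 = (⟨p, z⟩ : TangentBundle (𝓡 7) M) ∧ X 1 = Y

open Classical in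
/-- The inverse of the parallel transport `T_p M → T_{exp_p v} M` along the geodesic
`t ↦ exp_p (t v)`, `0 ≤ t ≤ 1`. -/
def transportBack (p : M) (v : TangentSpace (𝓡 7) p)
    (w : TangentSpace (𝓡 7) (G.expMap p v)) : TangentSpace (𝓡 7) p :=
  if h : ∃ z : TangentSpace (𝓡 7) p,
    G.IsTransport p v z (⟨G.expMap p v, w⟩ : TangentBundle (𝓡 7) M)
  then h.choose else 0

end Ambient

/-! ### Associative submanifolds -/

section Submanifold

variable {M : Type*} [TopologicalSpace M] [ChartedSpace R7 M] (G : G2Structure M)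
  {L : Type*} [TopologicalSpace L] [ChartedSpace R3 L]

/-- The basis `e` of `T_x L` is orthonormal for the metric induced by the immersion `ι`, and
positively oriented. -/
def IsOrientedOrthonormal (ι : L → M) (o : ∀ x : L, Orientation ℝ (TangentSpace (𝓡 3) x) (Fin 3))
    (x : L) (e : Module.Basis (Fin 3) ℝ (TangentSpace (𝓡 3) x)) : Prop :=
  (∀ i j, G.metric (ι x) (mfderiv (𝓡 3) (𝓡 7) ι x (e i)) (mfderiv (𝓡 3) (𝓡 7) ι x (e j))
    = if i = j then 1 else 0) ∧ e.orientation = o x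

/-- `L`, immersed by `ι` and oriented by `o`, is associative: `φ` restricts to the volume form, that
is, it takes the value `1` on oriented orthonormal bases of the tangent spaces of `L`. -/
def IsAssociative (ι : L → M) (o : ∀ x : L, Orientation ℝ (TangentSpace (𝓡 3) x) (Fin 3)) : Prop :=
  ∀ (x : L) (e : Module.Basis (Fin 3) ℝ (TangentSpace (𝓡 3) x)), G.IsOrientedOrthonormal ι o x e →
    G.form (ι x) (fun i => mfderiv (𝓡 3) (𝓡 7) ι x (e i)) = 1

/-- The volume measure of the induced Riemannian metric on `L`. In each chart it has density
`√det(g_ij)` with respect to Lebesgue measure; these measures on the chart domains agree on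
overlaps, and the measure that they define together is their supremum. -/
def volumeMeasure [MeasurableSpace L] (ι : L → M) : MeasureTheory.Measure L :=
  ⨆ x₀ : L, MeasureTheory.Measure.map (extChartAt (𝓡 3) x₀).symm
    ((MeasureTheory.volume.restrict (extChartAt (𝓡 3) x₀).target).withDensity fun y =>
      ENNReal.ofReal (Real.sqrt (Matrix.det (Matrix.of fun i j : Fin 3 =>
        G.metric (ι ((extChartAt (𝓡 3) x₀).symm y))
          (mfderiv 𝓘(ℝ, R3) (𝓡 7) (ι ∘ (extChartAt (𝓡 3) x₀).symm) y (EuclideanSpace.single i 1))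
          (mfderiv 𝓘(ℝ, R3) (𝓡 7) (ι ∘ (extChartAt (𝓡 3) x₀).symm) y
            (EuclideanSpace.single j 1))))))

variable [IsManifold (𝓡 7) ∞ M]

/-- Linear combinations of smooth vector fields along a smooth map are smooth. -/
theorem contMDiff_lift_of_linear {ι : L → M} {V W Z : ∀ x : L, TangentSpace (𝓡 7) (ι x)} {a b : ℝ}
    (hV : ContMDiff (𝓡 3) (𝓡 7).tangent ∞ (fun x => (⟨ι x, V x⟩ : TangentBundle (𝓡 7) M)))
    (hW : ContMDiff (𝓡 3) (𝓡 7).tangent ∞ (fun x => (⟨ι x, W x⟩ : TangentBundle (𝓡 7) M)))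
    (hZ : ∀ x, Z x = a • V x + b • W x) :
    ContMDiff (𝓡 3) (𝓡 7).tangent ∞ (fun x => (⟨ι x, Z x⟩ : TangentBundle (𝓡 7) M)) := by
  intro x₀
  have h1 := (Bundle.contMDiffAt_totalSpace (f := fun x => (⟨ι x, V x⟩ : TangentBundle (𝓡 7) M))
    (x₀ := x₀)).1 (hV x₀)
  have h2 := (Bundle.contMDiffAt_totalSpace (f := fun x => (⟨ι x, W x⟩ : TangentBundle (𝓡 7) M))
    (x₀ := x₀)).1 (hW x₀)
  refine Bundle.contMDiffAt_totalSpace.2 ⟨h1.1, ?_⟩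
  have h3 := ((contMDiffAt_const (I := 𝓡 3) (I' := 𝓘(ℝ, ℝ)) (c := a)).smul h1.2).add
    ((contMDiffAt_const (I := 𝓡 3) (I' := 𝓘(ℝ, ℝ)) (c := b)).smul h2.2)
  refine ContMDiffAt.congr_of_eventuallyEq h3 ?_
  have hb : ∀ᶠ x in nhds x₀, ι x ∈
      (trivializationAt R7 (TangentSpace (𝓡 7) : M → Type _) (ι x₀)).baseSet :=
    h1.1.continuousAt.eventually ((Bundle.Trivialization.open_baseSet _).mem_nhds
      (FiberBundle.mem_baseSet_trivializationAt R7 (TangentSpace (𝓡 7) : M → Type _) (ι x₀)))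
  filter_upwards [hb] with x hx
  have hl := (trivializationAt R7 (TangentSpace (𝓡 7) : M → Type _) (ι x₀)).linear ℝ hx
  simp only [hZ, hl.map_add, hl.map_smul]
  rfl

/-- The zero vector field along a smooth map is smooth. -/
theorem contMDiff_zero_lift {ι : L → M} (hι : ContMDiff (𝓡 3) (𝓡 7) ∞ ι) :
    ContMDiff (𝓡 3) (𝓡 7).tangent ∞ (fun x => (⟨ι x, 0⟩ : TangentBundle (𝓡 7) M)) :=
  (Bundle.contMDiff_zeroSection ℝ (TangentSpace (𝓡 7) : M → Type _)).comp hι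

/-- The space `C^∞(L, ν)` of smooth sections of the normal bundle of `L`. -/
def normalSections (ι : C^∞⟮𝓡 3, L; 𝓡 7, M⟯) : Submodule ℝ (∀ x : L, TangentSpace (𝓡 7) (ι x)) where
  carrier := {V | ContMDiff (𝓡 3) (𝓡 7).tangent ∞
      (fun x => (⟨ι x, V x⟩ : TangentBundle (𝓡 7) M)) ∧
    ∀ (x : L) (v : TangentSpace (𝓡 3) x),
      G.metric (ι x) (V x) (mfderiv (𝓡 3) (𝓡 7) ι x v) = 0}
  add_mem' := by
    rintro V W ⟨hV, hV'⟩ ⟨hW, hW'⟩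
    refine ⟨contMDiff_lift_of_linear hV hW (a := 1) (b := 1) (fun x => by simp), fun x v => ?_⟩
    have h1 := hV' x v
    have h2 := hW' x v
    simp only [metric, Pi.add_apply, map_add, inner_add_left] at h1 h2 ⊢
    rw [h1, h2, add_zero]
  zero_mem' := by
    refine ⟨contMDiff_zero_lift ι.contMDiff, fun x v => ?_⟩
    simp [metric]
  smul_mem' := by
    rintro c V ⟨hV, hV'⟩
    refine ⟨contMDiff_lift_of_linear hV hV (a := c) (b := 0)
      (fun x => by simp), fun x v => ?_⟩
    have h1 := hV' x v
    simp only [metric, Pi.smul_apply, map_smul, inner_smul_left] at h1 ⊢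
    rw [h1, mul_zero]

/-- The map `exp_V : L → M`, `x ↦ exp_x (V_x)`. -/
def expSection (ι : C^∞⟮𝓡 3, L; 𝓡 7, M⟯) (V : ∀ x : L, TangentSpace (𝓡 7) (ι x)) (x : L) : M :=
  G.expMap (ι x) (V x)

/-- The orthogonal projection `T_{ι x} M → ν_x`, written in an orthonormal basis `e` of `T_x L`. -/
def normalProj (ι : C^∞⟮𝓡 3, L; 𝓡 7, M⟯) (x : L) (e : Module.Basis (Fin 3) ℝ (TangentSpace (𝓡 3) x))
    (w : TangentSpace (𝓡 7) (ι x)) : TangentSpace (𝓡 7) (ι x) :=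
  w - ∑ i, G.metric (ι x) w (mfderiv (𝓡 3) (𝓡 7) ι x (e i)) • mfderiv (𝓡 3) (𝓡 7) ι x (e i)

/-- The value at `x` of the deformation map
`F(V) = (P_V⁻¹ ((exp_V^* χ)(e₁, e₂, e₃)))^⊥`, where `e` is an oriented orthonormal basis of `T_x L`
and `P_V` is the parallel transport along `t ↦ exp_x (t V_x)`, `0 ≤ t ≤ 1`. -/
def deformationMap (ι : C^∞⟮𝓡 3, L; 𝓡 7, M⟯) (V : ∀ x : L, TangentSpace (𝓡 7) (ι x)) (x : L)
    (e : Module.Basis (Fin 3) ℝ (TangentSpace (𝓡 3) x)) : TangentSpace (𝓡 7) (ι x) :=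
  G.normalProj ι x e (G.transportBack (ι x) (V x)
    (G.chi (G.expSection ι V x)
      (mfderiv (𝓡 3) (𝓡 7) (G.expSection ι V) x (e 0))
      (mfderiv (𝓡 3) (𝓡 7) (G.expSection ι V) x (e 1))
      (mfderiv (𝓡 3) (𝓡 7) (G.expSection ι V) x (e 2))))

/-- `D` is the linearization `(dF)_0 : C^∞(L, ν) → C^∞(L, ν)` of the deformation map at the zero
section: `D V = d/dt F(t V)` at `t = 0`. -/
def IsLinearization (ι : C^∞⟮𝓡 3, L; 𝓡 7, M⟯) (o : ∀ x : L, Orientation ℝ (TangentSpace (𝓡 3) x) (Fin 3))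
    (D : G.normalSections ι →ₗ[ℝ] G.normalSections ι) : Prop :=
  ∀ (V : G.normalSections ι) (x : L) (e : Module.Basis (Fin 3) ℝ (TangentSpace (𝓡 3) x)),
    G.IsOrientedOrthonormal ι o x e →
      HasDerivAt (fun t : ℝ => G.deformationMap ι ((t • V : G.normalSections ι).1) x e)
        ((D V).1 x) 0

/-- The `L²` inner product `∫_L g(V, W) vol_L` of two normal sections. -/
def l2Inner [MeasurableSpace L] (ι : C^∞⟮𝓡 3, L; 𝓡 7, M⟯) (V W : G.normalSections ι) : ℝ :=
  ∫ x, G.metric (ι x) (V.1 x) (W.1 x) ∂(G.volumeMeasure ι)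

/-- The deformation map has a linearization `D : C^∞(L, ν) → C^∞(L, ν)` at the zero section, and
`D` is self-adjoint for the `L²` inner product. -/
def HasSelfAdjointLinearization [MeasurableSpace L] (ι : C^∞⟮𝓡 3, L; 𝓡 7, M⟯)
    (o : ∀ x : L, Orientation ℝ (TangentSpace (𝓡 3) x) (Fin 3)) : Prop :=
  ∃ D : G.normalSections ι →ₗ[ℝ] G.normalSections ι, G.IsLinearization ι o D ∧
    ∀ V W : G.normalSections ι, G.l2Inner ι (D V) W = G.l2Inner ι V (D W)

end Submanifold

end G2Structure

end

/-!
The argument has three layers.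

*Smoothness of the induced data.* The metric and `*φ` are defined pointwise, through frames that
need not vary smoothly. They are smooth all the same, because they are algebraic expressions in `φ`.
For `η = u^* φ₀`, the determinant of the matrix of `η(v, ·, ·)` plus `v vᵀ` has square
`det(u)⁴ |v|⁸ |u v|⁸` (`formDet_sq`), so that a root recovers `|det u| |u v|²`; its polarization has
determinant `|det u|⁹`, which separates off `|det u|` (`formMetric_eq`). The identity
`*φ₀(x, y, z, w) = φ₀(x, y, z × w) - ⟨x, z⟩⟨y, w⟩ + ⟨x, w⟩⟨y, z⟩` (`starPhi0_apply`) then expresses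
`*φ` through `φ` and the metric (`contDiffOn_formInChart_starForm`).

*Existence and form of the linearization.* In a chart, `v ↦ exp (a v)` is the time `a` flow of the
geodesic vector field (`exists_geodesic_flow`), and parallel transport over time `a` is the identity
up to a relative error `O(a)`, by Grönwall's inequality (`norm_transportBack_sub_le`). On an
associative plane `*φ(x, y, z, ·)` vanishes, since the third vector of an oriented orthonormal basis
is the cross product of the other two (`starPhi0_eq_zero_of_phi0_eq_one`). Hence neither the
transport, nor the derivative of the metric that turns `*φ` into `χ`, contributes to the derivative
of the deformation map at the zero section. What remains is the first variation `firstVar` of `*φ`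
on the images of the tangent vectors (`hasDerivAt_toChart_transportBack`): in coordinates,
`g(DV, w)` is the derivative of `-*φ(w, A₀, A₁, A₂)` with `w` held fixed. It vanishes for tangent
`w` (`firstVar_self`), so `DV` is normal and the projection to the normal bundle does not change it;
and it is a smooth first order expression in `V`, linear in `V`.

*Self-adjointness.* The first variation is alternating in the tangent vectors (`firstVar_det`) and
may be evaluated on the coordinate vector fields `∂₀, ∂₁, ∂₂` of a chart of `L`; up to a sign that is
locally constant, this multiplies it by the Riemannian density, which is `|φ(∂₀, ∂₁, ∂₂)|` on an
associative submanifold (`chartDensity_eq_abs_chartForm`). If `*φ` is closed, exchanging the roles of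
`V` and `W` in the first variation changes it by a divergence, that of the vector field with
components `*φ(W, V, ∂₁, ∂₂)`, `*φ(W, ∂₀, V, ∂₂)` and `*φ(W, ∂₀, ∂₁, V)` (`firstVar_sub_firstVar`).
Divergences of compactly supported vector fields integrate to zero, which settles the case of a
section `V` supported in a chart (`integral_metric_linearizationAt_sub`), and a partition of unity
reduces the general case to this one (`l2Inner_linearization`).

A torsion-free structure is coclosed by definition, and a nearly parallel one because
`*φ = d(φ / 4)`.
-/

open scoped Manifold ContDiff Topology

set_option linter.unusedSectionVars false

noncomputable section

/-! ### The cross product and the model forms -/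

open Matrix in
theorem dxForm_apply {k : ℕ} (s : Fin k → Fin 7) (v : Fin k → R7) :
    dxForm s v = Matrix.det (Matrix.of fun a b => (v a) (s b)) := rfl

theorem phi0_apply (x y z : R7) : phi0 ![x, y, z] =
    x 0*y 1*z 2 - x 0*y 2*z 1 - x 1*y 0*z 2 + x 1*y 2*z 0 + x 2*y 0*z 1 - x 2*y 1*z 0
    + (x 0*y 3*z 4 - x 0*y 4*z 3 - x 3*y 0*z 4 + x 3*y 4*z 0 + x 4*y 0*z 3 - x 4*y 3*z 0)
    + (x 0*y 5*z 6 - x 0*y 6*z 5 - x 5*y 0*z 6 + x 5*y 6*z 0 + x 6*y 0*z 5 - x 6*y 5*z 0)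
    + (x 1*y 3*z 5 - x 1*y 5*z 3 - x 3*y 1*z 5 + x 3*y 5*z 1 + x 5*y 1*z 3 - x 5*y 3*z 1)
    - (x 1*y 4*z 6 - x 1*y 6*z 4 - x 4*y 1*z 6 + x 4*y 6*z 1 + x 6*y 1*z 4 - x 6*y 4*z 1)
    - (x 2*y 3*z 6 - x 2*y 6*z 3 - x 3*y 2*z 6 + x 3*y 6*z 2 + x 6*y 2*z 3 - x 6*y 3*z 2)
    - (x 2*y 4*z 5 - x 2*y 5*z 4 - x 4*y 2*z 5 + x 4*y 5*z 2 + x 5*y 2*z 4 - x 5*y 4*z 2) := by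
  simp only [phi0, ContinuousAlternatingMap.add_apply, ContinuousAlternatingMap.sub_apply,
    dxForm_apply, Matrix.det_fin_three, Matrix.of_apply, Matrix.cons_val]

/-- The cross product of `ℝ⁷` determined by `⟨x × y, z⟩ = φ₀(x, y, z)`. -/
def cross (x y : R7) : R7 := !₂[
  x 1*y 2 - x 2*y 1 + x 3*y 4 - x 4*y 3 + x 5*y 6 - x 6*y 5,
  x 2*y 0 - x 0*y 2 + x 3*y 5 - x 5*y 3 - x 4*y 6 + x 6*y 4,
  x 0*y 1 - x 1*y 0 - x 3*y 6 + x 6*y 3 - x 4*y 5 + x 5*y 4,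
  x 4*y 0 - x 0*y 4 + x 5*y 1 - x 1*y 5 - x 6*y 2 + x 2*y 6,
  x 0*y 3 - x 3*y 0 - x 6*y 1 + x 1*y 6 - x 5*y 2 + x 2*y 5,
  x 6*y 0 - x 0*y 6 + x 1*y 3 - x 3*y 1 - x 2*y 4 + x 4*y 2,
  x 0*y 5 - x 5*y 0 - x 1*y 4 + x 4*y 1 - x 2*y 3 + x 3*y 2]

theorem inner_r7 (x y : R7) : inner ℝ x y =
    x 0*y 0 + x 1*y 1 + x 2*y 2 + x 3*y 3 + x 4*y 4 + x 5*y 5 + x 6*y 6 := by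
  simp only [PiLp.inner_apply, Fin.sum_univ_seven]
  simp [mul_comm]

theorem inner_cross (x y z : R7) : inner ℝ (cross x y) z = phi0 ![x, y, z] := by
  rw [inner_r7, phi0_apply]
  simp only [cross, PiLp.toLp_apply, Matrix.cons_val]
  ring

/-- The double cross product identity that makes `(x × ·)²` explicit. -/
theorem r7_cross_cross (x y : R7) : cross x (cross x y) = (inner ℝ x y) • x - (inner ℝ x x) • y := by
  ext i
  rw [inner_r7, inner_r7]
  fin_cases i <;>
  · simp only [cross, PiLp.toLp_apply, Matrix.cons_val, PiLp.sub_apply, PiLp.smul_apply, smul_eq_mul,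
      Fin.reduceFinMk, Fin.isValue, Fin.zero_eta, Fin.mk_one]
    ring

theorem inner_cross_cross_self (x y : R7) : inner ℝ (cross x y) (cross x y) =
    inner ℝ x x * inner ℝ y y - inner ℝ x y ^ 2 := by
  simp only [inner_r7]
  simp only [cross, PiLp.toLp_apply, Matrix.cons_val]
  ring

theorem Matrix.det_fin_four' (A : Matrix (Fin 4) (Fin 4) ℝ) : A.det =
    A 0 0 * (A 1 1 * A 2 2 * A 3 3 - A 1 1 * A 2 3 * A 3 2 - A 1 2 * A 2 1 * A 3 3
      + A 1 2 * A 2 3 * A 3 1 + A 1 3 * A 2 1 * A 3 2 - A 1 3 * A 2 2 * A 3 1)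
    - A 0 1 * (A 1 0 * A 2 2 * A 3 3 - A 1 0 * A 2 3 * A 3 2 - A 1 2 * A 2 0 * A 3 3
      + A 1 2 * A 2 3 * A 3 0 + A 1 3 * A 2 0 * A 3 2 - A 1 3 * A 2 2 * A 3 0)
    + A 0 2 * (A 1 0 * A 2 1 * A 3 3 - A 1 0 * A 2 3 * A 3 1 - A 1 1 * A 2 0 * A 3 3
      + A 1 1 * A 2 3 * A 3 0 + A 1 3 * A 2 0 * A 3 1 - A 1 3 * A 2 1 * A 3 0)
    - A 0 3 * (A 1 0 * A 2 1 * A 3 2 - A 1 0 * A 2 2 * A 3 1 - A 1 1 * A 2 0 * A 3 2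
      + A 1 1 * A 2 2 * A 3 0 + A 1 2 * A 2 0 * A 3 1 - A 1 2 * A 2 1 * A 3 0) := by
  rw [Matrix.det_succ_row_zero, Fin.sum_univ_four]
  simp only [Matrix.det_fin_three, Matrix.submatrix_apply]
  have e : ∀ i : Fin 4, ∀ j : Fin 3, i.succAbove j = if j.castSucc < i then j.castSucc else j.succ :=
    fun i j => rfl
  simp only [e]
  norm_num [Fin.lt_def]
  have e3 : (Fin.succ (2 : Fin 3)) = 3 := rfl
  have e4 : (Fin.castSucc (2 : Fin 3)) = 2 := rfl
  simp only [e3, e4]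
  ring

/-- `*φ₀` in terms of `φ₀`, the cross product and the metric. As the cross product is determined by
`φ₀` and the metric, `*φ` depends smoothly on them. -/
theorem starPhi0_apply (x y z w : R7) : starPhi0 ![x, y, z, w] =
    phi0 ![x, y, cross z w] - inner ℝ x z * inner ℝ y w + inner ℝ x w * inner ℝ y z := by
  rw [phi0_apply]
  simp only [inner_r7]
  simp only [starPhi0, ContinuousAlternatingMap.add_apply, ContinuousAlternatingMap.sub_apply,
    dxForm_apply, Matrix.det_fin_four', Matrix.of_apply, Matrix.cons_val, cross, PiLp.toLp_apply]
  ring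

/-- On an associative plane the coassociative form contracts to zero: the third vector of an
associative orthonormal triple is the cross product of the other two. -/
theorem starPhi0_eq_zero_of_phi0_eq_one {x y z : R7} (hx : inner ℝ x x = 1) (hy : inner ℝ y y = 1)
    (hz : inner ℝ z z = 1) (hxy : inner ℝ x y = 0) (hxz : inner ℝ x z = 0) (hyz : inner ℝ y z = 0)
    (h : phi0 ![x, y, z] = 1) (w : R7) : starPhi0 ![x, y, z, w] = 0 := by
  have h1 : cross x y = z := by
    have h2 := inner_cross_cross_self x y
    rw [← inner_cross] at h
    have h3 : inner ℝ (cross x y - z) (cross x y - z) = 0 := by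
      rw [inner_sub_left, inner_sub_right, inner_sub_right, h2, real_inner_comm (cross x y) z, h, hz,
        hx, hy, hxy]
      norm_num
    exact sub_eq_zero.1 (inner_self_eq_zero.1 h3)
  rw [starPhi0_apply, hxz, hyz, ← inner_cross, h1, real_inner_comm, inner_cross]
  simp only [zero_mul, mul_zero, sub_zero, add_zero]
  exact phi0.map_eq_zero_of_eq _ (i := 0) (j := 2) rfl (by decide)

/-! ### The metric and the coassociative form in terms of the three-form -/

/-- The standard basis vectors of `ℝ⁷`. -/
abbrev e7 (i : Fin 7) : R7 := EuclideanSpace.single i 1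

theorem sum_smul_e7 (z : R7) : ∑ i, z i • e7 i = z := by
  ext j
  simp [Finset.sum_apply, Pi.single_apply]

theorem update_one_vec3 {E : Type*} (a y z q : E) :
    Function.update ![a, y, z] 1 q = ![a, q, z] := by
  funext i; fin_cases i <;> rfl

theorem update_two_vec3 {E : Type*} (a y z q : E) :
    Function.update ![a, y, z] 2 q = ![a, y, q] := by
  funext i; fin_cases i <;> rfl

/-- The bilinear form `η(a, ·, ·)`. -/
def contract (η : R7 [⋀^Fin 3]→L[ℝ] ℝ) (a : R7) : R7 →ₗ[ℝ] R7 →ₗ[ℝ] ℝ :=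
  LinearMap.mk₂ ℝ (fun y z => η ![a, y, z])
    (fun y y' z => by
      have := η.toMultilinearMap.map_update_add ![a, y, z] 1 y y'
      rwa [update_one_vec3, update_one_vec3, update_one_vec3] at this)
    (fun c y z => by
      have := η.toMultilinearMap.map_update_smul ![a, y, z] 1 c y
      rwa [update_one_vec3, update_one_vec3] at this)
    (fun y z z' => by
      have := η.toMultilinearMap.map_update_add ![a, y, z] 2 z z'
      rwa [update_two_vec3, update_two_vec3, update_two_vec3] at this)
    (fun c y z => by
      have := η.toMultilinearMap.map_update_smul ![a, y, z] 2 c z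
      rwa [update_two_vec3, update_two_vec3] at this)

/-- The matrix of the two-form `η(a, ·, ·)`. -/
def contractMatrix (η : R7 [⋀^Fin 3]→L[ℝ] ℝ) (a : R7) : Matrix (Fin 7) (Fin 7) ℝ :=
  Matrix.of fun i j => η ![a, e7 i, e7 j]

theorem form_eq_dotProduct (η : R7 [⋀^Fin 3]→L[ℝ] ℝ) (a y z : R7) :
    η ![a, y, z] = dotProduct y (Matrix.mulVec (contractMatrix η a) z) := by
  have h : contract η a y z = contract η a (∑ i, y i • e7 i) (∑ j, z j • e7 j) := by
    rw [sum_smul_e7, sum_smul_e7]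
  change contract η a y z = _
  rw [h]
  simp only [map_sum, map_smul, LinearMap.sum_apply, LinearMap.smul_apply, dotProduct,
    Matrix.mulVec, smul_eq_mul]
  simp only [Finset.mul_sum]
  rw [Finset.sum_comm]
  refine Finset.sum_congr rfl fun i _ => ?_
  refine Finset.sum_congr rfl fun j _ => ?_
  simp only [contract, contractMatrix, LinearMap.mk₂_apply, Matrix.of_apply]
  ring

/-- The matrix of a linear endomorphism of `ℝ⁷`. -/
def matrixOf (u : R7 →L[ℝ] R7) : Matrix (Fin 7) (Fin 7) ℝ := Matrix.of fun k i => u (e7 i) k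

theorem matrixOf_mulVec (u : R7 →L[ℝ] R7) (v : R7) : Matrix.mulVec (matrixOf u) v = u v := by
  ext k
  conv_rhs => rw [← sum_smul_e7 v]
  simp [Matrix.mulVec, dotProduct, matrixOf, Finset.sum_apply, mul_comm]

theorem inner_eq_dotProduct (x y : R7) : inner ℝ x y = dotProduct (x : Fin 7 → ℝ) y := by
  simp [PiLp.inner_apply, dotProduct, mul_comm]

theorem contractMatrix_comp (η : R7 [⋀^Fin 3]→L[ℝ] ℝ) (u : R7 →L[ℝ] R7) (a : R7) :
    contractMatrix (η.compContinuousLinearMap u) a =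
      (matrixOf u).transpose * contractMatrix η (u a) * matrixOf u := by
  ext i j
  have h : (η.compContinuousLinearMap u) ![a, e7 i, e7 j] = η ![u a, u (e7 i), u (e7 j)] := by
    simp only [ContinuousAlternatingMap.compContinuousLinearMap_apply]
    congr 1
    ext k
    fin_cases k <;> rfl
  change (η.compContinuousLinearMap u) ![a, e7 i, e7 j] = _
  rw [h, form_eq_dotProduct]
  simp only [dotProduct, Matrix.mulVec, Matrix.mul_apply, Matrix.transpose_apply, matrixOf,
    Matrix.of_apply, Finset.mul_sum, Finset.sum_mul]
  rw [Finset.sum_comm]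
  refine Finset.sum_congr rfl fun k _ => Finset.sum_congr rfl fun l _ => by ring

theorem contractMatrix_phi0_mulVec (a z : R7) :
    Matrix.mulVec (contractMatrix phi0 a) z = -(cross a z).ofLp := by
  ext i
  have h1 : phi0 ![a, e7 i, z] = -phi0 ![a, z, e7 i] := by
    rw [phi0_apply, phi0_apply]; ring
  have h2 := form_eq_dotProduct phi0 a (e7 i) z
  rw [h1, ← inner_cross] at h2
  simp only [EuclideanSpace.inner_single_right, e7] at h2
  simpa [dotProduct, eq_comm, Pi.single_apply] using h2

open Matrix in
theorem contractMatrix_phi0_sq (a : R7) :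
    contractMatrix phi0 a * contractMatrix phi0 a =
      vecMulVec a a - (inner ℝ a a : ℝ) • (1 : Matrix (Fin 7) (Fin 7) ℝ) := by
  refine Matrix.ext_of_mulVec_single fun j => ?_
  have h : (Pi.single j 1 : Fin 7 → ℝ) = (e7 j).ofLp := rfl
  rw [← Matrix.mulVec_mulVec, h, contractMatrix_phi0_mulVec a (e7 j),
    Matrix.mulVec_neg, contractMatrix_phi0_mulVec a (cross a (e7 j)), r7_cross_cross, Matrix.sub_mulVec,
    Matrix.smul_mulVec, Matrix.one_mulVec]
  ext i
  simp only [vecMulVec_mulVec, inner_eq_dotProduct]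
  simp [mul_comm]

open Matrix in
theorem det_smul_one_add_vecMulVec (α β : ℝ) (hα : α ≠ 0) (a : Fin 7 → ℝ) :
    (α • (1 : Matrix (Fin 7) (Fin 7) ℝ) + β • vecMulVec a a).det
      = α ^ 6 * (α + β * dotProduct a a) := by
  have h : α • (1 : Matrix (Fin 7) (Fin 7) ℝ) + β • vecMulVec a a
      = α • (1 + replicateCol Unit ((β / α) • a) * replicateRow Unit a) := by
    rw [smul_add]
    congr 1
    ext i j
    simp [vecMulVec, Matrix.mul_apply]
    field_simp
  rw [h, det_smul, det_one_add_replicateCol_mul_replicateRow]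
  simp
  field_simp

open Matrix in
/-- The square of `det (A + w wᵀ)` for `A` the matrix of `φ₀(a, ·, ·)`. A shear fixing `A` moves `w`
to a multiple of `a`, and `A²` is explicit. -/
theorem det_contractMatrix_phi0_sq (a w : R7) (h : dotProduct (w : Fin 7 → ℝ) a ≠ 0) :
    (contractMatrix phi0 a + vecMulVec w w).det ^ 2 =
      dotProduct (w : Fin 7 → ℝ) a ^ 4 * dotProduct (a : Fin 7 → ℝ) a ^ 4 := by
  set A := contractMatrix phi0 a with hA
  set n := dotProduct (a : Fin 7 → ℝ) a with hn
  set c := dotProduct (w : Fin 7 → ℝ) a with hc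
  have hn0 : n ≠ 0 := by
    intro h0
    have : (a : Fin 7 → ℝ) = 0 := dotProduct_self_eq_zero.1 h0
    apply h
    rw [hc, this, dotProduct_zero]
  have hAa : A *ᵥ a = 0 := by
    rw [hA, contractMatrix_phi0_mulVec]
    ext i
    fin_cases i <;> simp [cross] <;> ring
  have hskew : Aᵀ = -A := by
    ext i j
    change phi0 ![a, e7 j, e7 i] = -phi0 ![a, e7 i, e7 j]
    rw [phi0_apply, phi0_apply]
    ring
  have haA : a ᵥ* A = 0 := by
    rw [← mulVec_transpose, hskew, neg_mulVec, hAa, neg_zero]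
  set s := c / n with hs
  have hs0 : s ≠ 0 := div_ne_zero h hn0
  set y : Fin 7 → ℝ := fun i => w i - s * a i with hy
  have hya : dotProduct a y = 0 := by
    have h1 : dotProduct a y = c - s * n := by
      simp only [hy, hc, hn, dotProduct, mul_sub, Finset.sum_sub_distrib, Finset.mul_sum]
      congr 1 <;> refine Finset.sum_congr rfl fun i _ => by ring
    rw [h1, hs]; field_simp; ring
  set P : Matrix (Fin 7) (Fin 7) ℝ :=
    1 + replicateCol Unit ((1 / (s * n)) • y) * replicateRow Unit (a : Fin 7 → ℝ) with hP
  have hdetP : P.det = 1 := by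
    rw [hP, det_one_add_replicateCol_mul_replicateRow, dotProduct_smul, hya]
    simp
  have hPA : P * A = A := by
    rw [hP, add_mul, one_mul, Matrix.mul_assoc]
    have : replicateRow Unit (a : Fin 7 → ℝ) * A = 0 := by
      ext i j
      have := congrFun haA j
      simpa [vecMul, dotProduct, Matrix.mul_apply] using this
    rw [this, Matrix.mul_zero, add_zero]
  have hAP : A * Pᵀ = A := by
    have := congrArg transpose hPA
    rw [transpose_mul, hskew, neg_mul] at this
    exact neg_injective this
  have hPa : P *ᵥ a = (1 / s) • (w : Fin 7 → ℝ) := by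
    have e : replicateRow Unit (a : Fin 7 → ℝ) *ᵥ a = fun _ => n := by
      ext i; simp [mulVec, hn]
    rw [hP, add_mulVec, one_mulVec, ← mulVec_mulVec, e]
    ext i
    simp [mulVec, dotProduct, hy]
    field_simp
    ring
  have hw : vecMulVec w w = P * (s ^ 2 • vecMulVec a a) * Pᵀ := by
    rw [Matrix.mul_smul, Matrix.smul_mul, mul_vecMulVec, hPa, vecMulVec_mul,
      vecMul_transpose, hPa]
    ext i j
    simp [vecMulVec]
    field_simp
  have hfac : A + vecMulVec w w = P * (A + s ^ 2 • vecMulVec a a) * Pᵀ := by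
    rw [mul_add, add_mul, hPA, hAP, ← hw]
  rw [hfac, det_mul, det_mul, det_transpose, hdetP, one_mul, mul_one, sq, ← det_mul]
  have hsq : (A + s ^ 2 • vecMulVec a a) * (A + s ^ 2 • vecMulVec a a)
      = (-n) • (1 : Matrix (Fin 7) (Fin 7) ℝ) + (1 + s ^ 4 * n) • vecMulVec a a := by
    rw [add_mul, mul_add, mul_add, hA, contractMatrix_phi0_sq, ← hA, Matrix.mul_smul, Matrix.smul_mul,
      mul_vecMulVec, hAa, vecMulVec_mul, haA, Matrix.smul_mul, Matrix.mul_smul,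
      vecMulVec_mul_vecMulVec, inner_eq_dotProduct, ← hn]
    ext i j
    simp [vecMulVec]
    ring
  rw [hsq, det_smul_one_add_vecMulVec _ _ (neg_ne_zero.2 hn0), ← hn, hs]
  field_simp
  ring

open Matrix in
/-- `det (A + v vᵀ)` for `A` the matrix of `η(v, ·, ·)`. -/
def formDet (η : R7 [⋀^Fin 3]→L[ℝ] ℝ) (v : R7) : ℝ :=
  (contractMatrix η v + vecMulVec v v).det

theorem matrixOf_symm_mul (u : R7 ≃L[ℝ] R7) :
    matrixOf (u.symm : R7 →L[ℝ] R7) * matrixOf (u : R7 →L[ℝ] R7) = 1 := by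
  refine Matrix.ext_of_mulVec_single fun j => ?_
  have h : (Pi.single j 1 : Fin 7 → ℝ) = (e7 j).ofLp := rfl
  rw [← Matrix.mulVec_mulVec, h, matrixOf_mulVec (u : R7 →L[ℝ] R7) (e7 j),
    matrixOf_mulVec (u.symm : R7 →L[ℝ] R7), Matrix.one_mulVec]
  simp

open Matrix in
/-- For `η = u^* φ₀` the matrix of `η(v, ·, ·)` plus `v vᵀ` is congruent, by the matrix of `u`, to the
matrix of `φ₀(u v, ·, ·)` plus `w wᵀ`, where `⟨w, u v⟩ = |v|²`. -/
theorem formDet_sq (u : R7 ≃L[ℝ] R7) (v : R7) (hv : v ≠ 0) :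
    formDet (phi0.compContinuousLinearMap (u : R7 →L[ℝ] R7)) v ^ 2 =
      (matrixOf (u : R7 →L[ℝ] R7)).det ^ 4 * inner ℝ v v ^ 4 * inner ℝ (u v) (u v) ^ 4 := by
  set U := matrixOf (u : R7 →L[ℝ] R7) with hU
  set U' := matrixOf (u.symm : R7 →L[ℝ] R7) with hU'
  have hUU : U' * U = 1 := matrixOf_symm_mul u
  set w : R7 := WithLp.toLp 2 (U'ᵀ *ᵥ v.ofLp) with hw
  have hwv : Uᵀ *ᵥ w.ofLp = v.ofLp := by
    rw [hw, mulVec_mulVec, ← transpose_mul, hUU, transpose_one, one_mulVec]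
  have hdot : dotProduct w.ofLp (u v).ofLp = inner ℝ v v := by
    have h1 : (u v).ofLp = U *ᵥ v.ofLp := (matrixOf_mulVec (u : R7 →L[ℝ] R7) v).symm
    rw [h1, dotProduct_mulVec, ← mulVec_transpose, hwv, inner_eq_dotProduct]
  have hne : dotProduct w.ofLp (u v).ofLp ≠ 0 := by
    rw [hdot]; exact inner_self_ne_zero.2 hv
  have hfac : contractMatrix (phi0.compContinuousLinearMap (u : R7 →L[ℝ] R7)) v + vecMulVec v v
      = Uᵀ * (contractMatrix phi0 (u v) + vecMulVec w w) * U := by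
    rw [contractMatrix_comp, mul_add, add_mul, mul_vecMulVec, vecMulVec_mul, ← mulVec_transpose,
      hwv]
    rfl
  rw [formDet, hfac, det_mul, det_mul, det_transpose, mul_pow, mul_pow,
    det_contractMatrix_phi0_sq _ _ hne, hdot, inner_eq_dotProduct (u v)]
  ring

/-- The quadratic form `|det u| |u v|²` recovered from `η = u^* φ₀`. -/
def formQuad (η : R7 [⋀^Fin 3]→L[ℝ] ℝ) (v : R7) : ℝ :=
  (formDet η v ^ 2 / inner ℝ v v ^ 4) ^ (1 / 4 : ℝ)

theorem rpow_natCast_root {a : ℝ} (ha : 0 ≤ a) (n : ℕ) (hn : n ≠ 0) :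
    (a ^ n) ^ (1 / n : ℝ) = a := by
  rw [← Real.rpow_natCast, ← Real.rpow_mul ha, mul_one_div_cancel (by exact_mod_cast hn),
    Real.rpow_one]

theorem det_matrixOf_ne_zero (u : R7 ≃L[ℝ] R7) : (matrixOf (u : R7 →L[ℝ] R7)).det ≠ 0 := by
  intro h0
  have := congrArg Matrix.det (matrixOf_symm_mul u)
  rw [Matrix.det_mul, h0, mul_zero, Matrix.det_one] at this
  exact zero_ne_one this

theorem formDet_sq_div (u : R7 ≃L[ℝ] R7) (v : R7) (hv : v ≠ 0) :
    formDet (phi0.compContinuousLinearMap (u : R7 →L[ℝ] R7)) v ^ 2 / inner ℝ v v ^ 4 =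
      (|(matrixOf (u : R7 →L[ℝ] R7)).det| * inner ℝ (u v) (u v)) ^ 4 := by
  rw [formDet_sq u v hv, mul_pow, Even.pow_abs (by decide)]
  have h : (inner ℝ v v : ℝ) ≠ 0 := inner_self_ne_zero.2 hv
  field_simp

theorem formQuad_eq (u : R7 ≃L[ℝ] R7) (v : R7) (hv : v ≠ 0) :
    formQuad (phi0.compContinuousLinearMap (u : R7 →L[ℝ] R7)) v =
      |(matrixOf (u : R7 →L[ℝ] R7)).det| * inner ℝ (u v) (u v) := by
  rw [formQuad, formDet_sq_div u v hv]
  exact_mod_cast rpow_natCast_root (mul_nonneg (abs_nonneg _) real_inner_self_nonneg) 4 (by norm_num)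

theorem contDiff_contractMatrix_apply (v : R7) (i j : Fin 7) :
    ContDiff ℝ ∞ fun η : R7 [⋀^Fin 3]→L[ℝ] ℝ => contractMatrix η v i j := by
  have : (fun η : R7 [⋀^Fin 3]→L[ℝ] ℝ => contractMatrix η v i j)
      = ContinuousAlternatingMap.apply ℝ R7 ℝ ![v, e7 i, e7 j] := rfl
  rw [this]
  exact ContinuousLinearMap.contDiff _

theorem contDiffAt_matrix_det {E : Type*} [NormedAddCommGroup E] [NormedSpace ℝ E] {n : ℕ}
    {A : E → Matrix (Fin n) (Fin n) ℝ} {x : E}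
    (h : ∀ i j, ContDiffAt ℝ ∞ (fun y => A y i j) x) : ContDiffAt ℝ ∞ (fun y => (A y).det) x := by
  simp only [Matrix.det_apply']
  refine ContDiffAt.sum fun σ _ => contDiffAt_const.mul ?_
  exact contDiffAt_prod fun i _ => h _ _

theorem contDiffAt_formQuad (u : R7 ≃L[ℝ] R7) (v : R7) (hv : v ≠ 0) :
    ContDiffAt ℝ ∞ (fun η => formQuad η v) (phi0.compContinuousLinearMap (u : R7 →L[ℝ] R7)) := by
  unfold formQuad
  refine ContDiffAt.rpow_const_of_ne ?_ ?_
  · refine ContDiffAt.div_const (ContDiffAt.pow ?_ 2) _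
    refine contDiffAt_matrix_det fun i j => ?_
    simp only [Matrix.add_apply]
    exact (contDiff_contractMatrix_apply v i j).contDiffAt.add contDiffAt_const
  · rw [formDet_sq_div u v hv]
    refine pow_ne_zero _ (mul_ne_zero (abs_ne_zero.2 (det_matrixOf_ne_zero u)) ?_)
    exact inner_self_ne_zero.2 (by simpa using hv)

/-- The polarization of `formQuad`. -/
def formGram (η : R7 [⋀^Fin 3]→L[ℝ] ℝ) : Matrix (Fin 7) (Fin 7) ℝ :=
  Matrix.of fun i j => (formQuad η (e7 i + e7 j) - formQuad η (e7 i) - formQuad η (e7 j)) / 2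

theorem e7_ne_zero (i : Fin 7) : e7 i ≠ 0 := by
  simp [e7]

theorem e7_add_ne_zero (i j : Fin 7) : e7 i + e7 j ≠ 0 := by
  intro h
  have h1 := congrArg (fun v : R7 => v i) h
  simp only [e7, PiLp.add_apply, PiLp.single_apply, PiLp.zero_apply] at h1
  split_ifs at h1 <;> norm_num at h1

theorem formGram_apply (u : R7 ≃L[ℝ] R7) (i j : Fin 7) :
    formGram (phi0.compContinuousLinearMap (u : R7 →L[ℝ] R7)) i j =
      |(matrixOf (u : R7 →L[ℝ] R7)).det| * inner ℝ (u (e7 i)) (u (e7 j)) := by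
  rw [formGram, Matrix.of_apply, formQuad_eq u _ (e7_ne_zero i), formQuad_eq u _ (e7_ne_zero j),
    formQuad_eq u _ (e7_add_ne_zero i j), map_add, real_inner_add_add_self]
  ring

/-- The matrix is `|det u| uᵀ u`, of size seven. -/
theorem det_formGram (u : R7 ≃L[ℝ] R7) :
    (formGram (phi0.compContinuousLinearMap (u : R7 →L[ℝ] R7))).det =
      |(matrixOf (u : R7 →L[ℝ] R7)).det| ^ 9 := by
  set U := matrixOf (u : R7 →L[ℝ] R7) with hU
  have h : formGram (phi0.compContinuousLinearMap (u : R7 →L[ℝ] R7)) =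
      |U.det| • (U.transpose * U) := by
    ext i j
    rw [formGram_apply, ← hU]
    simp [Matrix.mul_apply, PiLp.inner_apply, hU, matrixOf, mul_comm]
  rw [h, Matrix.det_smul, Matrix.det_mul, Matrix.det_transpose, ← abs_mul_abs_self U.det]
  simp only [Fintype.card_fin]
  ring

/-- The metric coefficients determined by a three-form. -/
def formMetric (η : R7 [⋀^Fin 3]→L[ℝ] ℝ) (i j : Fin 7) : ℝ :=
  formGram η i j / (formGram η).det ^ (1 / 9 : ℝ)

theorem formMetric_eq (u : R7 ≃L[ℝ] R7) (i j : Fin 7) :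
    formMetric (phi0.compContinuousLinearMap (u : R7 →L[ℝ] R7)) i j =
      inner ℝ (u (e7 i)) (u (e7 j)) := by
  have h := rpow_natCast_root (abs_nonneg (matrixOf (u : R7 →L[ℝ] R7)).det) 9 (by norm_num)
  have h0 := abs_ne_zero.2 (det_matrixOf_ne_zero u)
  norm_cast at h
  rw [formMetric, formGram_apply, det_formGram]
  rw [h]
  field_simp

/-- The metric depends smoothly on the three-form: both radicands are nonzero at `u^* φ₀`. -/
theorem contDiffAt_formMetric (u : R7 ≃L[ℝ] R7) (i j : Fin 7) :
    ContDiffAt ℝ ∞ (fun η => formMetric η i j)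
      (phi0.compContinuousLinearMap (u : R7 →L[ℝ] R7)) := by
  have h0 := abs_ne_zero.2 (det_matrixOf_ne_zero u)
  have hG : ∀ i j, ContDiffAt ℝ ∞ (fun η => formGram η i j)
      (phi0.compContinuousLinearMap (u : R7 →L[ℝ] R7)) := fun i j => by
    simp only [formGram, Matrix.of_apply]
    exact (((contDiffAt_formQuad u _ (e7_add_ne_zero i j)).sub
      (contDiffAt_formQuad u _ (e7_ne_zero i))).sub
      (contDiffAt_formQuad u _ (e7_ne_zero j))).div_const _
  have hd : (formGram (phi0.compContinuousLinearMap (u : R7 →L[ℝ] R7))).det ≠ 0 := by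
    rw [det_formGram]; exact pow_ne_zero _ h0
  unfold formMetric
  refine (hG i j).div ((contDiffAt_matrix_det hG).rpow_const_of_ne hd) ?_
  rw [det_formGram]
  positivity

/-- A map into a normed space is smooth if its compositions with a finite separating family of
continuous linear functionals are. -/
theorem contDiffOn_of_separating {E F ι : Type*} [NormedAddCommGroup E] [NormedSpace ℝ E]
    [NormedAddCommGroup F] [NormedSpace ℝ F] [Fintype ι] (l : ι → F →L[ℝ] ℝ)
    (hl : ∀ x : F, (∀ i, l i x = 0) → x = 0) {f : E → F} {s : Set E}
    (h : ∀ i, ContDiffOn ℝ ∞ (fun x => l i (f x)) s) : ContDiffOn ℝ ∞ f s := by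
  let A : F →ₗ[ℝ] (ι → ℝ) := LinearMap.pi fun i => (l i).toLinearMap
  have hA : LinearMap.ker A = ⊥ := by
    rw [LinearMap.ker_eq_bot']
    intro x hx
    exact hl x fun i => congrFun hx i
  obtain ⟨B, hB⟩ := A.exists_leftInverse_of_injective hA
  have hf : f = fun x => B.toContinuousLinearMap (fun i => l i (f x)) := by
    ext x
    exact (LinearMap.congr_fun hB (f x)).symm
  rw [hf]
  exact (ContinuousLinearMap.contDiff _).comp_contDiffOn (contDiffOn_pi.2 h)

theorem alternatingMap_ext_e7 {k : ℕ} (η : R7 [⋀^Fin k]→L[ℝ] ℝ)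
    (h : ∀ s : Fin k → Fin 7, η (fun i => e7 (s i)) = 0) : η = 0 := by
  have : η.toAlternatingMap = 0 := by
    refine Module.Basis.ext_alternating (EuclideanSpace.basisFun (Fin 7) ℝ).toBasis fun s _ => ?_
    simpa using h s
  ext v
  exact congrArg (fun ζ : R7 [⋀^Fin k]→ₗ[ℝ] ℝ => ζ v) this

/-! ### Charts -/

section Charts

variable {M : Type*} [TopologicalSpace M] [ChartedSpace R7 M]

/-- The derivative at `p` of the chart around `x₀`, as an endomorphism of the model space. -/
def toChart (x₀ p : M) : R7 →L[ℝ] R7 := mfderiv (𝓡 7) 𝓘(ℝ, R7) (extChartAt (𝓡 7) x₀) p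

/-- The derivative at `y` of the inverse of the chart around `x₀`, as an endomorphism of the model
space. -/
def ofChart (x₀ : M) (y : R7) : R7 →L[ℝ] R7 :=
  mfderiv 𝓘(ℝ, R7) (𝓡 7) (extChartAt (𝓡 7) x₀).symm y

theorem isOpen_chart_target (x₀ : M) : IsOpen (extChartAt (𝓡 7) x₀).target :=
  isOpen_extChartAt_target x₀

variable [IsManifold (𝓡 7) ∞ M]

theorem toChart_ofChart {x₀ : M} {y : R7} (hy : y ∈ (extChartAt (𝓡 7) x₀).target) (v : R7) :
    toChart x₀ ((extChartAt (𝓡 7) x₀).symm y) (ofChart x₀ y v) = v := by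
  have : IsManifold (𝓡 7) 1 M := .of_le (n := ∞) (by decide)
  have h := mfderiv_extChartAt_comp_mfderivWithin_extChartAt_symm (I := 𝓡 7) hy
  simp only [ModelWithCorners.range_eq_univ, mfderivWithin_univ] at h
  exact congrArg (fun A : R7 →L[ℝ] R7 => A v) h

theorem ofChart_toChart {x₀ : M} {y : R7} (hy : y ∈ (extChartAt (𝓡 7) x₀).target) (v : R7) :
    ofChart x₀ y (toChart x₀ ((extChartAt (𝓡 7) x₀).symm y) v) = v := by
  have : IsManifold (𝓡 7) 1 M := .of_le (n := ∞) (by decide)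
  have h := mfderivWithin_extChartAt_symm_comp_mfderiv_extChartAt (I := 𝓡 7) hy
  simp only [ModelWithCorners.range_eq_univ, mfderivWithin_univ] at h
  exact congrArg (fun A : R7 →L[ℝ] R7 => A v) h

theorem ofChart_toChart' {x₀ p : M} (hp : p ∈ (extChartAt (𝓡 7) x₀).source) (v : R7) :
    ofChart x₀ (extChartAt (𝓡 7) x₀ p) (toChart x₀ p v) = v := by
  have h := ofChart_toChart ((extChartAt (𝓡 7) x₀).map_source hp) v
  rwa [(extChartAt (𝓡 7) x₀).left_inv hp] at h

theorem toChart_ofChart' {x₀ p : M} (hp : p ∈ (extChartAt (𝓡 7) x₀).source) (v : R7) :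
    toChart x₀ p (ofChart x₀ (extChartAt (𝓡 7) x₀ p) v) = v := by
  have h := toChart_ofChart ((extChartAt (𝓡 7) x₀).map_source hp) v
  rwa [(extChartAt (𝓡 7) x₀).left_inv hp] at h

/-- The derivative of the inverse chart as a linear isomorphism. -/
def ofChartEquiv {x₀ : M} {y : R7} (hy : y ∈ (extChartAt (𝓡 7) x₀).target) : R7 ≃L[ℝ] R7 :=
  ContinuousLinearEquiv.equivOfInverse (ofChart x₀ y) (toChart x₀ ((extChartAt (𝓡 7) x₀).symm y))
    (toChart_ofChart hy) (ofChart_toChart hy)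

/-- The transition map between two charts. -/
def transition (x₀ x₁ : M) (y : R7) : R7 := extChartAt (𝓡 7) x₁ ((extChartAt (𝓡 7) x₀).symm y)

/-- The part of the target of the chart around `x₀` that lies in the chart around `x₁`. -/
def overlap (x₀ x₁ : M) : Set R7 :=
  (extChartAt (𝓡 7) x₀).target ∩ (extChartAt (𝓡 7) x₀).symm ⁻¹' (extChartAt (𝓡 7) x₁).source

theorem isOpen_overlap (x₀ x₁ : M) : IsOpen (overlap x₀ x₁) :=
  (continuousOn_extChartAt_symm x₀).isOpen_inter_preimage (isOpen_chart_target x₀)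
    (isOpen_extChartAt_source x₁)

theorem contDiffOn_transition (x₀ x₁ : M) : ContDiffOn ℝ ∞ (transition x₀ x₁) (overlap x₀ x₁) := by
  have h := contDiffOn_ext_coord_change (I := 𝓡 7) (n := ∞) x₁ x₀
  rwa [PartialEquiv.trans_source, PartialEquiv.symm_source] at h

theorem mdifferentiableAt_extChartAt_symm' {x₀ : M} {y : R7}
    (hy : y ∈ (extChartAt (𝓡 7) x₀).target) :
    MDifferentiableAt 𝓘(ℝ, R7) (𝓡 7) (extChartAt (𝓡 7) x₀).symm y := by
  have h := (contMDiffOn_extChartAt_symm (I := 𝓡 7) (n := ∞) x₀ y hy).contMDiffAt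
    ((isOpen_chart_target x₀).mem_nhds hy)
  exact h.mdifferentiableAt (by simp)

theorem mdifferentiableAt_extChartAt' {x₀ p : M} (hp : p ∈ (extChartAt (𝓡 7) x₀).source) :
    MDifferentiableAt (𝓡 7) 𝓘(ℝ, R7) (extChartAt (𝓡 7) x₀) p := by
  rw [extChartAt_source] at hp
  exact (contMDiffAt_extChartAt' (I := 𝓡 7) (n := ∞) hp).mdifferentiableAt (by simp)

theorem fderiv_transition {x₀ x₁ : M} {y : R7} (hy : y ∈ overlap x₀ x₁) (v : R7) :
    fderiv ℝ (transition x₀ x₁) y v =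
      toChart x₁ ((extChartAt (𝓡 7) x₀).symm y) (ofChart x₀ y v) := by
  have h := mfderiv_comp y (mdifferentiableAt_extChartAt' hy.2)
    (mdifferentiableAt_extChartAt_symm' hy.1)
  rw [← mfderiv_eq_fderiv]
  exact congrArg (fun A : R7 →L[ℝ] R7 => A v) h

theorem mem_overlap {x₀ x₁ p : M} (h₀ : p ∈ (extChartAt (𝓡 7) x₀).source)
    (h₁ : p ∈ (extChartAt (𝓡 7) x₁).source) : extChartAt (𝓡 7) x₀ p ∈ overlap x₀ x₁ := by
  refine ⟨(extChartAt (𝓡 7) x₀).map_source h₀, ?_⟩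
  rw [Set.mem_preimage, (extChartAt (𝓡 7) x₀).left_inv h₀]
  exact h₁

theorem fderiv_transition_toChart {x₀ x₁ p : M} (h₀ : p ∈ (extChartAt (𝓡 7) x₀).source)
    (h₁ : p ∈ (extChartAt (𝓡 7) x₁).source) (v : R7) :
    fderiv ℝ (transition x₀ x₁) (extChartAt (𝓡 7) x₀ p) (toChart x₀ p v) = toChart x₁ p v := by
  rw [fderiv_transition (mem_overlap h₀ h₁), ofChart_toChart' h₀,
    (extChartAt (𝓡 7) x₀).left_inv h₀]

theorem apply_eq_formInChart {k : ℕ} (α : ∀ p : M, TangentSpace (𝓡 7) p [⋀^Fin k]→L[ℝ] ℝ)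
    {x₀ p : M} (hp : p ∈ (extChartAt (𝓡 7) x₀).source) (v : Fin k → R7) :
    α p v = formInChart α x₀ (extChartAt (𝓡 7) x₀ p) (fun i => toChart x₀ p (v i)) := by
  have h : ∀ (q : M) (a : Fin k → R7), q = p → a = v → α p v = α q a := by
    rintro q a rfl rfl; rfl
  exact h _ _ ((extChartAt (𝓡 7) x₀).left_inv hp) (funext fun i => ofChart_toChart' hp (v i))

end Charts

/-! ### The metric and the coassociative form in charts -/

namespace G2Structure

variable {M : Type*} [TopologicalSpace M] [ChartedSpace R7 M] (G : G2Structure M)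
variable [IsManifold (𝓡 7) ∞ M]

/-- The isomorphism with `ℝ⁷` that identifies the coordinate expression of `φ` with `φ₀`. -/
def chartFrame {x₀ : M} {y : R7} (hy : y ∈ (extChartAt (𝓡 7) x₀).target) : R7 ≃L[ℝ] R7 :=
  (ofChartEquiv hy).trans (G.frame ((extChartAt (𝓡 7) x₀).symm y))

theorem frame_spec (p : M) : G.form p =
    phi0.compContinuousLinearMap (G.frame p : TangentSpace (𝓡 7) p →L[ℝ] R7) :=
  (G.exists_frame p).choose_spec

theorem formInChart_form {x₀ : M} {y : R7} (hy : y ∈ (extChartAt (𝓡 7) x₀).target) :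
    formInChart G.form x₀ y = phi0.compContinuousLinearMap (G.chartFrame hy : R7 →L[ℝ] R7) := by
  rw [formInChart, frame_spec]
  rfl

theorem formInChart_starForm {x₀ : M} {y : R7} (hy : y ∈ (extChartAt (𝓡 7) x₀).target) :
    formInChart G.starForm x₀ y =
      starPhi0.compContinuousLinearMap (G.chartFrame hy : R7 →L[ℝ] R7) := rfl

theorem metricInChart_eq {x₀ : M} {y : R7} (hy : y ∈ (extChartAt (𝓡 7) x₀).target) (v w : R7) :
    G.metricInChart x₀ y v w = inner ℝ (G.chartFrame hy v) (G.chartFrame hy w) := rfl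

theorem metric_eq_metricInChart {x₀ p : M} (hp : p ∈ (extChartAt (𝓡 7) x₀).source) (v w : R7) :
    G.metric p v w =
      G.metricInChart x₀ (extChartAt (𝓡 7) x₀ p) (toChart x₀ p v) (toChart x₀ p w) := by
  have h : ∀ (q : M) (a b : R7), q = p → a = v → b = w → G.metric p v w = G.metric q a b := by
    rintro q a b rfl rfl rfl; rfl
  exact h _ _ _ ((extChartAt (𝓡 7) x₀).left_inv hp) (ofChart_toChart' hp v) (ofChart_toChart' hp w)

/-- A function of three-forms that is smooth at every `u^* φ₀` is smooth along `φ`, although the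
frames `u` need not be smooth. -/
theorem contDiffOn_comp_formInChart (x₀ : M) {F : R7 [⋀^Fin 3]→L[ℝ] ℝ → ℝ}
    (hF : ∀ u : R7 ≃L[ℝ] R7, ContDiffAt ℝ ∞ F (phi0.compContinuousLinearMap (u : R7 →L[ℝ] R7))) :
    ContDiffOn ℝ ∞ (fun y => F (formInChart G.form x₀ y)) (extChartAt (𝓡 7) x₀).target := by
  intro y hy
  have h1 := hF (G.chartFrame hy)
  rw [← formInChart_form G hy] at h1
  exact ContDiffAt.comp_contDiffWithinAt y h1 (G.smooth x₀ y hy)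

theorem metricInChart_e7_eq_formMetric {x₀ : M} {y : R7} (hy : y ∈ (extChartAt (𝓡 7) x₀).target)
    (i j : Fin 7) :
    G.metricInChart x₀ y (e7 i) (e7 j) = formMetric (formInChart G.form x₀ y) i j := by
  rw [metricInChart_eq G hy, formInChart_form G hy, formMetric_eq]

theorem contDiffOn_metricInChart_e7 (x₀ : M) (i j : Fin 7) :
    ContDiffOn ℝ ∞ (fun y => G.metricInChart x₀ y (e7 i) (e7 j)) (extChartAt (𝓡 7) x₀).target :=
  ContDiffOn.congr (G.contDiffOn_comp_formInChart x₀ fun u => contDiffAt_formMetric u i j)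
    fun _ hy => G.metricInChart_e7_eq_formMetric hy i j

/-- The metric in a chart, as a self-adjoint operator of the Euclidean space `ℝ⁷`. -/
def metricOp (x₀ : M) (y : R7) : R7 →L[ℝ] R7 :=
  ∑ i, ∑ j, G.metricInChart x₀ y (e7 i) (e7 j) •
    (EuclideanSpace.proj (𝕜 := ℝ) j).smulRight (e7 i)

theorem contDiffOn_metricOp (x₀ : M) :
    ContDiffOn ℝ ∞ (G.metricOp x₀) (extChartAt (𝓡 7) x₀).target := by
  unfold metricOp
  exact ContDiffOn.sum fun i _ => ContDiffOn.sum fun j _ =>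
    (G.contDiffOn_metricInChart_e7 x₀ i j).smul contDiffOn_const

theorem inner_metricOp {x₀ : M} {y : R7} (hy : y ∈ (extChartAt (𝓡 7) x₀).target) (v w : R7) :
    inner ℝ (G.metricOp x₀ y v) w = G.metricInChart x₀ y v w := by
  have h1 : G.metricInChart x₀ y v w =
      ∑ i, ∑ j, v j * w i * G.metricInChart x₀ y (e7 i) (e7 j) := by
    conv_lhs => rw [metricInChart_eq G hy, ← sum_smul_e7 v, ← sum_smul_e7 w]
    simp only [map_sum, map_smul, sum_inner, inner_sum, inner_smul_left, inner_smul_right,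
      metricInChart_eq G hy]
    refine Finset.sum_congr rfl fun i _ => ?_
    rw [Finset.mul_sum]
    refine Finset.sum_congr rfl fun j _ => ?_
    rw [real_inner_comm]
    simp only [conj_trivial]
    ring
  rw [h1, metricOp]
  simp only [_root_.sum_apply, sum_inner]
  refine Finset.sum_congr rfl fun i _ => Finset.sum_congr rfl fun j _ => ?_
  simp [inner_smul_left, EuclideanSpace.inner_single_left]
  ring

theorem metricInChart_symm (x₀ : M) (y v w : R7) :
    G.metricInChart x₀ y v w = G.metricInChart x₀ y w v := real_inner_comm _ _

theorem isUnit_metricOp {x₀ : M} {y : R7} (hy : y ∈ (extChartAt (𝓡 7) x₀).target) :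
    IsUnit (G.metricOp x₀ y) := by
  rw [ContinuousLinearMap.isUnit_iff_bijective]
  have hinj : Function.Injective (G.metricOp x₀ y).toLinearMap := by
    rw [← LinearMap.ker_eq_bot, LinearMap.ker_eq_bot']
    intro v hv
    have h := G.inner_metricOp hy v v
    rw [show G.metricOp x₀ y v = 0 from hv, inner_zero_left, metricInChart_eq G hy] at h
    simpa using inner_self_eq_zero.1 h.symm
  exact ⟨hinj, LinearMap.injective_iff_surjective.1 hinj⟩

/-- The inverse of the metric operator. -/
def metricInv (x₀ : M) (y : R7) : R7 →L[ℝ] R7 := Ring.inverse (G.metricOp x₀ y)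

theorem metricInv_metricOp {x₀ : M} {y : R7} (hy : y ∈ (extChartAt (𝓡 7) x₀).target) (v : R7) :
    G.metricInv x₀ y (G.metricOp x₀ y v) = v :=
  congrArg (fun A : R7 →L[ℝ] R7 => A v) (Ring.inverse_mul_cancel _ (G.isUnit_metricOp hy))

theorem metricOp_metricInv {x₀ : M} {y : R7} (hy : y ∈ (extChartAt (𝓡 7) x₀).target) (v : R7) :
    G.metricOp x₀ y (G.metricInv x₀ y v) = v :=
  congrArg (fun A : R7 →L[ℝ] R7 => A v) (Ring.mul_inverse_cancel _ (G.isUnit_metricOp hy))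

theorem contDiffOn_metricInv (x₀ : M) :
    ContDiffOn ℝ ∞ (G.metricInv x₀) (extChartAt (𝓡 7) x₀).target := by
  intro y hy
  obtain ⟨A, hA⟩ := G.isUnit_metricOp hy
  have h := contDiffAt_ringInverse ℝ A (n := ∞)
  rw [hA] at h
  exact h.comp_contDiffWithinAt y (G.contDiffOn_metricOp x₀ y hy)

/-- The form `*φ` is smooth, by the formula `starPhi0_apply` read in the frames of the structure. -/
theorem contDiffOn_formInChart_starForm (x₀ : M) :
    ContDiffOn ℝ ∞ (formInChart G.starForm x₀) (extChartAt (𝓡 7) x₀).target := by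
  refine contDiffOn_of_separating
    (fun s : Fin 4 → Fin 7 => ContinuousAlternatingMap.apply ℝ R7 ℝ (fun i => e7 (s i)))
    (fun η h => alternatingMap_ext_e7 η h) fun s => ?_
  -- the cross product of two basis vectors, as a field of vectors in the chart
  set c : R7 → R7 := fun y => G.metricInv x₀ y (∑ k, formInChart G.form x₀ y
    ![e7 (s 2), e7 (s 3), e7 k] • e7 k) with hc
  have hφ : ∀ v : Fin 3 → R7, ContDiffOn ℝ ∞ (fun y => formInChart G.form x₀ y v)
      (extChartAt (𝓡 7) x₀).target := fun v =>
    (ContinuousAlternatingMap.apply ℝ R7 ℝ v).contDiff.comp_contDiffOn (G.smooth x₀)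
  have hcs : ContDiffOn ℝ ∞ c (extChartAt (𝓡 7) x₀).target :=
    (G.contDiffOn_metricInv x₀).clm_apply
      (ContDiffOn.sum fun k _ => (hφ _).smul contDiffOn_const)
  have hφc : ContDiffOn ℝ ∞ (fun y => ∑ k, formInChart G.form x₀ y ![e7 (s 0), e7 (s 1), e7 k]
      * c y k) (extChartAt (𝓡 7) x₀).target :=
    ContDiffOn.sum fun k _ => (hφ _).mul
      ((EuclideanSpace.proj (𝕜 := ℝ) k).contDiff.comp_contDiffOn hcs)
  have hm := fun i j => G.contDiffOn_metricInChart_e7 x₀ i j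
  refine (((hφc.sub ((hm (s 0) (s 2)).mul (hm (s 1) (s 3)))).add
    ((hm (s 0) (s 3)).mul (hm (s 1) (s 2))))).congr fun y hy => ?_
  set u := G.chartFrame hy with hu
  have hev : ∀ a b d : R7, formInChart G.form x₀ y ![a, b, d] = phi0 ![u a, u b, u d] := by
    intro a b d
    rw [formInChart_form G hy, ContinuousAlternatingMap.compContinuousLinearMap_apply]
    congr 1
    ext k
    fin_cases k <;> rfl
  have hlin : ∀ a b d : R7, phi0 ![u a, u b, u d] = ∑ k, phi0 ![u a, u b, u (e7 k)] * d k := by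
    intro a b d
    simp only [← inner_cross]
    conv_lhs => rw [← sum_smul_e7 d]
    simp only [map_sum, map_smul, inner_sum, inner_smul_right]
    exact Finset.sum_congr rfl fun k _ => mul_comm _ _
  have hcross : u (c y) = cross (u (e7 (s 2))) (u (e7 (s 3))) := by
    refine ext_inner_right ℝ fun z => ?_
    obtain ⟨d, rfl⟩ := u.surjective z
    rw [inner_cross, hlin, ← metricInChart_eq G hy, ← G.inner_metricOp hy, hc,
      G.metricOp_metricInv hy, sum_inner]
    refine Finset.sum_congr rfl fun k _ => ?_
    rw [hev, inner_smul_left]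
    simp [EuclideanSpace.inner_single_left]
  change formInChart G.starForm x₀ y (fun i => e7 (s i)) = _
  have hlhs : formInChart G.starForm x₀ y (fun i => e7 (s i)) =
      starPhi0 ![u (e7 (s 0)), u (e7 (s 1)), u (e7 (s 2)), u (e7 (s 3))] := by
    rw [formInChart_starForm G hy, ContinuousAlternatingMap.compContinuousLinearMap_apply]
    congr 1
    ext k
    fin_cases k <;> rfl
  rw [hlhs, starPhi0_apply, ← hcross, hlin]
  simp only [hev, metricInChart_eq G hy]
  rfl

end G2Structure

/-! ### Christoffel symbols -/

namespace G2Structure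

variable {M : Type*} [TopologicalSpace M] [ChartedSpace R7 M] (G : G2Structure M)
variable [IsManifold (𝓡 7) ∞ M]

theorem differentiableAt_metricOp {x₀ : M} {y : R7} (hy : y ∈ (extChartAt (𝓡 7) x₀).target) :
    DifferentiableAt ℝ (G.metricOp x₀) y :=
  ((G.contDiffOn_metricOp x₀).contDiffAt ((isOpen_chart_target x₀).mem_nhds hy)).differentiableAt
    (by simp)

theorem fderiv_metricInChart {x₀ : M} {y : R7} (hy : y ∈ (extChartAt (𝓡 7) x₀).target)
    (u v w : R7) : fderiv ℝ (fun y' => G.metricInChart x₀ y' v w) y u =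
      inner ℝ (fderiv ℝ (G.metricOp x₀) y u v) w := by
  have h1 : (fun y' => G.metricInChart x₀ y' v w) =ᶠ[𝓝 y]
      fun y' => inner ℝ (G.metricOp x₀ y' v) w := by
    filter_upwards [(isOpen_chart_target x₀).mem_nhds hy] with y' hy'
    exact (G.inner_metricOp hy' v w).symm
  have h2 := (((G.differentiableAt_metricOp hy).hasFDerivAt.clm_apply
    (hasFDerivAt_const v y))).inner ℝ (hasFDerivAt_const w y)
  rw [h1.fderiv_eq, h2.fderiv]
  simp

/-- The Euclidean inner product of `ℝ⁷` as a continuous bilinear map. -/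
def dotL : R7 →L[ℝ] R7 →L[ℝ] ℝ :=
  ∑ j, (EuclideanSpace.proj (𝕜 := ℝ) j).smulRight (EuclideanSpace.proj (𝕜 := ℝ) j)

theorem dotL_apply (v w : R7) : dotL v w = inner ℝ v w := by
  simp [dotL, PiLp.inner_apply, mul_comm]

/-- Christoffel symbols of the first kind, as a vector: the Euclidean inner product with `w` is
`G.christoffel x₀ y u v w`. -/
def christoffelOne (x₀ : M) (y : R7) : R7 →L[ℝ] R7 →L[ℝ] R7 :=
  (1 / 2 : ℝ) • (fderiv ℝ (G.metricOp x₀) y + (fderiv ℝ (G.metricOp x₀) y).flip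
    - ∑ k, ((ContinuousLinearMap.smulRightL ℝ R7 R7).flip (e7 k)).comp
        (dotL.comp (fderiv ℝ (G.metricOp x₀) y (e7 k))))

theorem sum_inner_smul_e7 (f : R7 →L[ℝ] ℝ) (w : R7) : inner ℝ (∑ k, f (e7 k) • e7 k) w = f w := by
  conv_rhs => rw [← sum_smul_e7 w]
  simp only [sum_inner, inner_smul_left, map_sum, map_smul, EuclideanSpace.inner_single_left]
  refine Finset.sum_congr rfl fun k _ => ?_
  simp
  ring

theorem inner_christoffelOne {x₀ : M} {y : R7} (hy : y ∈ (extChartAt (𝓡 7) x₀).target)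
    (u v w : R7) : inner ℝ (G.christoffelOne x₀ y u v) w = G.christoffel x₀ y u v w := by
  have h := sum_inner_smul_e7 ((dotL.flip v).comp
    ((ContinuousLinearMap.apply ℝ R7 u).comp (fderiv ℝ (G.metricOp x₀) y))) w
  simp only [ContinuousLinearMap.comp_apply, ContinuousLinearMap.flip_apply, dotL_apply,
    ContinuousLinearMap.apply_apply] at h
  rw [christoffel, G.fderiv_metricInChart hy, G.fderiv_metricInChart hy, G.fderiv_metricInChart hy,
    ← h, christoffelOne]
  simp only [_root_.smul_apply, _root_.sub_apply,
    _root_.add_apply, ContinuousLinearMap.flip_apply, _root_.sum_apply,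
    ContinuousLinearMap.comp_apply, inner_smul_left, inner_sub_left, inner_add_left,
    ContinuousLinearMap.smulRightL_apply_apply, dotL_apply,
    ContinuousLinearMap.smulRight_apply]
  simp

/-- Christoffel symbols of the second kind. -/
def christoffelTwo (x₀ : M) (y : R7) : R7 →L[ℝ] R7 →L[ℝ] R7 :=
  (ContinuousLinearMap.compL ℝ R7 R7 R7 (G.metricInv x₀ y)).comp (G.christoffelOne x₀ y)

theorem metricOp_christoffelTwo {x₀ : M} {y : R7} (hy : y ∈ (extChartAt (𝓡 7) x₀).target)
    (u v : R7) : G.metricOp x₀ y (G.christoffelTwo x₀ y u v) = G.christoffelOne x₀ y u v :=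
  G.metricOp_metricInv hy _

theorem contDiffOn_christoffelOne (x₀ : M) :
    ContDiffOn ℝ ∞ (G.christoffelOne x₀) (extChartAt (𝓡 7) x₀).target := by
  have h : ContDiffOn ℝ ∞ (fderiv ℝ (G.metricOp x₀)) (extChartAt (𝓡 7) x₀).target :=
    (G.contDiffOn_metricOp x₀).fderiv_of_isOpen (isOpen_chart_target x₀) (by simp)
  unfold christoffelOne
  refine ContDiffOn.const_smul _ ((h.add ?_).sub (ContDiffOn.sum fun k _ => ?_))
  · exact contDiffOn_clm_apply.2 fun u => contDiffOn_clm_apply.2 fun v =>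
      (h.clm_apply (contDiffOn_const (c := v))).clm_apply (contDiffOn_const (c := u))
  · exact contDiffOn_const.clm_comp (contDiffOn_const.clm_comp (h.clm_apply contDiffOn_const))

theorem contDiffOn_christoffelTwo (x₀ : M) :
    ContDiffOn ℝ ∞ (G.christoffelTwo x₀) (extChartAt (𝓡 7) x₀).target :=
  ((ContinuousLinearMap.contDiff _).comp_contDiffOn (G.contDiffOn_metricInv x₀)).clm_comp
    (G.contDiffOn_christoffelOne x₀)

theorem metricInChart_transition {x₀ x₁ : M} {y : R7} (hy : y ∈ overlap x₀ x₁) (v w : R7) :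
    G.metricInChart x₀ y v w = G.metricInChart x₁ (transition x₀ x₁ y)
      (fderiv ℝ (transition x₀ x₁) y v) (fderiv ℝ (transition x₀ x₁) y w) := by
  rw [fderiv_transition hy, fderiv_transition hy]
  exact G.metric_eq_metricInChart hy.2 _ _

theorem transition_mem_target {x₀ x₁ : M} {y : R7} (hy : y ∈ overlap x₀ x₁) :
    transition x₀ x₁ y ∈ (extChartAt (𝓡 7) x₁).target :=
  (extChartAt (𝓡 7) x₁).map_source hy.2

/-- The transformation law of the Christoffel symbols. -/
theorem christoffel_transition {x₀ x₁ : M} {y : R7} (hy : y ∈ overlap x₀ x₁) (u v w : R7) :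
    G.christoffel x₀ y u v w =
      G.christoffel x₁ (transition x₀ x₁ y) (fderiv ℝ (transition x₀ x₁) y u)
        (fderiv ℝ (transition x₀ x₁) y v) (fderiv ℝ (transition x₀ x₁) y w)
      + inner ℝ (G.metricOp x₁ (transition x₀ x₁ y) (fderiv ℝ (fderiv ℝ (transition x₀ x₁)) y u v))
        (fderiv ℝ (transition x₀ x₁) y w) := by
  set τ := transition x₀ x₁ with hτ
  have hτs : ContDiffAt ℝ ∞ τ y :=
    (contDiffOn_transition x₀ x₁).contDiffAt ((isOpen_overlap x₀ x₁).mem_nhds hy)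
  have hτ1 : HasFDerivAt τ (fderiv ℝ τ y) y := (hτs.differentiableAt (by simp)).hasFDerivAt
  have hτ2 : HasFDerivAt (fderiv ℝ τ) (fderiv ℝ (fderiv ℝ τ) y) y :=
    ((hτs.fderiv_right (m := 1) (by decide)).differentiableAt (by simp)).hasFDerivAt
  have hsymm : ∀ a b, fderiv ℝ (fderiv ℝ τ) y a b = fderiv ℝ (fderiv ℝ τ) y b a :=
    (hτs.isSymmSndFDerivAt (by simp only [minSmoothness_of_isRCLikeNormedField]; decide)).eq
  have hty : τ y ∈ (extChartAt (𝓡 7) x₁).target := transition_mem_target hy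
  have hS := (G.differentiableAt_metricOp hty).hasFDerivAt.comp y hτ1
  have hop : ∀ a b, inner ℝ (G.metricOp x₁ (τ y) a) b = inner ℝ (G.metricOp x₁ (τ y) b) a :=
    fun a b => by rw [G.inner_metricOp hty, G.inner_metricOp hty, metricInChart_symm]
  have key : ∀ a b d : R7, fderiv ℝ (fun y' => G.metricInChart x₀ y' b d) y a =
      fderiv ℝ (fun y' => G.metricInChart x₁ y' (fderiv ℝ τ y b) (fderiv ℝ τ y d)) (τ y)
        (fderiv ℝ τ y a)
      + inner ℝ (G.metricOp x₁ (τ y) (fderiv ℝ (fderiv ℝ τ) y a b)) (fderiv ℝ τ y d)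
      + inner ℝ (G.metricOp x₁ (τ y) (fderiv ℝ (fderiv ℝ τ) y a d)) (fderiv ℝ τ y b) := by
    intro a b d
    have h1 : (fun y' => G.metricInChart x₀ y' b d) =ᶠ[𝓝 y]
        fun y' => inner ℝ ((G.metricOp x₁ ∘ τ) y' (fderiv ℝ τ y' b)) (fderiv ℝ τ y' d) := by
      filter_upwards [(isOpen_overlap x₀ x₁).mem_nhds hy] with y' hy'
      rw [G.metricInChart_transition hy', Function.comp_apply,
        G.inner_metricOp (transition_mem_target hy')]
    have h2 := (hS.clm_apply (hτ2.clm_apply (hasFDerivAt_const b y))).inner ℝ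
      (hτ2.clm_apply (hasFDerivAt_const d y))
    rw [h1.fderiv_eq, h2.fderiv, G.fderiv_metricInChart hty]
    simp only [ContinuousLinearMap.comp_apply, ContinuousLinearMap.prod_apply,
      fderivInnerCLM_apply, _root_.add_apply, ContinuousLinearMap.flip_apply,
      Function.comp_apply, inner_add_left]
    rw [hop _ (fderiv ℝ τ y b)]
    simp
    ring
  rw [christoffel, christoffel, key, key, key]
  rw [hsymm v u, hsymm w u, hsymm w v]
  ring

end G2Structure

/-! ### Curves in the tangent bundle -/

section Bundle

variable {M : Type*} [TopologicalSpace M] [ChartedSpace R7 M] [IsManifold (𝓡 7) ∞ M]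

theorem coordVector_eq (x₀ : M) (X : TangentBundle (𝓡 7) M) :
    G2Structure.coordVector x₀ X = toChart x₀ X.proj X.2 := rfl

theorem trivializationAt_snd_eq {x₀ : M} {X : TangentBundle (𝓡 7) M}
    (h : X.proj ∈ (extChartAt (𝓡 7) x₀).source) :
    (trivializationAt R7 (TangentSpace (𝓡 7) : M → Type _) x₀ X).2 =
      G2Structure.coordVector x₀ X := by
  have : IsManifold (𝓡 7) 1 M := .of_le (n := ∞) (by decide)
  rw [extChartAt_source] at h
  have h1 := TangentBundle.continuousLinearMapAt_trivializationAt (I := 𝓡 7) h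
  have h2 : X.proj ∈ (trivializationAt R7 (TangentSpace (𝓡 7) : M → Type _) x₀).baseSet := h
  have h3 := Bundle.Trivialization.continuousLinearMapAt_apply_of_mem (R := ℝ)
    (trivializationAt R7 (TangentSpace (𝓡 7) : M → Type _) x₀) h2 X.2
  rw [h1] at h3
  exact h3.symm

/-- Smoothness of a map into the tangent bundle, in terms of the components of the vectors in a
chart. -/
theorem contMDiffAt_tangent_iff {n : ℕ∞ω}
    [ContMDiffVectorBundle n R7 (TangentSpace (𝓡 7) : M → Type _) (𝓡 7)]
    {E H N : Type*} [NormedAddCommGroup E] [NormedSpace ℝ E] [TopologicalSpace H]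
    {I : ModelWithCorners ℝ E H} [TopologicalSpace N] [ChartedSpace H N]
    {f : N → TangentBundle (𝓡 7) M} {z : N} {x₀ : M}
    (h : (f z).proj ∈ (extChartAt (𝓡 7) x₀).source) :
    ContMDiffAt I (𝓡 7).tangent n f z ↔
      ContMDiffAt I (𝓡 7) n (fun z => (f z).proj) z ∧
        ContMDiffAt I 𝓘(ℝ, R7) n (fun z => G2Structure.coordVector x₀ (f z)) z := by
  have h' := h
  rw [extChartAt_source] at h'
  have hs : f z ∈ (trivializationAt R7 (TangentSpace (𝓡 7) : M → Type _) x₀).source := by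
    rw [Bundle.Trivialization.mem_source]; exact h'
  refine (Bundle.Trivialization.contMDiffAt_iff
    (e := trivializationAt R7 (TangentSpace (𝓡 7) : M → Type _) x₀) hs).trans ?_
  refine and_congr_right fun h1 => ?_
  refine Filter.EventuallyEq.contMDiffAt_iff ?_
  filter_upwards [h1.continuousAt.preimage_mem_nhds
    ((isOpen_extChartAt_source (I := 𝓡 7) x₀).mem_nhds h)] with y hy
  exact trivializationAt_snd_eq hy

theorem coordVector_transition {x₀ x₁ : M} {X : TangentBundle (𝓡 7) M}
    (h₀ : X.proj ∈ (extChartAt (𝓡 7) x₀).source) (h₁ : X.proj ∈ (extChartAt (𝓡 7) x₁).source) :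
    fderiv ℝ (transition x₀ x₁) (extChartAt (𝓡 7) x₀ X.proj) (G2Structure.coordVector x₀ X) =
      G2Structure.coordVector x₁ X :=
  fderiv_transition_toChart h₀ h₁ _

theorem tangent_ext {x₀ : M} {X Y : TangentBundle (𝓡 7) M} (h : X.proj = Y.proj)
    (h₀ : X.proj ∈ (extChartAt (𝓡 7) x₀).source)
    (hc : G2Structure.coordVector x₀ X = G2Structure.coordVector x₀ Y) : X = Y := by
  obtain ⟨p, v⟩ := X
  obtain ⟨q, w⟩ := Y
  obtain rfl : p = q := h
  have : v = w := by
    have h1 := ofChart_toChart' h₀ v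
    have h2 := ofChart_toChart' h₀ w
    rw [← h1, ← h2]
    exact congrArg _ hc
  rw [this]

/-- The tangent vector at the point with coordinates `y` whose components are `v`. -/
def tangentOfChart (x₀ : M) (y v : R7) : TangentBundle (𝓡 7) M :=
  ⟨(extChartAt (𝓡 7) x₀).symm y, ofChart x₀ y v⟩

theorem coordVector_tangentOfChart {x₀ : M} {y : R7} (hy : y ∈ (extChartAt (𝓡 7) x₀).target)
    (v : R7) : G2Structure.coordVector x₀ (tangentOfChart x₀ y v) = v :=
  toChart_ofChart hy v

theorem tangentOfChart_proj_mem {x₀ : M} {y : R7} (hy : y ∈ (extChartAt (𝓡 7) x₀).target)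
    (v : R7) : (tangentOfChart x₀ y v).proj ∈ (extChartAt (𝓡 7) x₀).source :=
  (extChartAt (𝓡 7) x₀).map_target hy

theorem tangentOfChart_coordVector {x₀ : M} {X : TangentBundle (𝓡 7) M}
    (h : X.proj ∈ (extChartAt (𝓡 7) x₀).source) :
    tangentOfChart x₀ (extChartAt (𝓡 7) x₀ X.proj) (G2Structure.coordVector x₀ X) = X := by
  have hy := (extChartAt (𝓡 7) x₀).map_source h
  refine tangent_ext (x₀ := x₀) ((extChartAt (𝓡 7) x₀).left_inv h) (tangentOfChart_proj_mem hy _) ?_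
  exact coordVector_tangentOfChart hy _

theorem contMDiffAt_iff_ext {n : ℕ∞ω} (hn : n ≤ ∞)
    {E H N : Type*} [NormedAddCommGroup E] [NormedSpace ℝ E] [TopologicalSpace H]
    {I : ModelWithCorners ℝ E H} [TopologicalSpace N] [ChartedSpace H N]
    {f : N → M} {z : N} {x₀ : M} (h : f z ∈ (extChartAt (𝓡 7) x₀).source) :
    ContMDiffAt I (𝓡 7) n f z ↔ ContinuousAt f z ∧
      ContMDiffAt I 𝓘(ℝ, R7) n (fun z => extChartAt (𝓡 7) x₀ (f z)) z := by
  have : IsManifold (𝓡 7) n M := .of_le (n := ∞) hn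
  rw [extChartAt_source] at h
  exact contMDiffAt_iff_target_of_mem_source h

instance : ContMDiffVectorBundle 1 R7 (TangentSpace (𝓡 7) : M → Type _) (𝓡 7) := by
  have : IsManifold (𝓡 7) (1 + 1) M := .of_le (n := ∞) (by decide)
  infer_instance

/-- Regularity of a curve in the tangent bundle, in a chart. -/
theorem curve_contDiffAt {X : ℝ → TangentBundle (𝓡 7) M} {t : ℝ}
    (hX : ContMDiffAt 𝓘(ℝ, ℝ) (𝓡 7).tangent 1 X t) {x₀ : M}
    (h : (X t).proj ∈ (extChartAt (𝓡 7) x₀).source) :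
    (∀ᶠ s in 𝓝 t, (X s).proj ∈ (extChartAt (𝓡 7) x₀).source) ∧
      ContDiffAt ℝ 1 (fun s => extChartAt (𝓡 7) x₀ (X s).proj) t ∧
      ContDiffAt ℝ 1 (fun s => G2Structure.coordVector x₀ (X s)) t := by
  obtain ⟨h1, h2⟩ := (contMDiffAt_tangent_iff h).1 hX
  refine ⟨h1.continuousAt.preimage_mem_nhds ((isOpen_extChartAt_source (I := 𝓡 7) x₀).mem_nhds h),
    ?_, contMDiffAt_iff_contDiffAt.1 h2⟩
  exact contMDiffAt_iff_contDiffAt.1 ((contMDiffAt_iff_ext (n := 1)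
    (f := fun s => (X s).proj) (by decide) h).1 h1).2

theorem curve_contMDiffAt {X : ℝ → TangentBundle (𝓡 7) M} {t : ℝ} {x₀ : M} {y v : ℝ → R7}
    (hX : ∀ᶠ s in 𝓝 t, X s = tangentOfChart x₀ (y s) (v s))
    (hy : y t ∈ (extChartAt (𝓡 7) x₀).target) (hyt : ContDiffAt ℝ 1 y t)
    (hvt : ContDiffAt ℝ 1 v t) : ContMDiffAt 𝓘(ℝ, ℝ) (𝓡 7).tangent 1 X t := by
  have hY : ContMDiffAt 𝓘(ℝ, ℝ) (𝓡 7).tangent 1 (fun s => tangentOfChart x₀ (y s) (v s)) t := by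
    have hp : (tangentOfChart x₀ (y t) (v t)).proj ∈ (extChartAt (𝓡 7) x₀).source :=
      tangentOfChart_proj_mem hy _
    refine (contMDiffAt_tangent_iff (f := fun s => tangentOfChart x₀ (y s) (v s)) hp).2 ⟨?_, ?_⟩
    · have : IsManifold (𝓡 7) 1 M := .of_le (n := ∞) (by decide)
      have h1 : ContMDiffAt 𝓘(ℝ, R7) (𝓡 7) 1 (extChartAt (𝓡 7) x₀).symm (y t) :=
        (contMDiffOn_extChartAt_symm x₀ _ hy).contMDiffAt ((isOpen_chart_target x₀).mem_nhds hy)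
      exact h1.comp t (contMDiffAt_iff_contDiffAt.2 hyt)
    · refine (contMDiffAt_iff_contDiffAt.2 hvt).congr_of_eventuallyEq ?_
      have hn : ∀ᶠ s in 𝓝 t, y s ∈ (extChartAt (𝓡 7) x₀).target :=
        hyt.continuousAt.preimage_mem_nhds ((isOpen_chart_target x₀).mem_nhds hy)
      filter_upwards [hn] with s hs
      exact coordVector_tangentOfChart hs _
  exact hY.congr_of_eventuallyEq hX

end Bundle

/-- First and second order chain rule along a curve. -/
theorem deriv_comp_curve {E F : Type*} [NormedAddCommGroup E] [NormedSpace ℝ E]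
    [NormedAddCommGroup F] [NormedSpace ℝ F] {τ : E → F} {y c : ℝ → E} {t : ℝ}
    (hτ : ContDiffAt ℝ 2 τ (y t)) (hy : DifferentiableAt ℝ y t) (hc : DifferentiableAt ℝ c t) :
    deriv (fun s => τ (y s)) t = fderiv ℝ τ (y t) (deriv y t) ∧
      deriv (fun s => fderiv ℝ τ (y s) (c s)) t =
        fderiv ℝ (fderiv ℝ τ) (y t) (deriv y t) (c t) + fderiv ℝ τ (y t) (deriv c t) := by
  have h1 := (hτ.differentiableAt (by simp)).hasFDerivAt
  have h2 := ((hτ.fderiv_right (m := 1) (by norm_num)).differentiableAt (by simp)).hasFDerivAt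
  exact ⟨(h1.comp_hasDerivAt t hy.hasDerivAt).deriv,
    ((h2.comp_hasDerivAt t hy.hasDerivAt).clm_apply hc.hasDerivAt).deriv⟩

namespace G2Structure

variable {M : Type*} [TopologicalSpace M] [ChartedSpace R7 M] (G : G2Structure M)
variable [IsManifold (𝓡 7) ∞ M]

/-- The covariant derivative of a vector field along a curve in two charts. The chart around `x₀` is
used with the Christoffel symbols of the first kind, the chart around `x₁` with those of the second
kind. -/
theorem covDerivPairing_transition {X : ℝ → TangentBundle (𝓡 7) M} {t : ℝ}
    (hX : ContMDiffAt 𝓘(ℝ, ℝ) (𝓡 7).tangent 1 X t) {x₀ x₁ : M}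
    (h₀ : (X t).proj ∈ (extChartAt (𝓡 7) x₀).source)
    (h₁ : (X t).proj ∈ (extChartAt (𝓡 7) x₁).source) (w : R7) :
    G.metricInChart x₀ (extChartAt (𝓡 7) x₀ (X t).proj)
        (deriv (fun s => coordVector x₀ (X s)) t) w +
      G.christoffel x₀ (extChartAt (𝓡 7) x₀ (X t).proj)
        (deriv (fun s => extChartAt (𝓡 7) x₀ (X s).proj) t) (coordVector x₀ (X t)) w =
      inner ℝ (G.metricOp x₁ (extChartAt (𝓡 7) x₁ (X t).proj)
        (deriv (fun s => coordVector x₁ (X s)) t +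
          G.christoffelTwo x₁ (extChartAt (𝓡 7) x₁ (X t).proj)
            (deriv (fun s => extChartAt (𝓡 7) x₁ (X s).proj) t) (coordVector x₁ (X t))))
        (fderiv ℝ (transition x₀ x₁) (extChartAt (𝓡 7) x₀ (X t).proj) w) := by
  obtain ⟨hs0, hy0, hc0⟩ := curve_contDiffAt hX h₀
  obtain ⟨hs1, -, -⟩ := curve_contDiffAt hX h₁
  have hO : extChartAt (𝓡 7) x₀ (X t).proj ∈ overlap x₀ x₁ := mem_overlap h₀ h₁
  have hτs : ContDiffAt ℝ ∞ (transition x₀ x₁) (extChartAt (𝓡 7) x₀ (X t).proj) :=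
    (contDiffOn_transition x₀ x₁).contDiffAt ((isOpen_overlap x₀ x₁).mem_nhds hO)
  have hty : transition x₀ x₁ (extChartAt (𝓡 7) x₀ (X t).proj) = extChartAt (𝓡 7) x₁ (X t).proj := by
    rw [transition, (extChartAt (𝓡 7) x₀).left_inv h₀]
  have ey : (fun s => extChartAt (𝓡 7) x₁ (X s).proj) =ᶠ[𝓝 t]
      fun s => transition x₀ x₁ (extChartAt (𝓡 7) x₀ (X s).proj) := by
    filter_upwards [hs0] with s hs
    rw [transition, (extChartAt (𝓡 7) x₀).left_inv hs]
  have ec : (fun s => coordVector x₁ (X s)) =ᶠ[𝓝 t]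
      fun s => fderiv ℝ (transition x₀ x₁) (extChartAt (𝓡 7) x₀ (X s).proj)
        (coordVector x₀ (X s)) := by
    filter_upwards [hs0, hs1] with s hs hs'
    exact (coordVector_transition hs hs').symm
  obtain ⟨dy1, dc1⟩ := deriv_comp_curve (hτs.of_le (by decide)) (hy0.differentiableAt (by simp))
    (hc0.differentiableAt (by simp))
  rw [ey.deriv_eq, dy1, ec.deriv_eq, dc1]
  have hm0 := (extChartAt (𝓡 7) x₀).map_source h₀
  have hm1 := (extChartAt (𝓡 7) x₁).map_source h₁
  have hlaw := G.christoffel_transition hO (deriv (fun s => extChartAt (𝓡 7) x₀ (X s).proj) t)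
    (coordVector x₀ (X t)) w
  rw [coordVector_transition h₀ h₁, hty] at hlaw
  have hmet := G.metricInChart_transition hO (deriv (fun s => coordVector x₀ (X s)) t) w
  rw [hty] at hmet
  rw [map_add, inner_add_left, G.metricOp_christoffelTwo hm1, G.inner_christoffelOne hm1,
    map_add, inner_add_left, G.inner_metricOp hm1 (fderiv ℝ _ _ (deriv _ _))]
  rw [hmet, hlaw]
  ring

/-- The covariant derivative of a vector field along a curve may be computed in any chart. -/
theorem covDerivPairing_eq {X : ℝ → TangentBundle (𝓡 7) M} {t : ℝ}
    (hX : ContMDiffAt 𝓘(ℝ, ℝ) (𝓡 7).tangent 1 X t) {x₁ : M}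
    (h₁ : (X t).proj ∈ (extChartAt (𝓡 7) x₁).source) (w : R7) :
    G.covDerivPairing X t w =
      inner ℝ (G.metricOp x₁ (extChartAt (𝓡 7) x₁ (X t).proj)
        (deriv (fun s => coordVector x₁ (X s)) t +
          G.christoffelTwo x₁ (extChartAt (𝓡 7) x₁ (X t).proj)
            (deriv (fun s => extChartAt (𝓡 7) x₁ (X s).proj) t) (coordVector x₁ (X t))))
        (fderiv ℝ (transition (X t).proj x₁) (extChartAt (𝓡 7) (X t).proj (X t).proj) w) :=
  G.covDerivPairing_transition hX (mem_extChartAt_source _) h₁ w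

/-- Being parallel is expressed by the usual equation in every chart. -/
theorem covDerivPairing_eq_zero_iff {X : ℝ → TangentBundle (𝓡 7) M} {t : ℝ}
    (hX : ContMDiffAt 𝓘(ℝ, ℝ) (𝓡 7).tangent 1 X t) {x₁ : M}
    (h₁ : (X t).proj ∈ (extChartAt (𝓡 7) x₁).source) :
    (∀ w : R7, G.covDerivPairing X t w = 0) ↔
      deriv (fun s => coordVector x₁ (X s)) t +
        G.christoffelTwo x₁ (extChartAt (𝓡 7) x₁ (X t).proj)
          (deriv (fun s => extChartAt (𝓡 7) x₁ (X s).proj) t) (coordVector x₁ (X t)) = 0 := by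
  have hm1 := (extChartAt (𝓡 7) x₁).map_source h₁
  have h₀ : (X t).proj ∈ (extChartAt (𝓡 7) (X t).proj).source := mem_extChartAt_source _
  constructor
  · intro h
    set z := deriv (fun s => coordVector x₁ (X s)) t +
        G.christoffelTwo x₁ (extChartAt (𝓡 7) x₁ (X t).proj)
          (deriv (fun s => extChartAt (𝓡 7) x₁ (X s).proj) t) (coordVector x₁ (X t)) with hz
    have h2 := h (toChart (X t).proj (X t).proj (ofChart x₁ (extChartAt (𝓡 7) x₁ (X t).proj)
      (G.metricOp x₁ (extChartAt (𝓡 7) x₁ (X t).proj) z)))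
    rw [G.covDerivPairing_eq hX h₁, fderiv_transition_toChart h₀ h₁, toChart_ofChart' h₁, ← hz,
      inner_self_eq_zero] at h2
    rw [← G.metricInv_metricOp hm1 z, h2, map_zero]
  · intro h w
    rw [G.covDerivPairing_eq hX h₁, h, map_zero, inner_zero_left]

end G2Structure

/-! ### Differential equations: linear equations and dependence on the initial value -/

section ODE

open Set Metric

variable {E : Type*} [NormedAddCommGroup E] [NormedSpace ℝ E]

/-- Grönwall's inequality on both sides of the initial time. -/
theorem norm_le_gronwallBound_abs {f f' : ℝ → E} {K ε a b t₀ : ℝ} (ht₀ : t₀ ∈ Icc a b)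
    (hf : ∀ t ∈ Icc a b, HasDerivWithinAt f (f' t) (Icc a b) t)
    (hb : ∀ t ∈ Icc a b, ‖f' t‖ ≤ K * ‖f t‖ + ε) {t : ℝ} (ht : t ∈ Icc a b) :
    ‖f t‖ ≤ gronwallBound ‖f t₀‖ K ε |t - t₀| := by
  have hc : ContinuousOn f (Icc a b) := fun t ht => (hf t ht).continuousWithinAt
  rcases le_total t₀ t with h | h
  · rw [abs_of_nonneg (sub_nonneg.2 h)]
    refine norm_le_gronwallBound_of_norm_deriv_right_le (f := f) (f' := f') (b := b)
      (hc.mono (Icc_subset_Icc_left ht₀.1)) (fun s hs => ?_) le_rfl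
      (fun s hs => hb s ⟨ht₀.1.trans hs.1, hs.2.le⟩) t ⟨h, ht.2⟩
    have hs' : s ∈ Icc a b := ⟨ht₀.1.trans hs.1, hs.2.le⟩
    exact (hf s hs').mono_of_mem_nhdsWithin
      (Filter.mem_of_superset (Icc_mem_nhdsGE hs.2) (Icc_subset_Icc_left hs'.1))
  · rw [abs_sub_comm, abs_of_nonneg (sub_nonneg.2 h)]
    have hneg : ∀ s ∈ Icc (-t₀) (-a), -s ∈ Icc a b :=
      fun s hs => ⟨by linarith [hs.2], by linarith [hs.1, ht₀.2]⟩
    have key := norm_le_gronwallBound_of_norm_deriv_right_le (f := fun s => f (-s))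
      (f' := fun s => -f' (-s)) (a := -t₀) (b := -a) (δ := ‖f t₀‖) (K := K) (ε := ε)
      (hc.comp continuousOn_neg hneg) (fun s hs => ?_) (by simp)
      (fun s hs => by
        rw [norm_neg]
        exact hb _ (hneg s ⟨hs.1, hs.2.le⟩)) (-t) ⟨neg_le_neg h, neg_le_neg ht.1⟩
    · simpa [sub_eq_add_neg, add_comm] using key
    · have hs' := hneg s ⟨hs.1, hs.2.le⟩
      have h1 : HasDerivWithinAt f (f' (-s)) (Iic (-s)) (-s) :=
        (hf _ hs').mono_of_mem_nhdsWithin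
          (Filter.mem_of_superset (Icc_mem_nhdsLE (lt_neg_of_lt_neg hs.2))
            (Icc_subset_Icc_right hs'.2))
      have h2 := HasDerivWithinAt.scomp (t' := Iic (-s)) (s := Ici s) s h1
        (hasDerivWithinAt_neg s (Ici s)) (fun x hx => Set.mem_Iic.2 (neg_le_neg hx))
      simpa using! h2

/-- Existence for linear differential equations on short intervals. -/
theorem exists_linear_ode_solution [CompleteSpace E] {A : ℝ → E →L[ℝ] E} {a b t₀ K : ℝ}
    (ht₀ : t₀ ∈ Icc a b) (hA : ContinuousOn A (Icc a b)) (hK : ∀ t ∈ Icc a b, ‖A t‖ ≤ K)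
    (hKab : K * (b - a) ≤ 1 / 2) (x₀ : E) :
    ∃ x : ℝ → E, x t₀ = x₀ ∧ ∀ t ∈ Icc a b, HasDerivWithinAt x (A t (x t)) (Icc a b) t := by
  have hK0 : 0 ≤ K := (norm_nonneg _).trans (hK t₀ ht₀)
  lift K to NNReal using hK0
  have hpl : IsPicardLindelof (fun t x => A t x) (⟨t₀, ht₀⟩ : Icc a b) x₀ ‖x₀‖₊ 0
      (2 * K * ‖x₀‖₊) K := by
    refine ⟨fun t ht => ?_, fun x _ => ?_, fun t ht x hx => ?_, ?_⟩
    · exact ((A t).lipschitz.weaken (hK t ht)).lipschitzOnWith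
    · exact hA.clm_apply continuousOn_const
    · have hx' : ‖x‖ ≤ 2 * ‖x₀‖ := by
        rw [mem_closedBall, dist_eq_norm] at hx
        have := norm_le_norm_add_norm_sub x₀ x
        simp only [coe_nnnorm] at hx
        rw [norm_sub_rev] at hx
        linarith
      have h1 := (A t).le_opNorm x
      have h2 : ‖A t‖ * ‖x‖ ≤ K * (2 * ‖x₀‖) := by
        gcongr
        exact hK t ht
      push_cast
      linarith
    · push_cast
      have h1 : max (b - t₀) (t₀ - a) ≤ b - a := max_le (by linarith [ht₀.1]) (by linarith [ht₀.2])
      calc 2 * (K : ℝ) * ‖x₀‖ * max (b - t₀) (t₀ - a) ≤ 2 * K * ‖x₀‖ * (b - a) := by gcongr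
        _ = 2 * (K * (b - a)) * ‖x₀‖ := by ring
        _ ≤ 2 * (1 / 2) * ‖x₀‖ := by gcongr
        _ = ‖x₀‖ - 0 := by ring
  exact hpl.exists_eq_forall_mem_Icc_hasDerivWithinAt₀

/-- A `C²` map satisfies first and second order increment bounds near a point. -/
theorem exists_increment_bounds {F : E → E} {z₀ : E} (hF : ContDiffAt ℝ 2 F z₀) {U : Set E}
    (hU : U ∈ 𝓝 z₀) : ∃ R > 0, ∃ K₁ > 0, ∃ K₂ ≥ 0, ball z₀ R ⊆ U ∧
      (∀ z ∈ ball z₀ R, ‖fderiv ℝ F z‖ ≤ K₁) ∧ ContinuousOn (fderiv ℝ F) (ball z₀ R) ∧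
      (∀ a ∈ ball z₀ R, ∀ b ∈ ball z₀ R, ‖F b - F a‖ ≤ K₁ * ‖b - a‖) ∧
      (∀ a ∈ ball z₀ R, ∀ b ∈ ball z₀ R,
        ‖F b - F a - fderiv ℝ F a (b - a)‖ ≤ K₂ * ‖b - a‖ * ‖b - a‖) := by
  have hd : ∀ᶠ z in 𝓝 z₀, DifferentiableAt ℝ F z := by
    filter_upwards [hF.eventually (by decide)] with z hz
    exact hz.differentiableAt (by simp)
  obtain ⟨K₂, W, hW, hlip⟩ := (hF.fderiv_right (m := 1) (by norm_num)).exists_lipschitzOnWith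
  obtain ⟨R, hR, hball⟩ := Metric.mem_nhds_iff.1 (Filter.inter_mem hU (Filter.inter_mem hd hW))
  have hdiff : ∀ z ∈ ball z₀ R, DifferentiableAt ℝ F z := fun z hz => (hball hz).2.1
  have hlip' : LipschitzOnWith K₂ (fderiv ℝ F) (ball z₀ R) := hlip.mono fun z hz => (hball hz).2.2
  have hbound : ∀ z ∈ ball z₀ R, ‖fderiv ℝ F z‖ ≤ ‖fderiv ℝ F z₀‖ + K₂ * R + 1 := by
    intro z hz
    have h1 := hlip'.dist_le_mul z hz z₀ (mem_ball_self hR)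
    rw [dist_eq_norm] at h1
    have h2 : K₂ * dist z z₀ ≤ K₂ * R := by
      gcongr
      exact (mem_ball.1 hz).le
    have h3 := norm_le_norm_add_norm_sub' (fderiv ℝ F z) (fderiv ℝ F z₀)
    linarith
  refine ⟨R, hR, ‖fderiv ℝ F z₀‖ + K₂ * R + 1, by positivity, K₂, K₂.2, fun z hz => (hball hz).1,
    hbound, hlip'.continuousOn, fun a ha b hb => ?_, fun a ha b hb => ?_⟩
  · exact (convex_ball z₀ R).norm_image_sub_le_of_norm_fderiv_le hdiff hbound ha hb
  · have hconv : Convex ℝ (ball z₀ R ∩ closedBall a ‖b - a‖) :=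
      (convex_ball _ _).inter (convex_closedBall _ _)
    refine hconv.norm_image_sub_le_of_norm_hasFDerivWithin_le'
      (f' := fderiv ℝ F)
      (fun z hz => (hdiff z hz.1).hasFDerivAt.hasFDerivWithinAt) (fun z hz => ?_)
      ⟨ha, by simp⟩ ⟨hb, by simp [dist_eq_norm]⟩
    have h1 := hlip'.dist_le_mul z hz.1 a ha
    rw [dist_eq_norm] at h1
    exact h1.trans (mul_le_mul_of_nonneg_left hz.2 K₂.2)

/-- The local flow of a `C²` vector field, together with its derivative `J` with respect to the
initial value, at `z₀`; `J` solves the linearized equation. -/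
theorem exists_flow_hasFDerivAt [CompleteSpace E] {F : E → E} {z₀ : E} (hF : ContDiffAt ℝ 2 F z₀)
    {U : Set E} (hU : U ∈ 𝓝 z₀) :
    ∃ r > 0, ∃ ε > 0, ∃ (Φ : E → ℝ → E) (J : ℝ → E →L[ℝ] E),
      (∀ z ∈ ball z₀ r, Φ z 0 = z ∧
        ∀ t ∈ Ioo (-ε) ε, Φ z t ∈ U ∧ HasDerivAt (Φ z) (F (Φ z t)) t) ∧
      J 0 = ContinuousLinearMap.id ℝ E ∧ HasDerivAt J (fderiv ℝ F z₀) 0 ∧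
      ∀ t ∈ Ioo (-ε) ε, HasFDerivAt (fun z => Φ z t) (J t) z₀ := by
  obtain ⟨R, hR, K₁, hK₁, K₂, hK₂, hRU, hDF, hDFc, hF1, hF2⟩ := exists_increment_bounds hF hU
  obtain ⟨ε₀, hε₀, a, r₀, L, K, hr₀, hpl⟩ := IsPicardLindelof.of_contDiffAt_one (hF.of_le (by decide))
  obtain ⟨α, hα, hαc⟩ :=
    (hpl 0).exists_forall_mem_closedBall_eq_hasDerivWithinAt_continuousOn
  simp only [zero_sub, zero_add] at hα hαc
  have hr₀' : (0 : ℝ) < r₀ := hr₀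
  have hdom : closedBall z₀ (r₀ : ℝ) ×ˢ Icc (-ε₀) ε₀ ∈ 𝓝 (z₀, (0 : ℝ)) :=
    prod_mem_nhds (closedBall_mem_nhds _ hr₀') (Icc_mem_nhds (by linarith) hε₀)
  have hαz : α (z₀, 0) = z₀ := (hα z₀ (mem_closedBall_self hr₀'.le)).1
  have hcont : ContinuousAt α (z₀, 0) := hαc.continuousAt hdom
  have hev : ∀ᶠ p in 𝓝 (z₀, (0 : ℝ)), α p ∈ ball z₀ R :=
    hcont.preimage_mem_nhds (by rw [hαz]; exact ball_mem_nhds _ hR)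
  rw [nhds_prod_eq] at hev
  obtain ⟨pa, hpa, pb, hpb, hprod⟩ := Filter.eventually_prod_iff.1 hev
  obtain ⟨r₁, hr₁, hr₁s⟩ := Metric.eventually_nhds_iff_ball.1 hpa
  obtain ⟨ε₁, hε₁, hε₁s⟩ := Metric.eventually_nhds_iff_ball.1 hpb
  set r := min r₁ r₀ with hr
  have hrpos : 0 < r := lt_min hr₁ hr₀'
  set ε := min (min (ε₁ / 2) (ε₀ / 2)) (1 / (4 * K₁)) with hε
  have hεpos : 0 < ε := by positivity
  have hεε₁ : ε < ε₁ := by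
    have : ε ≤ ε₁ / 2 := (min_le_left _ _).trans (min_le_left _ _)
    linarith
  have hεε₀ : ε < ε₀ := by
    have : ε ≤ ε₀ / 2 := (min_le_left _ _).trans (min_le_right _ _)
    linarith
  have hεK : K₁ * (ε - -ε) ≤ 1 / 2 := by
    have h1 : ε ≤ 1 / (4 * K₁) := min_le_right _ _
    have h2 : K₁ * ε ≤ K₁ * (1 / (4 * K₁)) := by gcongr
    have h3 : K₁ * (1 / (4 * K₁)) = 1 / 4 := by field_simp
    linarith
  have hmem : ∀ z ∈ ball z₀ r, ∀ t ∈ Icc (-ε) ε, α (z, t) ∈ ball z₀ R := by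
    intro z hz t ht
    refine hprod (hr₁s z (ball_subset_ball (min_le_left _ _) hz)) (hε₁s t ?_)
    rw [mem_ball, Real.dist_eq, sub_zero]
    exact (abs_le.2 ht).trans_lt hεε₁
  have hder : ∀ z ∈ ball z₀ r, ∀ t ∈ Icc (-ε) ε,
      HasDerivAt (fun s => α (z, s)) (F (α (z, t))) t := by
    intro z hz t ht
    have hz' : z ∈ closedBall z₀ (r₀ : ℝ) :=
      ball_subset_closedBall (ball_subset_ball (min_le_right _ _) hz)
    exact ((hα z hz').2 t ⟨by linarith [ht.1], by linarith [ht.2]⟩).hasDerivAt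
      (Icc_mem_nhds (by linarith [ht.1]) (by linarith [ht.2]))
  have hinit : ∀ z ∈ ball z₀ r, α (z, 0) = z := fun z hz =>
    (hα z (ball_subset_closedBall (ball_subset_ball (min_le_right _ _) hz))).1
  have hz₀ : z₀ ∈ ball z₀ r := mem_ball_self hrpos
  have h0 : (0 : ℝ) ∈ Icc (-ε) ε := ⟨by linarith, hεpos.le⟩
  -- the linearized equation along the trajectory of `z₀`
  set A : ℝ → E →L[ℝ] E := fun t => fderiv ℝ F (α (z₀, t)) with hA
  have hAc : ContinuousOn A (Icc (-ε) ε) := hDFc.comp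
    (fun t ht => (hder z₀ hz₀ t ht).continuousAt.continuousWithinAt) (fun t ht => hmem z₀ hz₀ t ht)
  have hAn : ∀ t ∈ Icc (-ε) ε, ‖A t‖ ≤ K₁ := fun t ht => hDF _ (hmem z₀ hz₀ t ht)
  obtain ⟨J, hJ0, hJ⟩ := exists_linear_ode_solution (E := E →L[ℝ] E)
    (A := fun t => ContinuousLinearMap.compL ℝ E E E (A t)) (K := K₁) h0
    ((ContinuousLinearMap.compL ℝ E E E).continuous.comp_continuousOn hAc)
    (fun t ht => ((ContinuousLinearMap.compL ℝ E E E).le_opNorm (A t)).trans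
      ((mul_le_of_le_one_left (norm_nonneg _) (ContinuousLinearMap.norm_compL_le ℝ E E E)).trans
        (hAn t ht))) hεK (ContinuousLinearMap.id ℝ E)
  refine ⟨r, hrpos, ε, hεpos, fun z t => α (z, t), J, fun z hz => ⟨hinit z hz, fun t ht =>
    ⟨hRU (hmem z hz t (Ioo_subset_Icc_self ht)), hder z hz t (Ioo_subset_Icc_self ht)⟩⟩, hJ0, ?_, ?_⟩
  · have h1 := (hJ 0 h0).hasDerivAt (Icc_mem_nhds (by linarith) hεpos)
    have h2 : (ContinuousLinearMap.compL ℝ E E E (A 0)) (J 0) = fderiv ℝ F z₀ := by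
      rw [hJ0, hA]
      simp only [hαz]
      exact ContinuousLinearMap.comp_id _
    rwa [h2] at h1
  · intro t ht
    have ht' := Ioo_subset_Icc_self ht
    set C := Real.exp (K₁ * ε) with hC
    -- the flow is Lipschitz in the initial value
    have hlip : ∀ z ∈ ball z₀ r, ∀ s ∈ Icc (-ε) ε, ‖α (z, s) - α (z₀, s)‖ ≤ ‖z - z₀‖ * C := by
      intro z hz s hs
      have h1 := norm_le_gronwallBound_abs (f := fun s => α (z, s) - α (z₀, s))
        (f' := fun s => F (α (z, s)) - F (α (z₀, s))) (K := K₁) (ε := 0) h0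
        (fun s hs => ((hder z hz s hs).sub (hder z₀ hz₀ s hs)).hasDerivWithinAt)
        (fun s hs => by
          rw [add_zero]
          exact hF1 _ (hmem z₀ hz₀ s hs) _ (hmem z hz s hs)) hs
      rw [gronwallBound_ε0, hinit z hz, hinit z₀ hz₀, sub_zero] at h1
      exact h1.trans (mul_le_mul_of_nonneg_left (Real.exp_le_exp.2
        (mul_le_mul_of_nonneg_left (abs_le.2 hs) hK₁.le)) (norm_nonneg _))
    rw [hasFDerivAt_iff_isLittleO]
    have hO : (fun z => α (z, t) - α (z₀, t) - J t (z - z₀)) =O[𝓝 z₀] fun z => ‖z - z₀‖ ^ 2 := by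
      refine Asymptotics.IsBigO.of_bound (K₂ * C ^ 2 / K₁ * (Real.exp (K₁ * |t - 0|) - 1)) ?_
      filter_upwards [ball_mem_nhds z₀ hrpos] with z hz
      -- the error of the linear approximation solves the linearized equation up to `O(‖z - z₀‖²)`
      have h1 := norm_le_gronwallBound_abs (f := fun s => α (z, s) - α (z₀, s) - J s (z - z₀))
        (f' := fun s => F (α (z, s)) - F (α (z₀, s)) - A s (J s (z - z₀))) (K := K₁)
        (ε := K₂ * C ^ 2 * ‖z - z₀‖ ^ 2) h0
        (fun s hs => (((hder z hz s hs).sub (hder z₀ hz₀ s hs)).hasDerivWithinAt).sub (by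
          have := (hJ s hs).clm_apply (hasDerivWithinAt_const s (Icc (-ε) ε) (z - z₀))
          simpa using this))
        (fun s hs => by
          set d := α (z, s) - α (z₀, s) with hd
          have e1 : F (α (z, s)) - F (α (z₀, s)) - A s (J s (z - z₀)) =
              A s (d - J s (z - z₀)) + (F (α (z, s)) - F (α (z₀, s)) - A s d) := by
            rw [(A s).map_sub d]; abel
          have e2 := hF2 _ (hmem z₀ hz₀ s hs) _ (hmem z hz s hs)
          rw [← hd] at e2
          have e3 := hlip z hz s hs
          rw [← hd] at e3
          rw [e1]
          refine (norm_add_le _ _).trans (add_le_add ?_ (e2.trans ?_))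
          · exact ((A s).le_opNorm _).trans (by gcongr; exact hAn s hs)
          · calc K₂ * ‖d‖ * ‖d‖ ≤ K₂ * (‖z - z₀‖ * C) * (‖z - z₀‖ * C) := by gcongr
              _ = K₂ * C ^ 2 * ‖z - z₀‖ ^ 2 := by ring) ht'
      have e0 : ‖α (z, 0) - α (z₀, 0) - J 0 (z - z₀)‖ = 0 := by
        rw [hinit z hz, hinit z₀ hz₀, hJ0]; simp
      rw [e0, gronwallBound_of_K_ne_0 hK₁.ne'] at h1
      refine h1.trans (le_of_eq ?_)
      rw [norm_pow, norm_norm]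
      ring
    refine hO.trans_isLittleO ?_
    have h2 := (Asymptotics.isLittleO_norm_pow_id (E' := E) one_lt_two).comp_tendsto
      (show Filter.Tendsto (fun z => z - z₀) (𝓝 z₀) (𝓝 0) by
        have : Filter.Tendsto (fun z => z - z₀) (𝓝 z₀) (𝓝 (z₀ - z₀)) :=
          (continuous_sub_right z₀).tendsto z₀
        rwa [sub_self] at this)
    exact h2

end ODE

/-! ### Geodesics and parallel transport in a chart -/

/-- A curve with continuous derivative on an open set is of class `C¹` there. -/
theorem contDiffAt_one_of_hasDerivAt {E : Type*} [NormedAddCommGroup E] [NormedSpace ℝ E]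
    {f f' : ℝ → E} {J : Set ℝ} (hJ : IsOpen J) (hf : ∀ t ∈ J, HasDerivAt f (f' t) t)
    (hf' : ContinuousOn f' J) {t : ℝ} (ht : t ∈ J) : ContDiffAt ℝ 1 f t := by
  rw [contDiffAt_one_iff]
  refine ⟨fun s => ContinuousLinearMap.toSpanSingleton ℝ (f' s), J, hJ.mem_nhds ht, ?_,
    fun s hs => (hf s hs).hasFDerivAt⟩
  exact (ContinuousLinearMap.toSpanSingletonCLE (𝕜 := ℝ) (E := E)).continuous.comp_continuousOn hf'

namespace G2Structure

variable {M : Type*} [TopologicalSpace M] [ChartedSpace R7 M] (G : G2Structure M)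
variable [IsManifold (𝓡 7) ∞ M]

/-- The geodesic vector field in the chart around `x₀`. -/
def geodesicField (x₀ : M) (z : R7 × R7) : R7 × R7 := (z.2, -G.christoffelTwo x₀ z.1 z.2 z.2)

theorem contDiffAt_geodesicField {x₀ : M} {z : R7 × R7} (hz : z.1 ∈ (extChartAt (𝓡 7) x₀).target) :
    ContDiffAt ℝ ∞ (G.geodesicField x₀) z := by
  have h1 : ContDiffAt ℝ ∞ (fun z : R7 × R7 => G.christoffelTwo x₀ z.1) z :=
    ((G.contDiffOn_christoffelTwo x₀).contDiffAt ((isOpen_chart_target x₀).mem_nhds hz)).comp z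
      contDiffAt_fst
  exact contDiffAt_snd.prodMk ((h1.clm_apply contDiffAt_snd).clm_apply contDiffAt_snd).neg

theorem coordVector_velocity {γ : ℝ → M} {t : ℝ}
    (h : MDifferentiableAt 𝓘(ℝ, ℝ) (𝓡 7) γ t) {x₀ : M} (h₀ : γ t ∈ (extChartAt (𝓡 7) x₀).source) :
    coordVector x₀ (velocity γ t) = deriv (fun s => extChartAt (𝓡 7) x₀ (γ s)) t := by
  have h1 := mfderiv_comp t (mdifferentiableAt_extChartAt' h₀) h
  rw [← fderiv_apply_one_eq_deriv, ← mfderiv_eq_fderiv]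
  exact (congrArg (fun A : ℝ →L[ℝ] R7 => A 1) h1).symm

theorem velocity_symm {x₀ : M} {y : ℝ → R7} {t : ℝ} {v : R7} (hy : HasDerivAt y v t)
    (ht : y t ∈ (extChartAt (𝓡 7) x₀).target) :
    velocity (fun s => (extChartAt (𝓡 7) x₀).symm (y s)) t = tangentOfChart x₀ (y t) v := by
  have h1 := mfderiv_comp t (mdifferentiableAt_extChartAt_symm' ht)
    hy.differentiableAt.mdifferentiableAt
  have h2 : mfderiv 𝓘(ℝ, ℝ) 𝓘(ℝ, R7) y t (1 : ℝ) = v := by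
    have h : fderiv ℝ y t 1 = v := fderiv_apply_one_eq_deriv.trans hy.deriv
    rw [mfderiv_eq_fderiv]
    exact h
  have h3 : mfderiv 𝓘(ℝ, ℝ) (𝓡 7) (fun s => (extChartAt (𝓡 7) x₀).symm (y s)) t (1 : ℝ) =
      ofChart x₀ (y t) v := by
    refine (congrArg (fun A : ℝ →L[ℝ] R7 => A 1) h1).trans ?_
    exact congrArg (ofChart x₀ (y t)) h2
  rw [velocity, tangentOfChart]
  exact congrArg _ h3

theorem IsParallelOn.hasDerivAt {X : ℝ → TangentBundle (𝓡 7) M} {J : Set ℝ}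
    (hX : G.IsParallelOn X J) (hJ : IsOpen J) {t : ℝ} (ht : t ∈ J) {x₀ : M}
    (h₀ : (X t).proj ∈ (extChartAt (𝓡 7) x₀).source) :
    HasDerivAt (fun s => coordVector x₀ (X s))
      (-G.christoffelTwo x₀ (extChartAt (𝓡 7) x₀ (X t).proj)
        (deriv (fun s => extChartAt (𝓡 7) x₀ (X s).proj) t) (coordVector x₀ (X t))) t := by
  have h1 : ContMDiffAt 𝓘(ℝ, ℝ) (𝓡 7).tangent 1 X t := (hX.1 t ht).contMDiffAt (hJ.mem_nhds ht)
  have h2 := (G.covDerivPairing_eq_zero_iff h1 h₀).1 (hX.2 t ht)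
  rw [← eq_neg_of_add_eq_zero_left h2]
  exact ((curve_contDiffAt h1 h₀).2.2.differentiableAt (by simp)).hasDerivAt

theorem IsGeodesicOn.mdifferentiableAt {γ : ℝ → M} {J : Set ℝ} (hγ : G.IsGeodesicOn γ J)
    (hJ : IsOpen J) {t : ℝ} (ht : t ∈ J) : MDifferentiableAt 𝓘(ℝ, ℝ) (𝓡 7) γ t := by
  have h1 : ContMDiffAt 𝓘(ℝ, ℝ) (𝓡 7).tangent 1 (velocity γ) t :=
    (hγ.1 t ht).contMDiffAt (hJ.mem_nhds ht)
  exact ((contMDiffAt_tangent_iff (f := velocity γ) (mem_extChartAt_source _)).1 h1).1.mdifferentiableAt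
    (by simp)

theorem IsGeodesicOn.deriv_eq {γ : ℝ → M} {J : Set ℝ} (hγ : G.IsGeodesicOn γ J)
    (hJ : IsOpen J) {t : ℝ} (ht : t ∈ J) {x₀ : M} (h₀ : γ t ∈ (extChartAt (𝓡 7) x₀).source) :
    deriv (fun s => extChartAt (𝓡 7) x₀ (γ s)) t = coordVector x₀ (velocity γ t) :=
  (coordVector_velocity (IsGeodesicOn.mdifferentiableAt G hγ hJ ht) h₀).symm

theorem IsGeodesicOn.hasDerivAt {γ : ℝ → M} {J : Set ℝ} (hγ : G.IsGeodesicOn γ J)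
    (hJ : IsOpen J) {t : ℝ} (ht : t ∈ J) {x₀ : M} (h₀ : γ t ∈ (extChartAt (𝓡 7) x₀).source) :
    HasDerivAt (fun s => (extChartAt (𝓡 7) x₀ (γ s), coordVector x₀ (velocity γ s)))
      (G.geodesicField x₀ (extChartAt (𝓡 7) x₀ (γ t), coordVector x₀ (velocity γ t))) t := by
  have h1 : ContMDiffAt 𝓘(ℝ, ℝ) (𝓡 7).tangent 1 (velocity γ) t :=
    (hγ.1 t ht).contMDiffAt (hJ.mem_nhds ht)
  have hv := IsGeodesicOn.deriv_eq G hγ hJ ht h₀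
  have h2 : HasDerivAt (fun s => extChartAt (𝓡 7) x₀ (γ s)) (coordVector x₀ (velocity γ t)) t := by
    rw [← hv]
    exact ((curve_contDiffAt (X := velocity γ) h1 h₀).2.1.differentiableAt (by simp)).hasDerivAt
  have h3 := IsParallelOn.hasDerivAt G hγ hJ ht (x₀ := x₀) h₀
  have h4 : deriv (fun s => extChartAt (𝓡 7) x₀ (velocity γ s).proj) t =
    coordVector x₀ (velocity γ t) := hv
  rw [h4] at h3
  exact h2.prodMk h3

/-- Solutions of the equation of parallel transport in a chart are parallel. -/
theorem isParallelOn_tangentOfChart {x₀ : M} {y y' c : ℝ → R7} {J : Set ℝ} (hJ : IsOpen J)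
    {X : ℝ → TangentBundle (𝓡 7) M} (hX : ∀ t ∈ J, X t = tangentOfChart x₀ (y t) (c t))
    (hyt : ∀ t ∈ J, y t ∈ (extChartAt (𝓡 7) x₀).target)
    (hy : ∀ t ∈ J, HasDerivAt y (y' t) t) (hy' : ContinuousOn y' J)
    (hc : ∀ t ∈ J, HasDerivAt c (-G.christoffelTwo x₀ (y t) (y' t) (c t)) t) :
    G.IsParallelOn X J := by
  have hyc : ContinuousOn y J := fun t ht => (hy t ht).continuousAt.continuousWithinAt
  have hcc : ContinuousOn c J := fun t ht => (hc t ht).continuousAt.continuousWithinAt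
  have hc' : ContinuousOn (fun t => -G.christoffelTwo x₀ (y t) (y' t) (c t)) J :=
    (((((G.contDiffOn_christoffelTwo x₀).continuousOn.comp hyc hyt)).clm_apply hy').clm_apply hcc).neg
  have hC : ∀ t ∈ J, ContMDiffAt 𝓘(ℝ, ℝ) (𝓡 7).tangent 1 X t := fun t ht =>
    curve_contMDiffAt (by filter_upwards [hJ.mem_nhds ht] with s hs using hX s hs) (hyt t ht)
      (contDiffAt_one_of_hasDerivAt hJ hy hy' ht) (contDiffAt_one_of_hasDerivAt hJ hc hc' ht)
  refine ⟨fun t ht => (hC t ht).contMDiffWithinAt, fun t ht => ?_⟩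
  have hs : (X t).proj ∈ (extChartAt (𝓡 7) x₀).source := by
    rw [hX t ht]; exact tangentOfChart_proj_mem (hyt t ht) _
  refine (G.covDerivPairing_eq_zero_iff (hC t ht) hs).2 ?_
  have e1 : (fun s => extChartAt (𝓡 7) x₀ (X s).proj) =ᶠ[𝓝 t] y := by
    filter_upwards [hJ.mem_nhds ht] with s hs
    rw [hX s hs]
    exact (extChartAt (𝓡 7) x₀).right_inv (hyt s hs)
  have e2 : (fun s => coordVector x₀ (X s)) =ᶠ[𝓝 t] c := by
    filter_upwards [hJ.mem_nhds ht] with s hs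
    rw [hX s hs]
    exact coordVector_tangentOfChart (hyt s hs) _
  have e1' := e1.eq_of_nhds
  have e2' := e2.eq_of_nhds
  rw [e1.deriv_eq, e2.deriv_eq, e1', e2', (hy t ht).deriv, (hc t ht).deriv]
  exact neg_add_cancel _

/-- Rescaled solutions of the geodesic equation in a chart are geodesics. -/
theorem isGeodesicFrom_symm {x₀ p : M} (hp : p ∈ (extChartAt (𝓡 7) x₀).source) {v : R7}
    {ζ : ℝ → R7 × R7} {ε a : ℝ} (hζ0 : ζ 0 = (extChartAt (𝓡 7) x₀ p, toChart x₀ p v))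
    (hζt : ∀ t ∈ Set.Ioo (-ε) ε, (ζ t).1 ∈ (extChartAt (𝓡 7) x₀).target)
    (hζ : ∀ t ∈ Set.Ioo (-ε) ε, HasDerivAt ζ (G.geodesicField x₀ (ζ t)) t) (ha : 3 * |a| < ε) :
    G.IsGeodesicFrom p (a • v : R7) (fun s => (extChartAt (𝓡 7) x₀).symm (ζ (a * s)).1)
      (Set.Ioo (-1) 3) ∧
    ∀ s ∈ Set.Ioo (-1 : ℝ) 3, velocity (fun s => (extChartAt (𝓡 7) x₀).symm (ζ (a * s)).1) s =
      tangentOfChart x₀ (ζ (a * s)).1 (a • (ζ (a * s)).2) := by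
  have hmem : ∀ s ∈ Set.Ioo (-1 : ℝ) 3, a * s ∈ Set.Ioo (-ε) ε := by
    intro s hs
    rw [Set.mem_Ioo, ← abs_lt, abs_mul]
    have : |s| ≤ 3 := abs_le.2 ⟨by linarith [hs.1], hs.2.le⟩
    calc |a| * |s| ≤ |a| * 3 := by gcongr
      _ < ε := by linarith
  have hd : ∀ s ∈ Set.Ioo (-1 : ℝ) 3,
      HasDerivAt (fun s => ζ (a * s)) (a • G.geodesicField x₀ (ζ (a * s))) s := by
    intro s hs
    have h1 : HasDerivAt (fun s : ℝ => a * s) a s := by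
      simpa using (hasDerivAt_id s).const_mul a
    exact (hζ _ (hmem s hs)).scomp s h1
  have hd1 : ∀ s ∈ Set.Ioo (-1 : ℝ) 3,
      HasDerivAt (fun s => (ζ (a * s)).1) (a • (ζ (a * s)).2) s := fun s hs =>
    (ContinuousLinearMap.fst ℝ R7 R7).hasFDerivAt.comp_hasDerivAt s (hd s hs)
  have hd2 : ∀ s ∈ Set.Ioo (-1 : ℝ) 3,
      HasDerivAt (fun s => (ζ (a * s)).2)
        (a • -G.christoffelTwo x₀ (ζ (a * s)).1 (ζ (a * s)).2 (ζ (a * s)).2) s := fun s hs =>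
    (ContinuousLinearMap.snd ℝ R7 R7).hasFDerivAt.comp_hasDerivAt s (hd s hs)
  have hvel : ∀ s ∈ Set.Ioo (-1 : ℝ) 3,
      velocity (fun s => (extChartAt (𝓡 7) x₀).symm (ζ (a * s)).1) s =
      tangentOfChart x₀ (ζ (a * s)).1 (a • (ζ (a * s)).2) := fun s hs =>
    velocity_symm (hd1 s hs) (hζt _ (hmem s hs))
  refine ⟨⟨isOpen_Ioo, fun s hs => ⟨by linarith [hs.1], by linarith [hs.2]⟩, ?_, ?_⟩, hvel⟩
  · refine G.isParallelOn_tangentOfChart isOpen_Ioo hvel (fun s hs => hζt _ (hmem s hs)) hd1 ?_ ?_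
    · exact ContinuousOn.smul (f := fun _ => a) continuousOn_const
        fun s hs => (hd2 s hs).continuousAt.continuousWithinAt
    · intro s hs
      have h : HasDerivAt (fun s => a • (ζ (a * s)).2)
          (a • a • -G.christoffelTwo x₀ (ζ (a * s)).1 (ζ (a * s)).2 (ζ (a * s)).2) s :=
        (a • ContinuousLinearMap.id ℝ R7).hasFDerivAt.comp_hasDerivAt s (hd2 s hs)
      have e : -G.christoffelTwo x₀ (ζ (a * s)).1 (a • (ζ (a * s)).2) (a • (ζ (a * s)).2) =
          a • a • -G.christoffelTwo x₀ (ζ (a * s)).1 (ζ (a * s)).2 (ζ (a * s)).2 := by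
        rw [map_smul, map_smul, smul_neg, smul_neg]
        rfl
      rw [e]
      exact h
  · rw [hvel 0 (by norm_num), mul_zero, hζ0]
    have h := tangentOfChart_coordVector (X := (⟨p, a • v⟩ : TangentBundle (𝓡 7) M)) hp
    rw [coordVector_eq] at h
    rw [← h]
    change tangentOfChart x₀ _ _ = tangentOfChart x₀ _ (toChart x₀ p (a • v))
    rw [map_smul]

theorem IsGeodesicOn.continuousAt_velocity {γ : ℝ → M} {J : Set ℝ} (hγ : G.IsGeodesicOn γ J)
    (hJ : IsOpen J) {t : ℝ} (ht : t ∈ J) {x₀ : M} (h₀ : γ t ∈ (extChartAt (𝓡 7) x₀).source) :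
    ContinuousAt (fun s => coordVector x₀ (velocity γ s)) t :=
  (IsGeodesicOn.hasDerivAt G hγ hJ ht h₀).continuousAt.snd

/-- Uniqueness of geodesics. -/
theorem velocity_eq_of_isGeodesicFrom [T2Space M] {p : M} {v : R7} {γ₁ γ₂ : ℝ → M} {J₁ J₂ : Set ℝ}
    (h₁ : G.IsGeodesicFrom p v γ₁ J₁) (h₂ : G.IsGeodesicFrom p v γ₂ J₂) :
    ∀ s ∈ Set.Icc (0 : ℝ) 1, velocity γ₁ s = velocity γ₂ s := by
  obtain ⟨hJ₁, hI₁, hg₁, hv₁⟩ := h₁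
  obtain ⟨hJ₂, hI₂, hg₂, hv₂⟩ := h₂
  have hproj : ∀ (γ : ℝ → M) (s : ℝ), (velocity γ s).proj = γ s := fun _ _ => rfl
  have hsub : Set.Icc (0 : ℝ) 1 ⊆ {s | velocity γ₁ s = velocity γ₂ s} := by
    refine IsClosed.Icc_subset_of_forall_mem_nhdsWithin ?_ (hv₁.trans hv₂.symm) ?_
    · refine isClosed_of_closure_subset fun s hs => ?_
      have hsI : s ∈ Set.Icc (0 : ℝ) 1 :=
        closure_minimal Set.inter_subset_right isClosed_Icc hs
      have hfr : ∃ᶠ s' in 𝓝 s, velocity γ₁ s' = velocity γ₂ s' :=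
        (mem_closure_iff_frequently.1 hs).mono fun _ h => h.1
      have hc₁ := (IsGeodesicOn.mdifferentiableAt G hg₁ hJ₁ (hI₁ hsI)).continuousAt
      have hc₂ := (IsGeodesicOn.mdifferentiableAt G hg₂ hJ₂ (hI₂ hsI)).continuousAt
      have hγ : γ₁ s = γ₂ s := tendsto_nhds_unique_of_frequently_eq hc₁ hc₂
        (hfr.mono fun s' h => congrArg Bundle.TotalSpace.proj h)
      have hs₁ : γ₁ s ∈ (extChartAt (𝓡 7) (γ₁ s)).source := mem_extChartAt_source _
      have hs₂ : γ₂ s ∈ (extChartAt (𝓡 7) (γ₁ s)).source := hγ ▸ hs₁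
      refine ⟨tangent_ext hγ hs₁ ?_, hsI⟩
      exact tendsto_nhds_unique_of_frequently_eq
        (IsGeodesicOn.continuousAt_velocity G hg₁ hJ₁ (hI₁ hsI) hs₁)
        (IsGeodesicOn.continuousAt_velocity G hg₂ hJ₂ (hI₂ hsI) hs₂)
        (hfr.mono fun s' h => congrArg (coordVector (γ₁ s)) h)
    · rintro s ⟨hs, hsI⟩
      have hsI' := Set.Ico_subset_Icc_self hsI
      have hγ : γ₁ s = γ₂ s := congrArg Bundle.TotalSpace.proj hs
      have hs₁ : γ₁ s ∈ (extChartAt (𝓡 7) (γ₁ s)).source := mem_extChartAt_source _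
      have hs₂ : γ₂ s ∈ (extChartAt (𝓡 7) (γ₁ s)).source := hγ ▸ hs₁
      set x₀ := γ₁ s with hx₀
      set z : R7 × R7 := (extChartAt (𝓡 7) x₀ (γ₁ s), coordVector x₀ (velocity γ₁ s)) with hz
      have hz₂ : z = (extChartAt (𝓡 7) x₀ (γ₂ s), coordVector x₀ (velocity γ₂ s)) := by
        rw [hz, ← hγ, show velocity γ₁ s = velocity γ₂ s from hs]
      obtain ⟨K, W, hW, hlip⟩ := ((G.contDiffAt_geodesicField (x₀ := x₀) (z := z)
        ((extChartAt (𝓡 7) x₀).map_source hs₁)).of_le (m := 1) (by decide)).exists_lipschitzOnWith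
      have hev : ∀ (γ : ℝ → M) (J : Set ℝ), IsOpen J → s ∈ J → G.IsGeodesicOn γ J →
          γ s ∈ (extChartAt (𝓡 7) x₀).source →
          z = (extChartAt (𝓡 7) x₀ (γ s), coordVector x₀ (velocity γ s)) →
          ∀ᶠ t in 𝓝 s, γ t ∈ (extChartAt (𝓡 7) x₀).source ∧
            HasDerivAt (fun s => (extChartAt (𝓡 7) x₀ (γ s), coordVector x₀ (velocity γ s)))
            (G.geodesicField x₀ (extChartAt (𝓡 7) x₀ (γ t), coordVector x₀ (velocity γ t))) t ∧
            (extChartAt (𝓡 7) x₀ (γ t), coordVector x₀ (velocity γ t)) ∈ W := by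
        intro γ J hJ hsJ hg hγs hzγ
        have e1 : ∀ᶠ t in 𝓝 s, γ t ∈ (extChartAt (𝓡 7) x₀).source :=
          (IsGeodesicOn.mdifferentiableAt G hg hJ hsJ).continuousAt.preimage_mem_nhds
            ((isOpen_extChartAt_source (I := 𝓡 7) x₀).mem_nhds hγs)
        have e2 : ∀ᶠ t in 𝓝 s,
            (extChartAt (𝓡 7) x₀ (γ t), coordVector x₀ (velocity γ t)) ∈ W :=
          (IsGeodesicOn.hasDerivAt G hg hJ hsJ hγs).continuousAt.preimage_mem_nhds (hzγ ▸ hW)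
        filter_upwards [e1, e2, hJ.mem_nhds hsJ] with t h1 h2 h3
        exact ⟨h1, IsGeodesicOn.hasDerivAt G hg hJ h3 h1, h2⟩
      have E₁ := hev γ₁ J₁ hJ₁ (hI₁ hsI') hg₁ hs₁ rfl
      have E₂ := hev γ₂ J₂ hJ₂ (hI₂ hsI') hg₂ hs₂ hz₂
      have huniq := ODE_solution_unique_of_eventually (v := fun _ => G.geodesicField x₀)
        (s := fun _ => W) (K := K) (t₀ := s) (Filter.Eventually.of_forall fun _ => hlip)
        (E₁.mono fun _ h => h.2) (E₂.mono fun _ h => h.2) (hz.symm.trans hz₂)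
      refine nhdsWithin_le_nhds ?_
      filter_upwards [E₁, E₂, huniq] with t h1 h2 h3
      have h4 := Prod.ext_iff.1 h3
      exact tangent_ext ((extChartAt (𝓡 7) x₀).injOn h1.1 h2.1 h4.1) h1.1 h4.2
  exact fun s hs => hsub hs

/-- The exponential map, defined by a choice of geodesic, is computed by any geodesic. -/
theorem expMap_eq [T2Space M] {p : M} {v : R7} {γ : ℝ → M} {J : Set ℝ}
    (h : G.IsGeodesicFrom p v γ J) : G.expMap p v = γ 1 := by
  have hex : ∃ q : M, ∃ (γ : ℝ → M) (J : Set ℝ), G.IsGeodesicFrom p v γ J ∧ γ 1 = q :=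
    ⟨γ 1, γ, J, h, rfl⟩
  have h1 : G.expMap p v = hex.choose := dif_pos hex
  obtain ⟨γ', J', h', e⟩ := hex.choose_spec
  rw [h1, ← e]
  exact congrArg Bundle.TotalSpace.proj
    (G.velocity_eq_of_isGeodesicFrom h' h 1 (Set.right_mem_Icc.2 zero_le_one))

end G2Structure

/-! ### The exponential map and parallel transport near a tangent vector -/

namespace G2Structure

variable {M : Type*} [TopologicalSpace M] [ChartedSpace R7 M] (G : G2Structure M)
variable [IsManifold (𝓡 7) ∞ M]

/-- In a chart, parallel transport along a short geodesic exists, and it is close to the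
identity. -/
theorem norm_transportBack_sub_le [T2Space M] {x₀ p : M} (hp : p ∈ (extChartAt (𝓡 7) x₀).source)
    {v : R7} {ζ : ℝ → R7 × R7} {ε a C : ℝ}
    (hζ0 : ζ 0 = (extChartAt (𝓡 7) x₀ p, toChart x₀ p v))
    (hζt : ∀ t ∈ Set.Ioo (-ε) ε, (ζ t).1 ∈ (extChartAt (𝓡 7) x₀).target)
    (hζ : ∀ t ∈ Set.Ioo (-ε) ε, HasDerivAt ζ (G.geodesicField x₀ (ζ t)) t)
    (hC : ∀ t ∈ Set.Ioo (-ε) ε, ‖G.christoffelTwo x₀ (ζ t).1‖ * ‖(ζ t).2‖ ≤ C)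
    (ha : 3 * |a| < ε) (haC : |a| * C ≤ 1 / 8) (w : R7) :
    ‖toChart x₀ p (G.transportBack p (a • v : R7) w) -
      toChart x₀ (G.expMap p (a • v : R7)) w‖ ≤
      |a| * C * Real.exp 1 * ‖toChart x₀ (G.expMap p (a • v : R7)) w‖ := by
  obtain ⟨hgeo, hvel⟩ := G.isGeodesicFrom_symm hp hζ0 hζt hζ ha
  set γ : ℝ → M := fun s => (extChartAt (𝓡 7) x₀).symm (ζ (a * s)).1 with hγ
  set q : M := G.expMap p (a • v : R7) with hq
  have hq1 : q = γ 1 := G.expMap_eq hgeo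
  have hmem : ∀ s ∈ Set.Icc (-1 : ℝ) 3, a * s ∈ Set.Ioo (-ε) ε := by
    intro s hs
    rw [Set.mem_Ioo, ← abs_lt, abs_mul]
    have : |s| ≤ 3 := abs_le.2 ⟨by linarith [hs.1], hs.2⟩
    calc |a| * |s| ≤ |a| * 3 := by gcongr
      _ < ε := by linarith
  have hC0 : 0 ≤ C := (by positivity : (0 : ℝ) ≤ _).trans (hC _ (hmem 0 (by norm_num)))
  have hsource : ∀ s ∈ Set.Icc (-1 : ℝ) 3, γ s ∈ (extChartAt (𝓡 7) x₀).source := fun s hs =>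
    (extChartAt (𝓡 7) x₀).map_target (hζt _ (hmem s hs))
  have hext : ∀ s ∈ Set.Icc (-1 : ℝ) 3, extChartAt (𝓡 7) x₀ (γ s) = (ζ (a * s)).1 := fun s hs =>
    (extChartAt (𝓡 7) x₀).right_inv (hζt _ (hmem s hs))
  have hqs : q ∈ (extChartAt (𝓡 7) x₀).source := hq1 ▸ hsource 1 (by norm_num)
  -- the equation of parallel transport in the chart
  set A : ℝ → R7 →L[ℝ] R7 := fun s =>
    -G.christoffelTwo x₀ (ζ (a * s)).1 (a • (ζ (a * s)).2) with hA
  have hAn : ∀ s ∈ Set.Icc (-1 : ℝ) 3, ‖A s‖ ≤ |a| * C := by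
    intro s hs
    rw [hA]
    simp only [map_smul, norm_neg, norm_smul, Real.norm_eq_abs]
    have := (G.christoffelTwo x₀ (ζ (a * s)).1).le_opNorm (ζ (a * s)).2
    have := hC _ (hmem s hs)
    gcongr
    linarith
  have hζc : ∀ s ∈ Set.Icc (-1 : ℝ) 3, ContinuousAt (fun s => ζ (a * s)) s := fun s hs =>
    ContinuousAt.comp (f := fun s => a * s) (hζ _ (hmem s hs)).continuousAt (by fun_prop)
  have hAc : ContinuousOn A (Set.Icc (-1) 3) := by
    have h1 : ContinuousOn (fun s => (ζ (a * s)).1) (Set.Icc (-1) 3) := fun s hs =>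
      (hζc s hs).fst.continuousWithinAt
    have h2 : ContinuousOn (fun s => (ζ (a * s)).2) (Set.Icc (-1) 3) := fun s hs =>
      (hζc s hs).snd.continuousWithinAt
    have h3 := (G.contDiffOn_christoffelTwo x₀).continuousOn.comp h1
      (fun s hs => hζt _ (hmem s hs))
    exact (h3.clm_apply (h2.const_smul a)).neg
  -- transporting `w` backwards from time `1` shows that `transportBack` is not a junk value
  have hex : ∃ z : TangentSpace (𝓡 7) p,
      G.IsTransport p (a • v : R7) z (⟨q, w⟩ : TangentBundle (𝓡 7) M) := by
    obtain ⟨c, hc1, hc⟩ := exists_linear_ode_solution (t₀ := 1) (by norm_num) hAc hAn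
      (by linarith) (toChart x₀ q w)
    have hc' : ∀ s ∈ Set.Ioo (-1 : ℝ) 3, HasDerivAt c (A s (c s)) s := fun s hs =>
      (hc s (Set.Ioo_subset_Icc_self hs)).hasDerivAt (Icc_mem_nhds hs.1 hs.2)
    have hy : ∀ s ∈ Set.Ioo (-1 : ℝ) 3,
        HasDerivAt (fun s => (ζ (a * s)).1) (a • (ζ (a * s)).2) s := by
      intro s hs
      have h1 : HasDerivAt (fun s : ℝ => a * s) a s := by
        simpa using (hasDerivAt_id s).const_mul a
      exact (ContinuousLinearMap.fst ℝ R7 R7).hasFDerivAt.comp_hasDerivAt s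
        ((hζ _ (hmem s (Set.Ioo_subset_Icc_self hs))).scomp s h1)
    refine ⟨ofChart x₀ (extChartAt (𝓡 7) x₀ p) (c 0), γ, Set.Ioo (-1) 3,
      fun s => tangentOfChart x₀ (ζ (a * s)).1 (c s), hgeo, ?_, fun _ _ => rfl, ?_, ?_⟩
    · refine G.isParallelOn_tangentOfChart isOpen_Ioo (fun _ _ => rfl)
        (fun s hs => hζt _ (hmem s (Set.Ioo_subset_Icc_self hs))) hy ?_ hc'
      exact fun s hs => ((hζc s (Set.Ioo_subset_Icc_self hs)).snd.const_smul a).continuousWithinAt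
    · change tangentOfChart x₀ (ζ (a * 0)).1 (c 0) = _
      rw [mul_zero, hζ0]
      have h1 := (extChartAt (𝓡 7) x₀).left_inv hp
      refine tangent_ext (x₀ := x₀) h1 (tangentOfChart_proj_mem
        ((extChartAt (𝓡 7) x₀).map_source hp) _) ?_
      rw [coordVector_tangentOfChart ((extChartAt (𝓡 7) x₀).map_source hp), coordVector_eq]
      exact (toChart_ofChart' hp _).symm
    · have h1 := tangentOfChart_coordVector (X := (⟨q, w⟩ : TangentBundle (𝓡 7) M)) hqs
      rw [← h1]
      change tangentOfChart x₀ _ _ = tangentOfChart x₀ (extChartAt (𝓡 7) x₀ q) (toChart x₀ q w)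
      rw [hc1, hq1, hext 1 (by norm_num)]
  have htb : G.transportBack p (a • v : R7) w = hex.choose := dif_pos hex
  obtain ⟨γ', J', X, hgeo', hpar, hXp, hX0, hX1⟩ := hex.choose_spec
  rw [← htb] at hX0
  -- the geodesic in the chosen transport is the given one, so it stays in the chart
  have hveq := G.velocity_eq_of_isGeodesicFrom hgeo' hgeo
  obtain ⟨hJ', hI', hg', -⟩ := hgeo'
  have hsub : ∀ s ∈ Set.Icc (0 : ℝ) 1, s ∈ Set.Icc (-1 : ℝ) 3 := fun s hs =>
    ⟨by linarith [hs.1], by linarith [hs.2]⟩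
  have hXγ : ∀ s ∈ Set.Icc (0 : ℝ) 1, (X s).proj = γ s := fun s hs =>
    (hXp s (hI' hs)).trans (congrArg Bundle.TotalSpace.proj (hveq s hs))
  have hder : ∀ s ∈ Set.Icc (0 : ℝ) 1,
      HasDerivAt (fun s => coordVector x₀ (X s)) (A s (coordVector x₀ (X s))) s := by
    intro s hs
    have hs' := hsub s hs
    have hXs : (X s).proj ∈ (extChartAt (𝓡 7) x₀).source := hXγ s hs ▸ hsource s hs'
    have h1 := IsParallelOn.hasDerivAt G hpar hJ' (hI' hs) hXs
    have h2 : deriv (fun s => extChartAt (𝓡 7) x₀ (X s).proj) s = a • (ζ (a * s)).2 := by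
      have e : (fun s => extChartAt (𝓡 7) x₀ (X s).proj) =ᶠ[𝓝 s]
          fun s => extChartAt (𝓡 7) x₀ (γ' s) := by
        filter_upwards [hJ'.mem_nhds (hI' hs)] with t ht
        rw [hXp t ht]
      rw [e.deriv_eq, IsGeodesicOn.deriv_eq G hg' hJ' (hI' hs) (hXp s (hI' hs) ▸ hXs), hveq s hs,
        hvel s ⟨by linarith [hs.1], by linarith [hs.2]⟩,
        coordVector_tangentOfChart (hζt _ (hmem s hs'))]
    rw [h2, hXγ s hs, hext s hs'] at h1
    exact h1
  set c : ℝ → R7 := fun s => coordVector x₀ (X s) with hcdef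
  have hc0 : c 0 = toChart x₀ p (G.transportBack p (a • v : R7) w) := by
    rw [hcdef]; simp only [hX0]; rfl
  have hc1 : c 1 = toChart x₀ q w := by
    rw [hcdef]; simp only [hX1]; rfl
  have hac : |a| * C ≤ 1 := by linarith
  have hac0 : 0 ≤ |a| * C := by positivity
  have hbound : ∀ s ∈ Set.Icc (0 : ℝ) 1, ‖c s‖ ≤ ‖c 1‖ * Real.exp 1 := by
    intro s hs
    have h := norm_le_gronwallBound_abs (K := |a| * C) (ε := 0) (Set.right_mem_Icc.2 zero_le_one)
      (fun t ht => (hder t ht).hasDerivWithinAt) (fun t ht => by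
        rw [add_zero]
        exact ((A t).le_opNorm _).trans (by gcongr; exact hAn t (hsub t ht))) hs
    rw [gronwallBound_ε0] at h
    refine h.trans ?_
    gcongr
    have h1 : |s - 1| ≤ 1 := abs_le.2 ⟨by linarith [hs.1], by linarith [hs.2]⟩
    calc |a| * C * |s - 1| ≤ 1 * 1 := by gcongr
      _ = 1 := one_mul 1
  have hfin := (convex_Icc (0 : ℝ) 1).norm_image_sub_le_of_norm_hasDerivWithin_le
    (f := c) (f' := fun s => A s (c s)) (C := |a| * C * (‖c 1‖ * Real.exp 1))
    (fun s hs => (hder s hs).hasDerivWithinAt) (fun s hs =>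
      ((A s).le_opNorm _).trans (mul_le_mul (hAn s (hsub s hs)) (hbound s hs) (norm_nonneg _) hac0))
    (Set.right_mem_Icc.2 zero_le_one) (Set.left_mem_Icc.2 zero_le_one)
  rw [hc0, hc1] at hfin
  refine hfin.trans (le_of_eq ?_)
  rw [zero_sub, norm_neg, norm_one]
  ring

/-- The exponential map and parallel transport near a tangent vector, in a chart: for small `a`, the
map `v ↦ exp (a v)` is the time `a` flow `Φ` of the geodesic vector field, whose derivative `J a`
at the given vector is differentiable in `a`. -/
theorem exists_geodesic_flow [T2Space M] {x₀ p₀ : M} (hp₀ : p₀ ∈ (extChartAt (𝓡 7) x₀).source)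
    (v₀ : R7) :
    ∃ r > 0, ∃ δ > 0, ∃ (C : ℝ) (Φ : R7 × R7 → ℝ → R7 × R7) (J : ℝ → R7 × R7 →L[ℝ] R7 × R7),
      (∀ p ∈ (extChartAt (𝓡 7) x₀).source, ∀ v : R7,
        (extChartAt (𝓡 7) x₀ p, toChart x₀ p v) ∈
          Metric.ball (extChartAt (𝓡 7) x₀ p₀, toChart x₀ p₀ v₀) r → ∀ a : ℝ, |a| < δ →
          G.expMap p (a • v : R7) ∈ (extChartAt (𝓡 7) x₀).source ∧
          extChartAt (𝓡 7) x₀ (G.expMap p (a • v : R7)) =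
            (Φ (extChartAt (𝓡 7) x₀ p, toChart x₀ p v) a).1) ∧
      Φ (extChartAt (𝓡 7) x₀ p₀, toChart x₀ p₀ v₀) 0 =
        (extChartAt (𝓡 7) x₀ p₀, toChart x₀ p₀ v₀) ∧
      HasDerivAt (Φ (extChartAt (𝓡 7) x₀ p₀, toChart x₀ p₀ v₀))
        (G.geodesicField x₀ (extChartAt (𝓡 7) x₀ p₀, toChart x₀ p₀ v₀)) 0 ∧
      J 0 = ContinuousLinearMap.id ℝ _ ∧
      HasDerivAt J (fderiv ℝ (G.geodesicField x₀) (extChartAt (𝓡 7) x₀ p₀, toChart x₀ p₀ v₀)) 0 ∧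
      (∀ a : ℝ, |a| < δ →
        HasFDerivAt (fun z => Φ z a) (J a) (extChartAt (𝓡 7) x₀ p₀, toChart x₀ p₀ v₀)) ∧
      ∀ a : ℝ, |a| < δ → ∀ w : R7, ‖toChart x₀ p₀ (G.transportBack p₀ (a • v₀ : R7) w) -
        toChart x₀ (G.expMap p₀ (a • v₀ : R7)) w‖ ≤
        |a| * C * ‖toChart x₀ (G.expMap p₀ (a • v₀ : R7)) w‖ := by
  set z₀ : R7 × R7 := (extChartAt (𝓡 7) x₀ p₀, toChart x₀ p₀ v₀) with hz₀
  have hz₀t : z₀.1 ∈ (extChartAt (𝓡 7) x₀).target := (extChartAt (𝓡 7) x₀).map_source hp₀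
  set C₀ : ℝ := ‖G.christoffelTwo x₀ z₀.1‖ * ‖z₀.2‖ + 1 with hC₀
  have hC₀0 : 0 < C₀ := by positivity
  have hU : {z : R7 × R7 | z.1 ∈ (extChartAt (𝓡 7) x₀).target ∧
      ‖G.christoffelTwo x₀ z.1‖ * ‖z.2‖ < C₀} ∈ 𝓝 z₀ := by
    refine Filter.inter_mem (continuousAt_fst.preimage_mem_nhds
      ((isOpen_chart_target x₀).mem_nhds hz₀t)) ?_
    have h1 : ContinuousAt (fun z : R7 × R7 => G.christoffelTwo x₀ z.1) z₀ :=
      ContinuousAt.comp (f := Prod.fst) (((G.contDiffOn_christoffelTwo x₀).continuousOn).continuousAt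
        ((isOpen_chart_target x₀).mem_nhds hz₀t)) continuousAt_fst
    have h2 : ContinuousAt (fun z : R7 × R7 => ‖G.christoffelTwo x₀ z.1‖ * ‖z.2‖) z₀ :=
      (ContinuousAt.norm (E := R7 →L[ℝ] R7 →L[ℝ] R7) h1).mul continuousAt_snd.norm
    exact h2.eventually_lt continuousAt_const (lt_add_one _)
  obtain ⟨r, hr, ε, hε, Φ, J, hΦ, hJ0, hJd, hJf⟩ :=
    exists_flow_hasFDerivAt ((G.contDiffAt_geodesicField hz₀t).of_le (by decide)) hU
  have hz₀r : z₀ ∈ Metric.ball z₀ r := Metric.mem_ball_self hr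
  refine ⟨r, hr, min (ε / 3) (1 / (8 * C₀)), by positivity, C₀ * Real.exp 1, Φ, J, ?_,
    (hΦ z₀ hz₀r).1, ?_, hJ0, hJd, ?_, ?_⟩
  · intro p hp v hpv a ha
    have ha' : 3 * |a| < ε := by have := ha.trans_le (min_le_left _ _); linarith
    obtain ⟨hgeo, -⟩ := G.isGeodesicFrom_symm hp (hΦ _ hpv).1
      (fun t ht => ((hΦ _ hpv).2 t ht).1.1) (fun t ht => ((hΦ _ hpv).2 t ht).2) ha'
    rw [G.expMap_eq hgeo, mul_one]
    have hat : a ∈ Set.Ioo (-ε) ε := abs_lt.1 (by linarith [abs_nonneg a])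
    have ht := ((hΦ _ hpv).2 a hat).1.1
    exact ⟨(extChartAt (𝓡 7) x₀).map_target ht, (extChartAt (𝓡 7) x₀).right_inv ht⟩
  · have h := ((hΦ z₀ hz₀r).2 0 ⟨by linarith, hε⟩).2
    rw [(hΦ z₀ hz₀r).1] at h
    exact h
  · intro a ha
    have := ha.trans_le (min_le_left _ _)
    exact hJf a (abs_lt.1 (by linarith [abs_nonneg a]))
  · intro a ha w
    have ha' : 3 * |a| < ε := by have := ha.trans_le (min_le_left _ _); linarith
    have haC : |a| * C₀ ≤ 1 / 8 := by
      have := (ha.trans_le (min_le_right _ _)).le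
      calc |a| * C₀ ≤ 1 / (8 * C₀) * C₀ := by gcongr
        _ = 1 / 8 := by field_simp
    rw [← mul_assoc]
    exact G.norm_transportBack_sub_le hp₀ (hΦ z₀ hz₀r).1 (fun t ht => ((hΦ _ hz₀r).2 t ht).1.1)
      (fun t ht => ((hΦ _ hz₀r).2 t ht).2) (fun t ht => ((hΦ _ hz₀r).2 t ht).1.2.le) ha' haC w

end G2Structure

/-! ### First variation of a four-form -/

/-- The derivative at `t = 0` of `ψ (w, A₀ t, A₁ t, A₂ t)` at a moving point `Y t`, where `Y` has
value `y` and derivative `a`, and `Aᵢ` has value `B i` and derivative `H i`. -/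
def firstVar (ψ : R7 → R7 [⋀^Fin 4]→L[ℝ] ℝ) (y a : R7) (B H : Fin 3 → R7) (w : R7) : ℝ :=
  fderiv ℝ ψ y a (Matrix.vecCons w B) + ∑ i, ψ y (Matrix.vecCons w (Function.update B i (H i)))

theorem hasDerivAt_firstVar {ψ : R7 → R7 [⋀^Fin 4]→L[ℝ] ℝ} {Y : ℝ → R7} {A : Fin 3 → ℝ → R7}
    {a : R7} {H : Fin 3 → R7} {t : ℝ} (hψ : DifferentiableAt ℝ ψ (Y t)) (hY : HasDerivAt Y a t)
    (hA : ∀ i, HasDerivAt (A i) (H i) t) (w : R7) :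
    HasDerivAt (fun t => ψ (Y t) (Matrix.vecCons w fun i => A i t))
      (firstVar ψ (Y t) a (fun i => A i t) H w) t := by
  have hg : ∀ i : Fin 4, HasDerivAt (Matrix.vecCons (fun _ => w) A i) (Matrix.vecCons 0 H i) t := by
    intro i
    refine Fin.cases ?_ (fun j => ?_) i
    · exact hasDerivAt_const t w
    · exact hA j
  have h := (((hψ.hasFDerivAt.comp t hY.hasFDerivAt)).continuousAlternatingMap_apply
    (fun i => (hg i).hasFDerivAt)).hasDerivAt
  have e1 : ∀ s, (fun i => Matrix.vecCons (fun _ => w) A i s) = Matrix.vecCons w fun i => A i s := by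
    intro s
    funext i
    refine Fin.cases ?_ (fun j => ?_) i <;> rfl
  have e2 : ∀ i (b : R7), Function.update (Matrix.vecCons w fun i => A i t) (Fin.succ i) b =
      Matrix.vecCons w (Function.update (fun i => A i t) i b) := by
    intro i b
    exact (Fin.cons_update _ _ _ _).symm
  simp only [Function.comp_apply, e1] at h
  refine h.congr_deriv ?_
  simp [firstVar, Fin.sum_univ_succ (n := 3), e2]

theorem map_cons_last (b : R7 [⋀^Fin 4]→L[ℝ] ℝ) (v : Fin 3 → R7) (w : R7) :
    b ![v 0, v 1, v 2, w] = -b (Matrix.vecCons w v) := by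
  have h := b.toAlternatingMap.map_perm (Matrix.vecCons w v) (finRotate 4)
  have hs : Equiv.Perm.sign (finRotate 4) = -1 := by decide
  rw [hs] at h
  have e : (Matrix.vecCons w v) ∘ (finRotate 4) = ![v 0, v 1, v 2, w] := by
    funext i
    fin_cases i <;> rfl
  rw [e] at h
  exact h.trans (by simp)

theorem map_cons_smul_e7 (b : R7 [⋀^Fin 4]→L[ℝ] ℝ) (v : Fin 3 → R7) (w : R7) :
    inner ℝ (∑ k, b (Matrix.vecCons (e7 k) v) • e7 k) w = b (Matrix.vecCons w v) := by
  exact G2Structure.sum_inner_smul_e7 ((ContinuousAlternatingMap.apply ℝ R7 ℝ v).comp b.curryLeft) w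

theorem map_last_smul_e7 (b : R7 [⋀^Fin 4]→L[ℝ] ℝ) (x y z w : R7) :
    inner ℝ (∑ k, b ![x, y, z, e7 k] • e7 k) w = b ![x, y, z, w] := by
  have h : ∀ w, b ![x, y, z, w] = -b (Matrix.vecCons w ![x, y, z]) :=
    map_cons_last b ![x, y, z]
  simp only [h, neg_smul, Finset.sum_neg_distrib, inner_neg_left, map_cons_smul_e7]

theorem firstVar_linear (ψ : R7 → R7 [⋀^Fin 4]→L[ℝ] ℝ) (y a : R7) (B H : Fin 3 → R7) (w : R7) :
    inner ℝ (∑ k, firstVar ψ y a B H (e7 k) • e7 k) w = firstVar ψ y a B H w := by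
  simp only [firstVar, add_smul, Finset.sum_add_distrib, inner_add_left, map_cons_smul_e7,
    Finset.sum_smul]
  rw [Finset.sum_comm, sum_inner]
  simp only [map_cons_smul_e7]

/-- The first variation vanishes on the vectors of a triple `B` with `ψ(·, B) = 0`, whatever the
variations `a` and `H` are. -/
theorem firstVar_self {ψ : R7 → R7 [⋀^Fin 4]→L[ℝ] ℝ} {y : R7} {B : Fin 3 → R7}
    (h : ∀ w, ψ y (Matrix.vecCons w B) = 0) (a : R7) (H : Fin 3 → R7) (j : Fin 3) :
    firstVar ψ y a B H (B j) = 0 := by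
  have hz : ∀ (b : R7 [⋀^Fin 4]→L[ℝ] ℝ) (v : Fin 3 → R7) (i : Fin 3),
      b (Matrix.vecCons (v i) v) = 0 := fun b v i =>
    b.map_eq_zero_of_eq _ (i := 0) (j := i.succ) (by simp) (Fin.succ_ne_zero i).symm
  have hi : ∀ i, ψ y (Matrix.vecCons (B j) (Function.update B i (H i))) = 0 := by
    intro i
    by_cases hij : i = j
    · subst hij
      -- exchanging the two vectors gives back the vanishing of `ψ` on `B`
      have h1 := (ψ y).toAlternatingMap.map_swap
        (Matrix.vecCons (B i) (Function.update B i (H i))) (i := 0) (j := i.succ)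
        (Fin.succ_ne_zero i).symm
      have e : (Matrix.vecCons (B i) (Function.update B i (H i))) ∘ Equiv.swap 0 i.succ =
          Matrix.vecCons (H i) B := by
        funext k
        refine Fin.cases ?_ (fun l => ?_) k
        · simp
        · by_cases hl : l = i
          · subst hl; simp
          · have : Equiv.swap (0 : Fin 4) i.succ l.succ = l.succ :=
              Equiv.swap_apply_of_ne_of_ne (Fin.succ_ne_zero l) (fun h => hl (Fin.succ_injective _ h))
            simp [this, hl]
      rw [e] at h1
      have h2 := h (H i)
      exact neg_eq_zero.1 (h1.symm.trans h2)
    · have := hz (ψ y) (Function.update B i (H i)) j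
      rwa [Function.update_of_ne (Ne.symm hij)] at this
  rw [firstVar, hz, zero_add]
  exact Finset.sum_eq_zero fun i _ => hi i

namespace G2Structure

variable {M : Type*} [TopologicalSpace M] [ChartedSpace R7 M] (G : G2Structure M)
variable [IsManifold (𝓡 7) ∞ M]

theorem metric_chi (p : M) (x y z w : R7) :
    G.metric p (G.chi p x y z) w = G.starForm p ![x, y, z, w] := by
  set u := G.frame p with hu
  have h1 : u (G.chi p x y z) = ∑ k, starPhi0 ![u x, u y, u z, e7 k] • e7 k := by
    refine (map_sum u _ _).trans ?_
    refine Finset.sum_congr rfl fun k _ => ?_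
    rw [map_smul, u.apply_symm_apply]
    congr 1
    change starPhi0 _ = _
    congr 1
    funext i
    fin_cases i <;> try rfl
    exact u.apply_symm_apply _
  have h2 : G.starForm p ![x, y, z, w] = starPhi0 ![u x, u y, u z, u w] := by
    change starPhi0 _ = _
    congr 1
    funext i
    fin_cases i <;> rfl
  change inner ℝ (u (G.chi p x y z)) (u w) = _
  rw [h1, h2]
  exact map_last_smul_e7 starPhi0 _ _ _ _

/-- The vector dual, for the metric in the chart around `x₀`, to a covector with the given
components. -/
def sharpInChart (x₀ : M) (y : R7) (c : Fin 7 → ℝ) : R7 := G.metricInv x₀ y (∑ k, c k • e7 k)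

theorem metricInChart_sharpInChart {x₀ : M} {y : R7} (hy : y ∈ (extChartAt (𝓡 7) x₀).target)
    (c : Fin 7 → ℝ) (w : R7) :
    G.metricInChart x₀ y (G.sharpInChart x₀ y c) w = inner ℝ (∑ k, c k • e7 k) w := by
  rw [← G.inner_metricOp hy, sharpInChart, metricOp_metricInv G hy]

theorem eq_sharpInChart {x₀ : M} {y : R7} (hy : y ∈ (extChartAt (𝓡 7) x₀).target)
    {v : R7} {c : Fin 7 → ℝ}
    (h : ∀ w, G.metricInChart x₀ y v w = inner ℝ (∑ k, c k • e7 k) w) :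
    v = G.sharpInChart x₀ y c := by
  rw [sharpInChart, ← metricInv_metricOp G hy v]
  congr 1
  refine ext_inner_right ℝ fun w => ?_
  rw [G.inner_metricOp hy, h]

theorem toChart_chi {x₀ p : M} (hp : p ∈ (extChartAt (𝓡 7) x₀).source) (v : Fin 3 → R7) :
    toChart x₀ p (G.chi p (v 0) (v 1) (v 2)) =
      G.sharpInChart x₀ (extChartAt (𝓡 7) x₀ p) fun k =>
        -formInChart G.starForm x₀ (extChartAt (𝓡 7) x₀ p)
          (Matrix.vecCons (e7 k) fun i => toChart x₀ p (v i)) := by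
  refine G.eq_sharpInChart ((extChartAt (𝓡 7) x₀).map_source hp) fun w => ?_
  have h1 := map_cons_smul_e7 (-formInChart G.starForm x₀ (extChartAt (𝓡 7) x₀ p))
    (fun i => toChart x₀ p (v i)) w
  refine Eq.trans ?_ h1.symm
  have hw : w = toChart x₀ p (ofChart x₀ (extChartAt (𝓡 7) x₀ p) w) := (toChart_ofChart' hp w).symm
  rw [hw]
  refine (G.metric_eq_metricInChart hp _ _).symm.trans ?_
  refine (G.metric_chi p _ _ _ _).trans ((apply_eq_formInChart _ hp _).trans ?_)
  rw [← hw]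
  refine Eq.trans ?_ (map_cons_last _ _ w)
  congr 1
  funext i
  fin_cases i <;> try rfl
  exact toChart_ofChart' hp w

theorem starForm_eq_zero_of_form_eq_one {p : M} {v : Fin 3 → R7}
    (hv : ∀ i j, G.metric p (v i) (v j) = if i = j then 1 else 0) (h : G.form p v = 1) (w : R7) :
    G.starForm p (Matrix.vecCons w v) = 0 := by
  set u := G.frame p with hu
  have hv' : ∀ i j, inner ℝ (u (v i)) (u (v j)) = if i = j then (1 : ℝ) else 0 := hv
  have h1 : phi0 ![u (v 0), u (v 1), u (v 2)] = 1 := by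
    rw [← h, frame_spec]
    change _ = phi0 _
    congr 1
    funext i
    fin_cases i <;> rfl
  have h2 : starPhi0 ![u (v 0), u (v 1), u (v 2), u w] = 0 :=
    starPhi0_eq_zero_of_phi0_eq_one (hv' 0 0) (hv' 1 1) (hv' 2 2) (hv' 0 1) (hv' 0 2) (hv' 1 2) h1 _
  have h3 := map_cons_last starPhi0 (fun i => u (v i)) (u w)
  rw [h2] at h3
  have h4 : G.starForm p (Matrix.vecCons w v) = starPhi0 (Matrix.vecCons (u w) fun i => u (v i)) := by
    change starPhi0 _ = _
    congr 1
    funext i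
    refine Fin.cases ?_ (fun j => ?_) i <;> rfl
  rw [h4]
  linarith

end G2Structure

/-! ### The linearization of the deformation map -/

/-- A function that agrees with `c` up to a factor `1 + O(a)`, where `c` vanishes at `0`, has the
same derivative at `0`. -/
theorem hasDerivAt_of_norm_sub_le {E : Type*} [NormedAddCommGroup E] [NormedSpace ℝ E]
    {N c : ℝ → E} {c' : E} {δ C : ℝ} (hδ : 0 < δ) (hc0 : c 0 = 0) (hc : HasDerivAt c c' 0)
    (h : ∀ a, |a| < δ → ‖N a - c a‖ ≤ |a| * C * ‖c a‖) : HasDerivAt N c' 0 := by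
  have h0 : N 0 = 0 := by
    have := h 0 (by simpa using hδ)
    simpa [hc0] using this
  have hd : HasDerivAt (fun a => N a - c a) 0 0 := by
    rw [hasDerivAt_iff_isLittleO_nhds_zero]
    simp only [zero_add, h0, hc0, sub_zero, smul_zero]
    have h1 : (fun a => N a - c a) =O[𝓝 0] fun a : ℝ => a * ‖c a‖ := by
      refine Asymptotics.IsBigO.of_bound C ?_
      filter_upwards [Metric.ball_mem_nhds (0 : ℝ) hδ] with a ha
      have := h a (by simpa [Real.dist_eq] using ha)
      rw [Real.norm_eq_abs, abs_mul, abs_norm]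
      linarith
    have h2 : (fun a : ℝ => a * ‖c a‖) =o[𝓝 0] fun a : ℝ => a := by
      have h3 : (fun a => ‖c a‖) =o[𝓝 0] fun _ : ℝ => (1 : ℝ) := by
        rw [Asymptotics.isLittleO_one_iff]
        have := hc.continuousAt.norm
        rwa [ContinuousAt, hc0, norm_zero] at this
      simpa using (Asymptotics.isBigO_refl (fun a : ℝ => a) (𝓝 0)).mul_isLittleO h3
    exact h1.trans_isLittleO h2
  have h3 := hd.add hc
  rw [zero_add] at h3
  have e : (fun a => N a - c a) + c = N := by
    funext a; simp
  rwa [e] at h3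

/-- Where `u` vanishes, the derivative of `K` does not enter the product rule. -/
theorem hasDerivAt_clm_apply_of_eq_zero {E F : Type*} [NormedAddCommGroup E] [NormedSpace ℝ E]
    [NormedAddCommGroup F] [NormedSpace ℝ F] {K : ℝ → E →L[ℝ] F} {u : ℝ → E} {u' : E} {t : ℝ}
    (hK : DifferentiableAt ℝ K t) (hu : HasDerivAt u u' t) (h0 : u t = 0) :
    HasDerivAt (fun s => K s (u s)) (K t u') t := by
  have h := hK.hasDerivAt.clm_apply hu
  rwa [h0, map_zero, zero_add] at h

namespace G2Structure

variable {M : Type*} [TopologicalSpace M] [ChartedSpace R7 M] (G : G2Structure M)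
  {L : Type*} [TopologicalSpace L] [ChartedSpace R3 L] [IsManifold (𝓡 7) ∞ M]

/-- A map into `M` in the chart around `x₀`. -/
def chartMap (ι : L → M) (x₀ : M) (x : L) : R7 := extChartAt (𝓡 7) x₀ (ι x)

/-- A vector field along a map in the chart around `x₀`. -/
def chartField (ι : L → M) (V : ∀ x : L, TangentSpace (𝓡 7) (ι x)) (x₀ : M) (x : L) : R7 :=
  toChart x₀ (ι x) (V x)

theorem contMDiffAt_chartMap (ι : C^∞⟮𝓡 3, L; 𝓡 7, M⟯) {x₀ : M} {x : L}
    (hx : ι x ∈ (extChartAt (𝓡 7) x₀).source) :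
    ContMDiffAt (𝓡 3) 𝓘(ℝ, R7) ∞ (chartMap ι x₀) x :=
  ((contMDiffAt_iff_ext le_rfl hx).1 (ι.contMDiff x)).2

theorem contMDiffAt_chartField {ι : L → M} {V : ∀ x : L, TangentSpace (𝓡 7) (ι x)}
    (hV : ContMDiff (𝓡 3) (𝓡 7).tangent ∞ (fun x => (⟨ι x, V x⟩ : TangentBundle (𝓡 7) M)))
    {x₀ : M} {x : L} (hx : ι x ∈ (extChartAt (𝓡 7) x₀).source) :
    ContMDiffAt (𝓡 3) 𝓘(ℝ, R7) ∞ (chartField ι V x₀) x :=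
  ((contMDiffAt_tangent_iff (f := fun x => (⟨ι x, V x⟩ : TangentBundle (𝓡 7) M)) hx).1 (hV x)).2

/-- The derivative of a map `L → ℝ⁷`. -/
def derivAt (f : L → R7) (x : L) : R3 →L[ℝ] R7 := mfderiv (𝓡 3) 𝓘(ℝ, R7) f x

theorem derivAt_chartMap (ι : C^∞⟮𝓡 3, L; 𝓡 7, M⟯) {x₀ : M} {x : L}
    (hx : ι x ∈ (extChartAt (𝓡 7) x₀).source) (v : R3) :
    derivAt (chartMap ι x₀) x v = toChart x₀ (ι x) (mfderiv (𝓡 3) (𝓡 7) ι x v) := by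
  have h := mfderiv_comp x (mdifferentiableAt_extChartAt' hx)
    ((ι.contMDiff x).mdifferentiableAt (by simp))
  exact congrArg (fun A : R3 →L[ℝ] R7 => A v) h

/-- The derivative at `x` of `exp (a V)`, in a chart, in terms of the derivative `J` of the geodesic
flow. -/
theorem toChart_mfderiv_expSection (ι : C^∞⟮𝓡 3, L; 𝓡 7, M⟯)
    {V : ∀ x : L, TangentSpace (𝓡 7) (ι x)}
    (hV : ContMDiff (𝓡 3) (𝓡 7).tangent ∞ (fun x => (⟨ι x, V x⟩ : TangentBundle (𝓡 7) M)))
    {x₀ : M} {x : L} (hx : ι x ∈ (extChartAt (𝓡 7) x₀).source) {r a : ℝ} (hr : 0 < r)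
    {Φ : R7 × R7 → R7 × R7} {J : R7 × R7 →L[ℝ] R7 × R7}
    (hΦ : ∀ p ∈ (extChartAt (𝓡 7) x₀).source, ∀ v : R7,
        (extChartAt (𝓡 7) x₀ p, toChart x₀ p v) ∈
          Metric.ball (extChartAt (𝓡 7) x₀ (ι x), toChart x₀ (ι x) (V x)) r →
          G.expMap p (a • v : R7) ∈ (extChartAt (𝓡 7) x₀).source ∧
          extChartAt (𝓡 7) x₀ (G.expMap p (a • v : R7)) =
            (Φ (extChartAt (𝓡 7) x₀ p, toChart x₀ p v)).1)
    (hJ : HasFDerivAt Φ J (extChartAt (𝓡 7) x₀ (ι x), toChart x₀ (ι x) (V x))) (v : R3) :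
    toChart x₀ (G.expSection ι (a • V) x) (mfderiv (𝓡 3) (𝓡 7) (G.expSection ι (a • V)) x v) =
      (J (derivAt (chartMap ι x₀) x v, derivAt (chartField ι V x₀) x v)).1 := by
  have hy := (contMDiffAt_chartMap ι hx).mdifferentiableAt (by simp)
  have hv := (contMDiffAt_chartField hV hx).mdifferentiableAt (by simp)
  have h1 : HasMFDerivAt (𝓡 3) 𝓘(ℝ, R7 × R7)
      (fun x' => (chartMap ι x₀ x', chartField ι V x₀ x')) x
      ((derivAt (chartMap ι x₀) x).prod (derivAt (chartField ι V x₀) x)) :=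
    ⟨hy.hasMFDerivAt.1.prodMk hv.hasMFDerivAt.1, hy.hasMFDerivAt.2.prodMk hv.hasMFDerivAt.2⟩
  have hJ' : HasFDerivAt (fun z => (Φ z).1) ((ContinuousLinearMap.fst ℝ R7 R7).comp J)
      (chartMap ι x₀ x, chartField ι V x₀ x) :=
    (ContinuousLinearMap.fst ℝ R7 R7).hasFDerivAt.comp _ hJ
  have h2 : HasMFDerivAt (𝓡 3) 𝓘(ℝ, R7)
      (fun x' => (Φ (chartMap ι x₀ x', chartField ι V x₀ x')).1) x
      (((ContinuousLinearMap.fst ℝ R7 R7).comp J).comp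
        ((derivAt (chartMap ι x₀) x).prod (derivAt (chartField ι V x₀) x))) :=
    HasMFDerivAt.comp (g := fun z => (Φ z).1) x hJ'.hasMFDerivAt h1
  have hnear : ∀ᶠ x' in 𝓝 x, ι x' ∈ (extChartAt (𝓡 7) x₀).source ∧
      (chartMap ι x₀ x', chartField ι V x₀ x') ∈
        Metric.ball (chartMap ι x₀ x, chartField ι V x₀ x) r :=
    Filter.Eventually.and ((ι.contMDiff x).continuousAt.preimage_mem_nhds
      ((isOpen_extChartAt_source (I := 𝓡 7) x₀).mem_nhds hx))
      (h1.continuousAt.preimage_mem_nhds (Metric.ball_mem_nhds _ hr))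
  have heq : G.expSection ι (a • V) =ᶠ[𝓝 x] fun x' => (extChartAt (𝓡 7) x₀).symm
      (Φ (chartMap ι x₀ x', chartField ι V x₀ x')).1 := by
    filter_upwards [hnear] with x' hx'
    obtain ⟨h3, h4⟩ := hΦ (ι x') hx'.1 (V x') hx'.2
    change G.expMap (ι x') (a • V x' : R7) = (extChartAt (𝓡 7) x₀).symm
      (Φ (extChartAt (𝓡 7) x₀ (ι x'), toChart x₀ (ι x') (V x'))).1
    rw [← h4]
    exact ((extChartAt (𝓡 7) x₀).left_inv h3).symm
  obtain ⟨h3, h4⟩ := hΦ (ι x) hx (V x) (Metric.mem_ball_self hr)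
  have htarget : (Φ (chartMap ι x₀ x, chartField ι V x₀ x)).1 ∈ (extChartAt (𝓡 7) x₀).target := by
    change (Φ (extChartAt (𝓡 7) x₀ (ι x), toChart x₀ (ι x) (V x))).1 ∈ _
    rw [← h4]
    exact (extChartAt (𝓡 7) x₀).map_source h3
  have h5 := ((mdifferentiableAt_extChartAt_symm' htarget).hasMFDerivAt.comp x h2).congr_of_eventuallyEq
    heq
  have h6 : (mfderiv (𝓡 3) (𝓡 7) (G.expSection ι (a • V)) x v : R7) =
      ofChart x₀ (Φ (chartMap ι x₀ x, chartField ι V x₀ x)).1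
        (J (derivAt (chartMap ι x₀) x v, derivAt (chartField ι V x₀) x v)).1 :=
    congrArg (fun A : R3 →L[ℝ] R7 => A v) h5.mfderiv
  have h7 : toChart x₀ (G.expSection ι (a • V) x) =
      toChart x₀ ((extChartAt (𝓡 7) x₀).symm (Φ (chartMap ι x₀ x, chartField ι V x₀ x)).1) :=
    congrArg (toChart x₀) heq.eq_of_nhds
  rw [h7]
  refine (congrArg _ h6).trans ?_
  exact toChart_ofChart htarget _

/-- The vector with components `firstVar`, in the chart around `x₀`: the derivative of
`χ (A₀ t, A₁ t, A₂ t)` when `χ` vanishes at `t = 0`. -/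
def variationVector (x₀ : M) (y a : R7) (B H : Fin 3 → R7) : R7 :=
  G.sharpInChart x₀ y fun k => -firstVar (formInChart G.starForm x₀) y a B H (e7 k)

theorem metricInChart_variationVector {x₀ : M} {y : R7} (hy : y ∈ (extChartAt (𝓡 7) x₀).target)
    (a : R7) (B H : Fin 3 → R7) (w : R7) :
    G.metricInChart x₀ y (G.variationVector x₀ y a B H) w =
      -firstVar (formInChart G.starForm x₀) y a B H w := by
  rw [variationVector, metricInChart_sharpInChart G hy]
  simp only [neg_smul, Finset.sum_neg_distrib, inner_neg_left, firstVar_linear]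

theorem differentiableAt_formInChart_starForm {x₀ : M} {y : R7}
    (hy : y ∈ (extChartAt (𝓡 7) x₀).target) :
    DifferentiableAt ℝ (formInChart G.starForm x₀) y :=
  ((G.contDiffOn_formInChart_starForm x₀).contDiffAt
    ((isOpen_chart_target x₀).mem_nhds hy)).differentiableAt (by simp)

/-- The coordinate expression of `χ` along a curve of triples on which it vanishes at time `t`. -/
theorem hasDerivAt_sharpInChart {x₀ : M} {Y : ℝ → R7} {A : Fin 3 → ℝ → R7} {a : R7}
    {H : Fin 3 → R7} {t : ℝ} (hy : Y t ∈ (extChartAt (𝓡 7) x₀).target) (hY : HasDerivAt Y a t)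
    (hA : ∀ i, HasDerivAt (A i) (H i) t)
    (h0 : ∀ w, formInChart G.starForm x₀ (Y t) (Matrix.vecCons w fun i => A i t) = 0) :
    HasDerivAt (fun s => G.sharpInChart x₀ (Y s) fun k =>
        -formInChart G.starForm x₀ (Y s) (Matrix.vecCons (e7 k) fun i => A i s))
      (G.variationVector x₀ (Y t) a (fun i => A i t) H) t := by
  refine hasDerivAt_clm_apply_of_eq_zero (K := fun s => G.metricInv x₀ (Y s))
    (u := fun s => ∑ k, (-formInChart G.starForm x₀ (Y s)
      (Matrix.vecCons (e7 k) fun i => A i s)) • e7 k) ?_ ?_ ?_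
  · exact DifferentiableAt.comp (g := G.metricInv x₀) t (((G.contDiffOn_metricInv x₀).contDiffAt
      ((isOpen_chart_target x₀).mem_nhds hy)).differentiableAt (by simp)) hY.differentiableAt
  · exact HasDerivAt.fun_sum fun k _ => (hasDerivAt_firstVar
      (G.differentiableAt_formInChart_starForm hy) hY hA (e7 k)).neg.smul_const (e7 k)
  · simp [h0]

/-- The inverse parallel transport of `χ`, evaluated on the images of tangent vectors on which it
vanishes, has at the zero section the derivative `variationVector`. -/
theorem hasDerivAt_toChart_transportBack [T2Space M] (ι : C^∞⟮𝓡 3, L; 𝓡 7, M⟯)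
    {V : ∀ x : L, TangentSpace (𝓡 7) (ι x)}
    (hV : ContMDiff (𝓡 3) (𝓡 7).tangent ∞ (fun x => (⟨ι x, V x⟩ : TangentBundle (𝓡 7) M)))
    {x₀ : M} {x : L} (hx : ι x ∈ (extChartAt (𝓡 7) x₀).source) (e : Fin 3 → R3)
    (h0 : ∀ w, formInChart G.starForm x₀ (chartMap ι x₀ x)
      (Matrix.vecCons w fun i => derivAt (chartMap ι x₀) x (e i)) = 0) :
    HasDerivAt (fun a : ℝ => toChart x₀ (ι x) (G.transportBack (ι x) (a • V x)
      (G.chi (G.expSection ι (a • V) x)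
      (mfderiv (𝓡 3) (𝓡 7) (G.expSection ι (a • V)) x (e 0))
      (mfderiv (𝓡 3) (𝓡 7) (G.expSection ι (a • V)) x (e 1))
      (mfderiv (𝓡 3) (𝓡 7) (G.expSection ι (a • V)) x (e 2)))))
      (G.variationVector x₀ (chartMap ι x₀ x) (chartField ι V x₀ x)
        (fun i => derivAt (chartMap ι x₀) x (e i)) fun i => derivAt (chartField ι V x₀) x (e i))
      0 := by
  obtain ⟨r, hr, δ, hδ, C, Φ, J, hΦ, hΦ0, hΦd, hJ0, hJd, hJf, htr⟩ :=
    G.exists_geodesic_flow hx (V x)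
  set z : R7 × R7 := (extChartAt (𝓡 7) x₀ (ι x), toChart x₀ (ι x) (V x)) with hz
  have hzt : z.1 ∈ (extChartAt (𝓡 7) x₀).target := (extChartAt (𝓡 7) x₀).map_source hx
  set Y : ℝ → R7 := fun a => (Φ z a).1 with hY
  set A : Fin 3 → ℝ → R7 := fun i a =>
    (J a (derivAt (chartMap ι x₀) x (e i), derivAt (chartField ι V x₀) x (e i))).1 with hA
  have hY0 : Y 0 = chartMap ι x₀ x := by rw [hY]; simp only [hΦ0]; rfl
  have hA0 : ∀ i, A i 0 = derivAt (chartMap ι x₀) x (e i) := by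
    intro i; rw [hA]; simp only [hJ0]; rfl
  have hYd : HasDerivAt Y (chartField ι V x₀ x) 0 :=
    (ContinuousLinearMap.fst ℝ R7 R7).hasFDerivAt.comp_hasDerivAt 0 hΦd
  have hAd : ∀ i, HasDerivAt (A i) (derivAt (chartField ι V x₀) x (e i)) 0 := by
    intro i
    set b : R7 × R7 := (derivAt (chartMap ι x₀) x (e i), derivAt (chartField ι V x₀) x (e i)) with hb
    have h1 : HasDerivAt (fun a => J a b) (fderiv ℝ (G.geodesicField x₀) z b) 0 := by
      have := hJd.clm_apply (hasDerivAt_const (0 : ℝ) b)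
      rwa [map_zero, add_zero] at this
    -- the first component of the geodesic field is linear
    have h2 : (fderiv ℝ (G.geodesicField x₀) z b).1 = b.2 := by
      have h3 : HasFDerivAt (fun z => (G.geodesicField x₀ z).1)
          ((ContinuousLinearMap.fst ℝ R7 R7).comp (fderiv ℝ (G.geodesicField x₀) z)) z :=
        (ContinuousLinearMap.fst ℝ R7 R7).hasFDerivAt.comp z
          ((G.contDiffAt_geodesicField hzt).differentiableAt (by simp)).hasFDerivAt
      have h4 : HasFDerivAt (fun z : R7 × R7 => z.2) (ContinuousLinearMap.snd ℝ R7 R7) z :=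
        (ContinuousLinearMap.snd ℝ R7 R7).hasFDerivAt
      exact congrArg (fun T : R7 × R7 →L[ℝ] R7 => T b) (h3.unique h4)
    have h5 : derivAt (chartField ι V x₀) x (e i) = (fderiv ℝ (G.geodesicField x₀) z b).1 := h2.symm
    rw [h5]
    exact (ContinuousLinearMap.fst ℝ R7 R7).hasFDerivAt.comp_hasDerivAt 0 h1
  have hzero : ∀ w, formInChart G.starForm x₀ (Y 0) (Matrix.vecCons w fun i => A i 0) = 0 := by
    intro w; rw [hY0]; simp only [hA0]; exact h0 w
  have hmain := G.hasDerivAt_sharpInChart (x₀ := x₀) (Y := Y) (A := A) (t := 0)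
    (by rw [hY0]; exact hzt) hYd hAd hzero
  rw [hY0] at hmain
  simp only [hA0] at hmain
  refine hasDerivAt_of_norm_sub_le hδ ?_ hmain (C := C) fun a ha => ?_
  · rw [sharpInChart]
    simp [hzero]
  · obtain ⟨hs, hext⟩ := hΦ (ι x) hx (V x) (Metric.mem_ball_self hr) a ha
    have h1 := htr a ha (G.chi (G.expSection ι (a • V) x)
      (mfderiv (𝓡 3) (𝓡 7) (G.expSection ι (a • V)) x (e 0))
      (mfderiv (𝓡 3) (𝓡 7) (G.expSection ι (a • V)) x (e 1))
      (mfderiv (𝓡 3) (𝓡 7) (G.expSection ι (a • V)) x (e 2)))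
    obtain ⟨v, hv⟩ : ∃ v : Fin 3 → R7,
        v = fun i => (mfderiv (𝓡 3) (𝓡 7) (G.expSection ι (a • V)) x (e i) : R7) := ⟨_, rfl⟩
    obtain ⟨q, hq⟩ : ∃ q : M, q = G.expSection ι (a • V) x := ⟨_, rfl⟩
    have hs' : q ∈ (extChartAt (𝓡 7) x₀).source := by rw [hq]; exact hs
    have hext' : extChartAt (𝓡 7) x₀ q = Y a := by rw [hq]; exact hext
    have h2 := G.toChart_chi hs' v
    have h3 : (fun i => toChart x₀ q (v i)) = fun i => A i a := by
      rw [hq, hv]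
      exact funext fun i => G.toChart_mfderiv_expSection ι hV hx hr
        (fun p hp v hv => hΦ p hp v hv a ha) (hJf a ha) (e i)
    rw [h3, hext', hv, hq] at h2
    have h4 : toChart x₀ (G.expSection ι (a • V) x) (G.chi (G.expSection ι (a • V) x)
      (mfderiv (𝓡 3) (𝓡 7) (G.expSection ι (a • V)) x (e 0))
      (mfderiv (𝓡 3) (𝓡 7) (G.expSection ι (a • V)) x (e 1))
      (mfderiv (𝓡 3) (𝓡 7) (G.expSection ι (a • V)) x (e 2))) = G.sharpInChart x₀ (Y a) fun k =>
        -formInChart G.starForm x₀ (Y a) (Matrix.vecCons (e7 k) fun i => A i a) := h2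
    rw [← h4]
    exact h1

end G2Structure

/-! ### Immersions and oriented orthonormal bases -/

/-- The derivative of an immersion is injective. -/
theorem Manifold.IsImmersionAt.injective_mfderiv {M : Type*} [TopologicalSpace M]
    [ChartedSpace R7 M] [IsManifold (𝓡 7) ∞ M] {L : Type*} [TopologicalSpace L] [ChartedSpace R3 L]
    [IsManifold (𝓡 3) ∞ L] {f : L → M} {x : L} (h : IsImmersionAt (𝓡 3) (𝓡 7) ∞ f x) :
    Function.Injective (mfderiv (𝓡 3) (𝓡 7) f x) := by
  set S : M → L := fun p => (h.domChart.extend (𝓡 3)).symm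
    (h.equiv.symm (h.codChart.extend (𝓡 7) p)).1 with hS
  have hx := h.mem_domChart_source
  -- `S` is a left inverse of `f` near `x`
  have hleft : S ∘ f =ᶠ[𝓝 x] id := by
    filter_upwards [h.domChart.open_source.mem_nhds hx] with x' hx'
    have hx'' : x' ∈ (h.domChart.extend (𝓡 3)).source := by
      rwa [OpenPartialHomeomorph.extend_source]
    have h1 := h.writtenInCharts ((h.domChart.extend (𝓡 3)).map_source hx'')
    simp only [Function.comp_apply, (h.domChart.extend (𝓡 3)).left_inv hx''] at h1
    simp only [hS, Function.comp_apply, h1, h.equiv.symm_apply_apply, id]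
    exact (h.domChart.extend (𝓡 3)).left_inv hx''
  have hf : MDifferentiableAt (𝓡 3) (𝓡 7) f x := h.contMDiffAt.mdifferentiableAt (by simp)
  have h1 : MDifferentiableAt (𝓡 7) 𝓘(ℝ, R7) (h.codChart.extend (𝓡 7)) (f x) :=
    (h.codChart.contMDiffAt_extend h.codChart_mem_maximalAtlas
      h.mem_codChart_source).mdifferentiableAt (by simp)
  have h2 : MDifferentiableAt (𝓡 7) 𝓘(ℝ, R3)
      (fun p => (h.equiv.symm (h.codChart.extend (𝓡 7) p)).1) (f x) := by
    have h3 := ((ContinuousLinearMap.fst ℝ R3 h.complement).comp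
      (h.equiv.symm : R7 →L[ℝ] R3 × h.complement)).differentiableAt
        (x := h.codChart.extend (𝓡 7) (f x))
    exact h3.mdifferentiableAt.comp (f x) h1
  have h4 : (h.equiv.symm (h.codChart.extend (𝓡 7) (f x))).1 = h.domChart.extend (𝓡 3) x := by
    have hx'' : x ∈ (h.domChart.extend (𝓡 3)).source := by
      rwa [OpenPartialHomeomorph.extend_source]
    have h1 := h.writtenInCharts ((h.domChart.extend (𝓡 3)).map_source hx'')
    simp only [Function.comp_apply, (h.domChart.extend (𝓡 3)).left_inv hx''] at h1
    rw [h1, h.equiv.symm_apply_apply]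
  have h5 : MDifferentiableAt 𝓘(ℝ, R3) (𝓡 3) (h.domChart.extend (𝓡 3)).symm
      (h.equiv.symm (h.codChart.extend (𝓡 7) (f x))).1 := by
    rw [h4]
    have h6 := contMDiffOn_extend_symm h.domChart_mem_maximalAtlas
    have h7 : (𝓡 3) '' h.domChart.target ∈ 𝓝 (h.domChart.extend (𝓡 3) x) := by
      have : (𝓡 3) '' h.domChart.target = h.domChart.target := by simp
      rw [this]
      exact h.domChart.open_target.mem_nhds (h.domChart.map_source hx)
    exact (h6.contMDiffAt h7).mdifferentiableAt (by simp)
  have h8 : MDifferentiableAt (𝓡 7) (𝓡 3) S (f x) := h5.comp (f x) h2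
  have h9 := (h8.hasMFDerivAt.comp x hf.hasMFDerivAt).congr_of_eventuallyEq hleft.symm
  have h10 := hasMFDerivAt_unique h9 (hasMFDerivAt_id x)
  intro v w hvw
  have h11 : ∀ v, mfderiv (𝓡 7) (𝓡 3) S (f x) (mfderiv (𝓡 3) (𝓡 7) f x v) = v := fun v =>
    congrArg (fun A : R3 →L[ℝ] R3 => A v) h10
  rw [← h11 v, hvw, h11 w]

/-- For an injective `A : ℝ³ → ℝ⁷`, a basis of `ℝ³` that `A` maps to an orthonormal family and that has
a prescribed orientation. -/
theorem exists_orthonormal_basis_orientation (A : R3 →ₗ[ℝ] R7) (hA : Function.Injective A)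
    (o : Orientation ℝ R3 (Fin 3)) :
    ∃ e : Module.Basis (Fin 3) ℝ R3,
      (∀ i j, inner ℝ (A (e i)) (A (e j)) = if i = j then (1 : ℝ) else 0) ∧ e.orientation = o := by
  let E := LinearEquiv.ofInjective A hA
  have hfin : Module.finrank ℝ (LinearMap.range A) = 3 := by
    rw [← E.finrank_eq]; simp
  let b := (stdOrthonormalBasis ℝ (LinearMap.range A)).reindex (finCongr hfin)
  let e₀ : Module.Basis (Fin 3) ℝ R3 := b.toBasis.map E.symm
  have he₀ : ∀ i, A (e₀ i) = b i := by
    intro i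
    have : E (e₀ i) = b i := by simp [e₀]
    rw [← this]; rfl
  have horth : ∀ i j, inner ℝ (A (e₀ i)) (A (e₀ j)) = if i = j then (1 : ℝ) else 0 := by
    intro i j
    rw [he₀, he₀]
    exact orthonormal_iff_ite.1 b.orthonormal i j
  refine ⟨e₀.adjustToOrientation o, fun i j => ?_, e₀.orientation_adjustToOrientation o⟩
  by_cases hij : i = j
  · subst hij
    rcases e₀.adjustToOrientation_apply_eq_or_eq_neg o i with h | h <;> rw [h] <;>
      simpa using horth i i
  · have h0 := horth i j
    rcases e₀.adjustToOrientation_apply_eq_or_eq_neg o i with h | h <;>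
      rcases e₀.adjustToOrientation_apply_eq_or_eq_neg o j with h' | h' <;> rw [h, h'] <;>
      simpa [hij] using h0

/-! ### The linearization in charts -/

theorem ContDiffAt.continuousAlternatingMap_apply {E : Type*} [NormedAddCommGroup E]
    [NormedSpace ℝ E] {k : ℕ} {b : E → R7 [⋀^Fin k]→L[ℝ] ℝ} {v : Fin k → E → R7} {x : E}
    (hb : ContDiffAt ℝ ∞ b x) (hv : ∀ i, ContDiffAt ℝ ∞ (v i) x) :
    ContDiffAt ℝ ∞ (fun x => b x fun i => v i x) x := by
  have h := (ContinuousLinearMap.analyticAt_uncurry_of_multilinear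
    (ContinuousAlternatingMap.toContinuousMultilinearMapCLM ℝ : (R7 [⋀^Fin k]→L[ℝ] ℝ) →L[ℝ] _)
    (x := (b x, fun i => v i x))).contDiffAt (n := ∞)
  exact ContDiffAt.comp (g := fun p : (R7 [⋀^Fin k]→L[ℝ] ℝ) × (Fin k → R7) => p.1 p.2)
    (f := fun x => (b x, fun i => v i x)) x h (hb.prodMk (contDiffAt_pi.2 hv))

theorem contDiffAt_cons {E : Type*} [NormedAddCommGroup E] [NormedSpace ℝ E]
    {b : E → R7 [⋀^Fin 4]→L[ℝ] ℝ} {v : Fin 3 → E → R7} {w : E → R7} {x : E}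
    (hb : ContDiffAt ℝ ∞ b x) (hw : ContDiffAt ℝ ∞ w x) (hv : ∀ i, ContDiffAt ℝ ∞ (v i) x) :
    ContDiffAt ℝ ∞ (fun x => b x (Matrix.vecCons (w x) fun i => v i x)) x := by
  have h := hb.continuousAlternatingMap_apply (v := Matrix.vecCons w v)
    (fun i => by refine Fin.cases ?_ (fun j => ?_) i; exacts [hw, hv j])
  refine h.congr_of_eventuallyEq (Filter.Eventually.of_forall fun z => ?_)
  change b z _ = b z _
  congr 1
  funext i
  refine Fin.cases ?_ (fun j => ?_) i <;> rfl

theorem contDiffAt_firstVar {E : Type*} [NormedAddCommGroup E] [NormedSpace ℝ E]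
    {ψ : R7 → R7 [⋀^Fin 4]→L[ℝ] ℝ} {f a w : E → R7} {B H : Fin 3 → E → R7} {x : E}
    (hψ : ContDiffAt ℝ ∞ ψ (f x)) (hf : ContDiffAt ℝ ∞ f x) (ha : ContDiffAt ℝ ∞ a x)
    (hB : ∀ i, ContDiffAt ℝ ∞ (B i) x) (hH : ∀ i, ContDiffAt ℝ ∞ (H i) x)
    (hw : ContDiffAt ℝ ∞ w x) :
    ContDiffAt ℝ ∞ (fun x => firstVar ψ (f x) (a x) (fun i => B i x) (fun i => H i x) (w x)) x := by
  have h1 : ContDiffAt ℝ ∞ (fun x => fderiv ℝ ψ (f x) (a x)) x :=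
    ((hψ.fderiv_right (m := ∞) (by decide)).comp x hf).clm_apply ha
  refine (contDiffAt_cons h1 hw hB).add (ContDiffAt.sum fun i _ => ?_)
  have h2 := contDiffAt_cons (hψ.comp x hf) hw (v := Function.update B i (H i)) (x := x) (fun j => by
    by_cases hj : j = i
    · subst hj; simpa using hH j
    · simpa [hj] using hB j)
  refine h2.congr_of_eventuallyEq (Filter.Eventually.of_forall fun z => ?_)
  change ψ (f z) _ = ψ (f z) _
  congr 2
  funext j
  by_cases hj : j = i
  · subst hj; simp
  · simp [hj]

/-- `firstVar` is alternating in the tangent vectors of the submanifold. -/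
theorem firstVar_det {ψ : R7 → R7 [⋀^Fin 4]→L[ℝ] ℝ} {y : R7} (hψ : DifferentiableAt ℝ ψ y) (a : R7)
    (P Q : R3 →L[ℝ] R7) (e : Module.Basis (Fin 3) ℝ R3) (u : Fin 3 → R3) (w : R7) :
    firstVar ψ y a (fun i => P (u i)) (fun i => Q (u i)) w =
      e.det u * firstVar ψ y a (fun i => P (e i)) (fun i => Q (e i)) w := by
  have hY : HasDerivAt (fun t : ℝ => y + t • a) a 0 := by
    simpa using ((hasDerivAt_id (0 : ℝ)).smul_const a).const_add y
  have hA : ∀ v : R3, HasDerivAt (fun t : ℝ => P v + t • Q v) (Q v) 0 := fun v => by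
    simpa using ((hasDerivAt_id (0 : ℝ)).smul_const (Q v)).const_add (P v)
  have hd : ∀ u : Fin 3 → R3, HasDerivAt (fun t : ℝ => ψ (y + t • a)
      (Matrix.vecCons w fun i => P (u i) + t • Q (u i)))
      (firstVar ψ y a (fun i => P (u i)) (fun i => Q (u i)) w) 0 := by
    intro u
    have h := hasDerivAt_firstVar (ψ := ψ) (Y := fun t : ℝ => y + t • a)
      (A := fun i t => P (u i) + t • Q (u i)) (t := 0) (by simpa using hψ) hY (fun i => hA (u i)) w
    simpa using h
  have hdet : ∀ t : ℝ, ψ (y + t • a) (Matrix.vecCons w fun i => P (u i) + t • Q (u i)) =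
      e.det u * ψ (y + t • a) (Matrix.vecCons w fun i => P (e i) + t • Q (e i)) := by
    intro t
    have h := AlternatingMap.eq_smul_basis_det e
      ((((ψ (y + t • a)).curryLeft w).toAlternatingMap).compLinearMap (P + t • Q).toLinearMap)
    have h' := congrArg (fun b : R3 [⋀^Fin 3]→ₗ[ℝ] ℝ => b u) h
    exact h'.trans (mul_comm _ _)
  have h1 := hd u
  simp only [hdet] at h1
  exact h1.unique ((hd e).const_mul _)

/-- A derivative that is orthogonal to some vectors is not changed by subtracting the components
along these vectors. -/
theorem hasDerivAt_sub_sum_inner {N : ℝ → R7} {D : R7} (h : HasDerivAt N D 0) (u : R7 →L[ℝ] R7)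
    {k : ℕ} (b : Fin k → R7) (hD : ∀ i, inner ℝ (u D) (u (b i)) = 0) :
    HasDerivAt (fun a => N a - ∑ i, (inner ℝ (u (N a)) (u (b i)) : ℝ) • b i) D 0 := by
  have h1 : ∀ i, HasDerivAt (fun a => (inner ℝ (u (N a)) (u (b i)) : ℝ) • b i) 0 0 := by
    intro i
    have h2 : HasDerivAt (fun a => u (N a)) (u D) 0 := u.hasFDerivAt.comp_hasDerivAt 0 h
    have h3 := (h2.inner ℝ (hasDerivAt_const (0 : ℝ) (u (b i)))).smul_const (b i)
    simpa [hD] using h3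
  have h4 := h.sub (HasDerivAt.fun_sum (u := Finset.univ) fun i _ => h1 i)
  rw [Finset.sum_const_zero, sub_zero] at h4
  exact h4

/-- The standard basis of `ℝ³`. -/
abbrev e3 (i : Fin 3) : R3 := EuclideanSpace.single i 1

namespace G2Structure

variable {M : Type*} [TopologicalSpace M] [ChartedSpace R7 M] (G : G2Structure M)
  {L : Type*} [TopologicalSpace L] [ChartedSpace R3 L] [IsManifold (𝓡 7) ∞ M]

/-- The coordinate expression of a map on `L` in the chart around `x₁`. -/
def inChart (F : L → R7) (x₁ : L) (η : R3) : R7 := F ((extChartAt (𝓡 3) x₁).symm η)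

section

variable [IsManifold (𝓡 3) ∞ L]

theorem mdifferentiableAt_symm₃ {x₁ : L} {η : R3} (h : η ∈ (extChartAt (𝓡 3) x₁).target) :
    MDifferentiableAt 𝓘(ℝ, R3) (𝓡 3) (extChartAt (𝓡 3) x₁).symm η :=
  ((contMDiffOn_extChartAt_symm (I := 𝓡 3) (n := ∞) x₁ η h).contMDiffAt
    ((isOpen_extChartAt_target x₁).mem_nhds h)).mdifferentiableAt (by simp)

theorem exists_coordBasis {x₁ : L} {η : R3} (h : η ∈ (extChartAt (𝓡 3) x₁).target) :
    ∃ b : Module.Basis (Fin 3) ℝ R3,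
      ∀ i, b i = mfderiv 𝓘(ℝ, R3) (𝓡 3) (extChartAt (𝓡 3) x₁).symm η (e3 i) := by
  have : IsManifold (𝓡 3) 1 L := .of_le (n := ∞) (by decide)
  have h1 := isInvertible_mfderivWithin_extChartAt_symm (I := 𝓡 3) h
  rw [ModelWithCorners.range_eq_univ, mfderivWithin_univ] at h1
  obtain ⟨A, hA⟩ := h1
  refine ⟨(EuclideanSpace.basisFun (Fin 3) ℝ).toBasis.map (A.toLinearEquiv : R3 ≃ₗ[ℝ] R3),
    fun i => ?_⟩
  have h2 : (EuclideanSpace.basisFun (Fin 3) ℝ).toBasis i = e3 i := by simp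
  have h3 := congrArg (fun A : R3 →L[ℝ] R3 => A (e3 i)) hA
  refine Eq.trans ?_ h3
  exact congrArg A h2

/-- The coordinate vector fields of the chart around `x₁`, at the point with coordinates `η`. -/
def coordBasis {x₁ : L} {η : R3} (h : η ∈ (extChartAt (𝓡 3) x₁).target) :
    Module.Basis (Fin 3) ℝ R3 :=
  (exists_coordBasis h).choose

theorem coordBasis_apply {x₁ : L} {η : R3} (h : η ∈ (extChartAt (𝓡 3) x₁).target) (i : Fin 3) :
    coordBasis h i = mfderiv 𝓘(ℝ, R3) (𝓡 3) (extChartAt (𝓡 3) x₁).symm η (e3 i) :=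
  (exists_coordBasis h).choose_spec i

theorem fderiv_inChart {F : L → R7} {x₁ : L} {η : R3} (h : η ∈ (extChartAt (𝓡 3) x₁).target)
    (hF : MDifferentiableAt (𝓡 3) 𝓘(ℝ, R7) F ((extChartAt (𝓡 3) x₁).symm η)) (i : Fin 3) :
    fderiv ℝ (inChart F x₁) η (e3 i) =
      derivAt F ((extChartAt (𝓡 3) x₁).symm η) (coordBasis h i) := by
  have h1 := mfderiv_comp η hF (mdifferentiableAt_symm₃ h)
  rw [← mfderiv_eq_fderiv, coordBasis_apply]
  exact congrArg (fun A : R3 →L[ℝ] R7 => A (e3 i)) h1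

theorem contDiffAt_inChart {F : L → R7} {x₁ : L} {η : R3} (h : η ∈ (extChartAt (𝓡 3) x₁).target)
    (hF : ContMDiffAt (𝓡 3) 𝓘(ℝ, R7) ∞ F ((extChartAt (𝓡 3) x₁).symm η)) :
    ContDiffAt ℝ ∞ (inChart F x₁) η := by
  have h1 := (contMDiffOn_extChartAt_symm (I := 𝓡 3) (n := ∞) x₁ η h).contMDiffAt
    ((isOpen_extChartAt_target x₁).mem_nhds h)
  exact contMDiffAt_iff_contDiffAt.1 (hF.comp η h1)

end

/-- The value of `φ` on the coordinate vector fields of `L`, in charts around `x₀` and `x₁`. -/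
def chartForm (ι : L → M) (x₀ : M) (x₁ : L) (η : R3) : ℝ :=
  formInChart G.form x₀ (inChart (chartMap ι x₀) x₁ η) fun i =>
    fderiv ℝ (inChart (chartMap ι x₀) x₁) η (e3 i)

/-- The linearization of the deformation map, applied to `V`, in charts around `x₀` and `x₁`. -/
def chartLinearization (ι : L → M) (V : ∀ x : L, TangentSpace (𝓡 7) (ι x)) (x₀ : M) (x₁ : L)
    (η : R3) : R7 :=
  (G.chartForm ι x₀ x₁ η)⁻¹ •
    G.variationVector x₀ (inChart (chartMap ι x₀) x₁ η) (inChart (chartField ι V x₀) x₁ η)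
      (fun i => fderiv ℝ (inChart (chartMap ι x₀) x₁) η (e3 i))
      (fun i => fderiv ℝ (inChart (chartField ι V x₀) x₁) η (e3 i))

variable [IsManifold (𝓡 3) ∞ L]

theorem exists_isOrientedOrthonormal (ι : C^∞⟮𝓡 3, L; 𝓡 7, M⟯)
    (hι : Manifold.IsImmersion (𝓡 3) (𝓡 7) ∞ ι)
    (o : ∀ x : L, Orientation ℝ (TangentSpace (𝓡 3) x) (Fin 3)) (x : L) :
    ∃ e : Module.Basis (Fin 3) ℝ (TangentSpace (𝓡 3) x), G.IsOrientedOrthonormal ι o x e := by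
  have h := (hι.isImmersionAt x).injective_mfderiv
  exact exists_orthonormal_basis_orientation
    ((G.frame (ι x)).toLinearEquiv.toLinearMap ∘ₗ (mfderiv (𝓡 3) (𝓡 7) ι x).toLinearMap)
    ((G.frame (ι x)).injective.comp h) (o x)

section Pointwise

variable {G} {ι : C^∞⟮𝓡 3, L; 𝓡 7, M⟯}
  {o : ∀ x : L, Orientation ℝ (TangentSpace (𝓡 3) x) (Fin 3)}

theorem formInChart_eq_one (hL : G.IsAssociative ι o) {x : L}
    {e : Module.Basis (Fin 3) ℝ R3} (he : G.IsOrientedOrthonormal ι o x e) {x₀ : M}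
    (hx : ι x ∈ (extChartAt (𝓡 7) x₀).source) :
    formInChart G.form x₀ (chartMap ι x₀ x) (fun i => derivAt (chartMap ι x₀) x (e i)) = 1 := by
  have h := hL x e he
  rw [← h]
  simp only [derivAt_chartMap ι hx]
  exact (apply_eq_formInChart G.form hx fun i => mfderiv (𝓡 3) (𝓡 7) ι x (e i)).symm

/-- On an associative submanifold `χ` vanishes on the tangent spaces, in charts. -/
theorem formInChart_starForm_eq_zero (hL : G.IsAssociative ι o) {x : L}
    {e : Module.Basis (Fin 3) ℝ R3} (he : G.IsOrientedOrthonormal ι o x e) {x₀ : M}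
    (hx : ι x ∈ (extChartAt (𝓡 7) x₀).source) (w : R7) :
    formInChart G.starForm x₀ (chartMap ι x₀ x)
      (Matrix.vecCons w fun i => derivAt (chartMap ι x₀) x (e i)) = 0 := by
  have h := G.starForm_eq_zero_of_form_eq_one
    (v := fun i => (mfderiv (𝓡 3) (𝓡 7) ι x (e i) : R7)) he.1 (hL x e he)
    (ofChart x₀ (extChartAt (𝓡 7) x₀ (ι x)) w)
  rw [← h]
  refine ((apply_eq_formInChart G.starForm hx _).trans ?_).symm
  congr 1
  funext i
  refine Fin.cases ?_ (fun j => ?_) i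
  · exact toChart_ofChart' hx w
  · exact (derivAt_chartMap ι hx (e j)).symm

/-- On an oriented orthonormal basis, `variationVector` is given by its expression in charts: both
sides are alternating in the tangent vectors, and `φ` has the value `1` on the basis. -/
theorem variationVector_eq_chartLinearization (hL : G.IsAssociative ι o)
    {V : ∀ x : L, TangentSpace (𝓡 7) (ι x)}
    (hV : ContMDiff (𝓡 3) (𝓡 7).tangent ∞ (fun x => (⟨ι x, V x⟩ : TangentBundle (𝓡 7) M)))
    {x₁ : L} {η : R3} (hη : η ∈ (extChartAt (𝓡 3) x₁).target)
    {e : Module.Basis (Fin 3) ℝ R3}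
    (he : G.IsOrientedOrthonormal ι o ((extChartAt (𝓡 3) x₁).symm η) e) {x₀ : M}
    (hx : ι ((extChartAt (𝓡 3) x₁).symm η) ∈ (extChartAt (𝓡 7) x₀).source) :
    G.chartForm ι x₀ x₁ η = e.det (coordBasis hη) ∧
    G.variationVector x₀ (chartMap ι x₀ ((extChartAt (𝓡 3) x₁).symm η))
      (chartField ι V x₀ ((extChartAt (𝓡 3) x₁).symm η))
      (fun i => derivAt (chartMap ι x₀) ((extChartAt (𝓡 3) x₁).symm η) (e i))
      (fun i => derivAt (chartField ι V x₀) ((extChartAt (𝓡 3) x₁).symm η) (e i)) =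
      G.chartLinearization ι V x₀ x₁ η := by
  set x := (extChartAt (𝓡 3) x₁).symm η with hxdef
  have hy := (contMDiffAt_chartMap ι hx).mdifferentiableAt (by simp)
  have hv := (contMDiffAt_chartField hV hx).mdifferentiableAt (by simp)
  have hyt : chartMap ι x₀ x ∈ (extChartAt (𝓡 7) x₀).target := (extChartAt (𝓡 7) x₀).map_source hx
  have e1 : (fun i => fderiv ℝ (inChart (chartMap ι x₀) x₁) η (e3 i)) =
      fun i => derivAt (chartMap ι x₀) x (coordBasis hη i) := funext (fderiv_inChart hη hy)
  have e2 : (fun i => fderiv ℝ (inChart (chartField ι V x₀) x₁) η (e3 i)) =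
      fun i => derivAt (chartField ι V x₀) x (coordBasis hη i) := funext (fderiv_inChart hη hv)
  have hform : G.chartForm ι x₀ x₁ η = e.det (coordBasis hη) := by
    rw [chartForm, e1]
    have h := AlternatingMap.eq_smul_basis_det e
      ((formInChart G.form x₀ (chartMap ι x₀ x)).toAlternatingMap.compLinearMap
        (derivAt (chartMap ι x₀) x).toLinearMap)
    have h' := congrArg (fun b : R3 [⋀^Fin 3]→ₗ[ℝ] ℝ => b (coordBasis hη)) h
    refine h'.trans ?_
    have h2 := formInChart_eq_one hL he hx
    change formInChart G.form x₀ (chartMap ι x₀ x)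
      (fun i => derivAt (chartMap ι x₀) x (e i)) * e.det (coordBasis hη) = _
    rw [h2, one_mul]
  refine ⟨hform, ?_⟩
  have hdet : e.det (coordBasis hη) ≠ 0 := (e.isUnit_det (coordBasis hη)).ne_zero
  rw [chartLinearization, hform, e1, e2, eq_inv_smul_iff₀ hdet]
  refine G.eq_sharpInChart hyt fun w => ?_
  have h3 := firstVar_det (G.differentiableAt_formInChart_starForm hyt) (chartField ι V x₀ x)
    (derivAt (chartMap ι x₀) x) (derivAt (chartField ι V x₀) x) e (coordBasis hη) w
  have h4 : G.metricInChart x₀ (chartMap ι x₀ x) (e.det (coordBasis hη) •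
      G.variationVector x₀ (chartMap ι x₀ x) (chartField ι V x₀ x)
        (fun i => derivAt (chartMap ι x₀) x (e i))
        (fun i => derivAt (chartField ι V x₀) x (e i))) w = e.det (coordBasis hη) *
      G.metricInChart x₀ (chartMap ι x₀ x) (G.variationVector x₀ (chartMap ι x₀ x)
        (chartField ι V x₀ x) (fun i => derivAt (chartMap ι x₀) x (e i))
        (fun i => derivAt (chartField ι V x₀) x (e i))) w := by
    rw [metricInChart_eq G hyt, metricInChart_eq G hyt, map_smul, real_inner_smul_left]
  rw [h4, metricInChart_variationVector G hyt]
  simp only [neg_smul, Finset.sum_neg_distrib, inner_neg_left, firstVar_linear]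
  refine Eq.trans ?_ (congrArg Neg.neg h3).symm
  rw [mul_neg]

theorem chartForm_ne_zero (hL : G.IsAssociative ι o) (hι : Manifold.IsImmersion (𝓡 3) (𝓡 7) ∞ ι)
    {x₁ : L} {η : R3} (hη : η ∈ (extChartAt (𝓡 3) x₁).target) {x₀ : M}
    (hx : ι ((extChartAt (𝓡 3) x₁).symm η) ∈ (extChartAt (𝓡 7) x₀).source) :
    G.chartForm ι x₀ x₁ η ≠ 0 := by
  obtain ⟨e, he⟩ := G.exists_isOrientedOrthonormal ι hι o ((extChartAt (𝓡 3) x₁).symm η)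
  rw [(variationVector_eq_chartLinearization hL (contMDiff_zero_lift ι.contMDiff) hη he hx).1]
  exact (Module.Basis.isUnit_det (M := R3) e (coordBasis hη)).ne_zero

/-- The deformation map has a derivative at the zero section in the direction `V`, which is normal and
is given in charts by `chartLinearization`. The formula involves neither the basis `e` nor the
exponential map. -/
theorem hasDerivAt_deformationMap [T2Space M] (hL : G.IsAssociative ι o)
    {V : ∀ x : L, TangentSpace (𝓡 7) (ι x)}
    (hV : ContMDiff (𝓡 3) (𝓡 7).tangent ∞ (fun x => (⟨ι x, V x⟩ : TangentBundle (𝓡 7) M)))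
    {x₁ : L} {η : R3} (hη : η ∈ (extChartAt (𝓡 3) x₁).target)
    {e : Module.Basis (Fin 3) ℝ R3}
    (he : G.IsOrientedOrthonormal ι o ((extChartAt (𝓡 3) x₁).symm η) e) {x₀ : M}
    (hx : ι ((extChartAt (𝓡 3) x₁).symm η) ∈ (extChartAt (𝓡 7) x₀).source) :
    (∀ v : R3, G.metric (ι ((extChartAt (𝓡 3) x₁).symm η))
      (ofChart x₀ (inChart (chartMap ι x₀) x₁ η) (G.chartLinearization ι V x₀ x₁ η))
      (mfderiv (𝓡 3) (𝓡 7) ι ((extChartAt (𝓡 3) x₁).symm η) v) = 0) ∧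
    HasDerivAt (F := R7)
      (fun a : ℝ => G.deformationMap ι (a • V) ((extChartAt (𝓡 3) x₁).symm η) e)
      (ofChart x₀ (inChart (chartMap ι x₀) x₁ η) (G.chartLinearization ι V x₀ x₁ η)) 0 := by
  have hinChart : inChart (chartMap ι x₀) x₁ η = extChartAt (𝓡 7) x₀
    (ι ((extChartAt (𝓡 3) x₁).symm η)) := rfl
  rw [← (variationVector_eq_chartLinearization hL hV hη he hx).2, hinChart]
  set x := (extChartAt (𝓡 3) x₁).symm η with hxdef
  have h0 := formInChart_starForm_eq_zero hL he hx
  have h1 := G.hasDerivAt_toChart_transportBack ι hV hx e h0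
  have hyt : chartMap ι x₀ x ∈ (extChartAt (𝓡 7) x₀).target := (extChartAt (𝓡 7) x₀).map_source hx
  obtain ⟨D, hD⟩ : ∃ D : R7, D = G.variationVector x₀ (chartMap ι x₀ x) (chartField ι V x₀ x)
    (fun i => derivAt (chartMap ι x₀) x (e i)) (fun i => derivAt (chartField ι V x₀) x (e i)) :=
    ⟨_, rfl⟩
  have hnormal : ∀ v : R3, G.metric (ι x) (ofChart x₀ (extChartAt (𝓡 7) x₀ (ι x)) D)
      (mfderiv (𝓡 3) (𝓡 7) ι x v) = 0 := by
    have hb : ∀ j, G.metricInChart x₀ (chartMap ι x₀ x) D (derivAt (chartMap ι x₀) x (e j)) = 0 := by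
      intro j
      rw [hD, metricInChart_variationVector G hyt,
        firstVar_self (B := fun i => derivAt (chartMap ι x₀) x (e i)) h0, neg_zero]
    intro v
    refine (G.metric_eq_metricInChart hx _ _).trans ?_
    rw [toChart_ofChart' hx]
    have e1 : toChart x₀ (ι x) (mfderiv (𝓡 3) (𝓡 7) ι x v) = derivAt (chartMap ι x₀) x v :=
      (derivAt_chartMap ι hx v).symm
    rw [e1]
    change G.metricInChart x₀ (chartMap ι x₀ x) D _ = 0
    rw [← G.inner_metricOp hyt]
    have h2 : ∀ j, inner ℝ (G.metricOp x₀ (chartMap ι x₀ x) D)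
        (derivAt (chartMap ι x₀) x (e j)) = 0 := fun j => by
      rw [G.inner_metricOp hyt]; exact hb j
    rw [← e.sum_repr v, map_sum, inner_sum]
    refine Finset.sum_eq_zero fun j _ => ?_
    rw [map_smul, real_inner_smul_right, h2, mul_zero]
  rw [← hD] at h1 ⊢
  refine ⟨hnormal, ?_⟩
  -- return from the chart, then project
  obtain ⟨N, hN⟩ : ∃ N : ℝ → R7, N = fun a : ℝ => (G.transportBack (ι x) (a • V x)
      (G.chi (G.expSection ι (a • V) x)
      (mfderiv (𝓡 3) (𝓡 7) (G.expSection ι (a • V)) x (e 0))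
      (mfderiv (𝓡 3) (𝓡 7) (G.expSection ι (a • V)) x (e 1))
      (mfderiv (𝓡 3) (𝓡 7) (G.expSection ι (a • V)) x (e 2))) : R7) := ⟨_, rfl⟩
  have h2 : HasDerivAt N (ofChart x₀ (extChartAt (𝓡 7) x₀ (ι x)) D) 0 := by
    have h3 : HasDerivAt (fun a => toChart x₀ (ι x) (N a)) D 0 := by rw [hN]; exact h1
    have h4 := (ofChart x₀ (extChartAt (𝓡 7) x₀ (ι x))).hasFDerivAt.comp_hasDerivAt 0 h3
    have h5 : (⇑(ofChart x₀ (extChartAt (𝓡 7) x₀ (ι x))) ∘ fun a => toChart x₀ (ι x) (N a)) = N :=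
      funext fun a => ofChart_toChart' hx (N a)
    rwa [h5] at h4
  have h3 := hasDerivAt_sub_sum_inner h2
    (show R7 →L[ℝ] R7 from (G.frame (ι x) : TangentSpace (𝓡 7) (ι x) →L[ℝ] R7))
    (fun i => (mfderiv (𝓡 3) (𝓡 7) ι x (e i) : R7)) (fun i => hnormal (e i))
  rw [hN] at h3
  exact h3

end Pointwise

end G2Structure

theorem firstVar_smul_add_smul (ψ : R7 → R7 [⋀^Fin 4]→L[ℝ] ℝ) (y a a' : R7) (B H H' : Fin 3 → R7)
    (c d : ℝ) (w : R7) :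
    firstVar ψ y (c • a + d • a') B (fun i => c • H i + d • H' i) w =
      c * firstVar ψ y a B H w + d * firstVar ψ y a' B H' w := by
  have h : ∀ i (u : R7), Matrix.vecCons w (Function.update B i u) =
      Function.update (Matrix.vecCons w B) i.succ u := fun i u => Fin.cons_update _ _ _ _
  simp only [firstVar, h, ContinuousAlternatingMap.map_update_add,
    ContinuousAlternatingMap.map_update_smul, map_add, map_smul, smul_eq_mul,
    ContinuousAlternatingMap.add_apply, ContinuousAlternatingMap.smul_apply, mul_add,
    Finset.mul_sum, Finset.sum_add_distrib]
  ring

namespace G2Structure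

variable {M : Type*} [TopologicalSpace M] [ChartedSpace R7 M] (G : G2Structure M)
  {L : Type*} [TopologicalSpace L] [ChartedSpace R3 L] [IsManifold (𝓡 7) ∞ M]

theorem sharpInChart_smul_add_smul (x₀ : M) (y : R7) (u v : Fin 7 → ℝ) (c d : ℝ) :
    G.sharpInChart x₀ y (fun k => c * u k + d * v k) =
      c • G.sharpInChart x₀ y u + d • G.sharpInChart x₀ y v := by
  simp only [sharpInChart, ← map_smul, ← map_add, Finset.smul_sum, ← Finset.sum_add_distrib,
    add_smul, mul_smul]

theorem variationVector_smul_add_smul (x₀ : M) (y a a' : R7) (B H H' : Fin 3 → R7) (c d : ℝ) :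
    G.variationVector x₀ y (c • a + d • a') B (fun i => c • H i + d • H' i) =
      c • G.variationVector x₀ y a B H + d • G.variationVector x₀ y a' B H' := by
  rw [variationVector, variationVector, variationVector, ← sharpInChart_smul_add_smul]
  congr 1
  funext k
  rw [firstVar_smul_add_smul]
  ring

variable [IsManifold (𝓡 3) ∞ L]

theorem contDiffAt_chartForm (ι : C^∞⟮𝓡 3, L; 𝓡 7, M⟯) {x₀ : M} {x₁ : L} {η : R3}
    (hη : η ∈ (extChartAt (𝓡 3) x₁).target)
    (hx : ι ((extChartAt (𝓡 3) x₁).symm η) ∈ (extChartAt (𝓡 7) x₀).source) :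
    ContDiffAt ℝ ∞ (G.chartForm ι x₀ x₁) η := by
  have hy := contDiffAt_inChart hη (contMDiffAt_chartMap ι hx)
  have hyt : inChart (chartMap ι x₀) x₁ η ∈ (extChartAt (𝓡 7) x₀).target :=
    (extChartAt (𝓡 7) x₀).map_source hx
  refine ContDiffAt.continuousAlternatingMap_apply (ContDiffAt.comp (g := formInChart G.form x₀) η
    ((G.smooth x₀).contDiffAt ((isOpen_chart_target x₀).mem_nhds hyt)) hy) fun i => ?_
  exact (hy.fderiv_right (m := ∞) (by decide)).clm_apply contDiffAt_const

theorem contDiffAt_chartLinearization {ι : C^∞⟮𝓡 3, L; 𝓡 7, M⟯}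
    {V : ∀ x : L, TangentSpace (𝓡 7) (ι x)}
    (hV : ContMDiff (𝓡 3) (𝓡 7).tangent ∞ (fun x => (⟨ι x, V x⟩ : TangentBundle (𝓡 7) M)))
    {x₀ : M} {x₁ : L} {η : R3} (hη : η ∈ (extChartAt (𝓡 3) x₁).target)
    (hx : ι ((extChartAt (𝓡 3) x₁).symm η) ∈ (extChartAt (𝓡 7) x₀).source)
    (h0 : G.chartForm ι x₀ x₁ η ≠ 0) :
    ContDiffAt ℝ ∞ (G.chartLinearization ι V x₀ x₁) η := by
  have hy := contDiffAt_inChart hη (contMDiffAt_chartMap ι hx)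
  have hv := contDiffAt_inChart hη (contMDiffAt_chartField hV hx)
  have hyt : inChart (chartMap ι x₀) x₁ η ∈ (extChartAt (𝓡 7) x₀).target :=
    (extChartAt (𝓡 7) x₀).map_source hx
  have hn := (isOpen_chart_target x₀).mem_nhds hyt
  refine ((G.contDiffAt_chartForm ι hη hx).inv h0).smul ?_
  have hinv : ContDiffAt ℝ ∞ (fun η => G.metricInv x₀ (inChart (chartMap ι x₀) x₁ η)) η :=
    ContDiffAt.comp (g := G.metricInv x₀) η ((G.contDiffOn_metricInv x₀).contDiffAt hn) hy
  have hvar : ∀ k : Fin 7, ContDiffAt ℝ ∞ (fun η => -firstVar (formInChart G.starForm x₀)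
      (inChart (chartMap ι x₀) x₁ η) (inChart (chartField ι V x₀) x₁ η)
      (fun i => fderiv ℝ (inChart (chartMap ι x₀) x₁) η (e3 i))
      (fun i => fderiv ℝ (inChart (chartField ι V x₀) x₁) η (e3 i)) (e7 k)) η := fun k =>
    (contDiffAt_firstVar (w := fun _ => e7 k)
      ((G.contDiffOn_formInChart_starForm x₀).contDiffAt hn) hy hv
      (fun i => (hy.fderiv_right (m := ∞) (by decide)).clm_apply contDiffAt_const)
      (fun i => (hv.fderiv_right (m := ∞) (by decide)).clm_apply contDiffAt_const)
      contDiffAt_const).neg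
  exact hinv.clm_apply (ContDiffAt.sum fun k _ => (hvar k).smul contDiffAt_const)

theorem chartLinearization_smul_add_smul {ι : C^∞⟮𝓡 3, L; 𝓡 7, M⟯}
    {V W Z : ∀ x : L, TangentSpace (𝓡 7) (ι x)}
    (hV : ContMDiff (𝓡 3) (𝓡 7).tangent ∞ (fun x => (⟨ι x, V x⟩ : TangentBundle (𝓡 7) M)))
    (hW : ContMDiff (𝓡 3) (𝓡 7).tangent ∞ (fun x => (⟨ι x, W x⟩ : TangentBundle (𝓡 7) M)))
    {c d : ℝ} (hZ : ∀ x, Z x = c • V x + d • W x)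
    {x₀ : M} {x₁ : L} {η : R3} (hη : η ∈ (extChartAt (𝓡 3) x₁).target)
    (hx : ι ((extChartAt (𝓡 3) x₁).symm η) ∈ (extChartAt (𝓡 7) x₀).source) :
    G.chartLinearization ι Z x₀ x₁ η =
      c • G.chartLinearization ι V x₀ x₁ η + d • G.chartLinearization ι W x₀ x₁ η := by
  have hv := (contDiffAt_inChart hη (contMDiffAt_chartField hV hx)).differentiableAt (by simp)
  have hw := (contDiffAt_inChart hη (contMDiffAt_chartField hW hx)).differentiableAt (by simp)
  have e1 : inChart (chartField ι Z x₀) x₁ = fun η =>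
      c • inChart (chartField ι V x₀) x₁ η + d • inChart (chartField ι W x₀) x₁ η := by
    funext η
    simp only [inChart, chartField, hZ]
    exact (map_add _ _ _).trans (congrArg₂ _ (map_smul _ _ _) (map_smul _ _ _))
  have e2 : ∀ i, fderiv ℝ (inChart (chartField ι Z x₀) x₁) η (e3 i) =
      c • fderiv ℝ (inChart (chartField ι V x₀) x₁) η (e3 i) +
        d • fderiv ℝ (inChart (chartField ι W x₀) x₁) η (e3 i) := by
    intro i
    rw [e1]
    have h := ((hv.hasFDerivAt.const_smul c).add (hw.hasFDerivAt.const_smul d)).fderiv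
    exact congrArg (fun A : R3 →L[ℝ] R7 => A (e3 i)) h
  rw [chartLinearization, chartLinearization, chartLinearization]
  simp only [e2]
  rw [congrFun e1 η, variationVector_smul_add_smul, smul_add, smul_comm _ c, smul_comm _ d]

/-- The value at `x` of the linearization of the deformation map, applied to `V`. -/
def linearizationAt (ι : L → M) (V : ∀ x : L, TangentSpace (𝓡 7) (ι x)) (x : L) :
    TangentSpace (𝓡 7) (ι x) :=
  ofChart (ι x) (chartMap ι (ι x) x)
    (G.chartLinearization ι V (ι x) x (extChartAt (𝓡 3) x x))

section

variable {G} {ι : C^∞⟮𝓡 3, L; 𝓡 7, M⟯}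
  {o : ∀ x : L, Orientation ℝ (TangentSpace (𝓡 3) x) (Fin 3)}

theorem hasDerivAt_deformationMap_of_mem [T2Space M] (hL : G.IsAssociative ι o)
    {V : ∀ x : L, TangentSpace (𝓡 7) (ι x)}
    (hV : ContMDiff (𝓡 3) (𝓡 7).tangent ∞ (fun x => (⟨ι x, V x⟩ : TangentBundle (𝓡 7) M)))
    {x x₁ : L} (h₁ : x ∈ (extChartAt (𝓡 3) x₁).source)
    {e : Module.Basis (Fin 3) ℝ R3} (he : G.IsOrientedOrthonormal ι o x e) {x₀ : M}
    (hx : ι x ∈ (extChartAt (𝓡 7) x₀).source) :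
    (∀ v : R3, G.metric (ι x) (ofChart x₀ (chartMap ι x₀ x)
      (G.chartLinearization ι V x₀ x₁ (extChartAt (𝓡 3) x₁ x))) (mfderiv (𝓡 3) (𝓡 7) ι x v) = 0) ∧
    HasDerivAt (F := R7) (fun a : ℝ => G.deformationMap ι (a • V) x e)
      (ofChart x₀ (chartMap ι x₀ x) (G.chartLinearization ι V x₀ x₁ (extChartAt (𝓡 3) x₁ x))) 0 := by
  obtain ⟨η, hη, rfl⟩ : ∃ η ∈ (extChartAt (𝓡 3) x₁).target, (extChartAt (𝓡 3) x₁).symm η = x :=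
    ⟨_, (extChartAt (𝓡 3) x₁).map_source h₁, (extChartAt (𝓡 3) x₁).left_inv h₁⟩
  rw [(extChartAt (𝓡 3) x₁).right_inv hη]
  exact hasDerivAt_deformationMap hL hV hη he hx

/-- The linearization may be computed in any charts, since it is the derivative of a map that does not
depend on them. -/
theorem linearizationAt_eq [T2Space M] (hι : Manifold.IsImmersion (𝓡 3) (𝓡 7) ∞ ι)
    (hL : G.IsAssociative ι o) {V : ∀ x : L, TangentSpace (𝓡 7) (ι x)}
    (hV : ContMDiff (𝓡 3) (𝓡 7).tangent ∞ (fun x => (⟨ι x, V x⟩ : TangentBundle (𝓡 7) M)))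
    {x x₁ : L} (h₁ : x ∈ (extChartAt (𝓡 3) x₁).source) {x₀ : M}
    (hx : ι x ∈ (extChartAt (𝓡 7) x₀).source) :
    G.linearizationAt ι V x = ofChart x₀ (chartMap ι x₀ x)
      (G.chartLinearization ι V x₀ x₁ (extChartAt (𝓡 3) x₁ x)) := by
  obtain ⟨e, he⟩ := G.exists_isOrientedOrthonormal ι hι o x
  exact (hasDerivAt_deformationMap_of_mem hL hV (mem_extChartAt_source x) he
    (mem_extChartAt_source _)).2.unique (hasDerivAt_deformationMap_of_mem hL hV h₁ he hx).2

theorem contMDiff_linearizationAt [T2Space M] (hι : Manifold.IsImmersion (𝓡 3) (𝓡 7) ∞ ι)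
    (hL : G.IsAssociative ι o) {V : ∀ x : L, TangentSpace (𝓡 7) (ι x)}
    (hV : ContMDiff (𝓡 3) (𝓡 7).tangent ∞ (fun x => (⟨ι x, V x⟩ : TangentBundle (𝓡 7) M))) :
    ContMDiff (𝓡 3) (𝓡 7).tangent ∞
      (fun x => (⟨ι x, G.linearizationAt ι V x⟩ : TangentBundle (𝓡 7) M)) := by
  intro x
  have hs : ι x ∈ (extChartAt (𝓡 7) (ι x)).source := mem_extChartAt_source _
  refine (contMDiffAt_tangent_iff
    (f := fun x => (⟨ι x, G.linearizationAt ι V x⟩ : TangentBundle (𝓡 7) M)) hs).2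
    ⟨ι.contMDiff x, ?_⟩
  have hη := mem_extChartAt_target (I := 𝓡 3) x
  have hx : ι ((extChartAt (𝓡 3) x).symm (extChartAt (𝓡 3) x x)) ∈
      (extChartAt (𝓡 7) (ι x)).source := by
    rw [extChartAt_to_inv]; exact hs
  have h1 := G.contDiffAt_chartLinearization hV hη hx (chartForm_ne_zero hL hι hη hx)
  have h2 : ContMDiffAt (𝓡 3) 𝓘(ℝ, R7) ∞
      (fun x' => G.chartLinearization ι V (ι x) x (extChartAt (𝓡 3) x x')) x :=
    ContMDiffAt.comp (I' := 𝓘(ℝ, R3)) (g := G.chartLinearization ι V (ι x) x) x h1.contMDiffAt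
      contMDiffAt_extChartAt
  refine h2.congr_of_eventuallyEq ?_
  filter_upwards [(isOpen_extChartAt_source (I := 𝓡 3) x).mem_nhds (mem_extChartAt_source x),
    (ι.contMDiff x).continuousAt.preimage_mem_nhds
      ((isOpen_extChartAt_source (I := 𝓡 7) (ι x)).mem_nhds hs)] with x' h₁ hx'
  rw [coordVector_eq]
  refine (congrArg (toChart (ι x) (ι x')) (linearizationAt_eq hι hL hV h₁ hx')).trans ?_
  exact toChart_ofChart' hx' _

variable (G ι) in
/-- The linearization of the deformation map at the zero section. -/
def linearization [T2Space M] (hι : Manifold.IsImmersion (𝓡 3) (𝓡 7) ∞ ι)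
    (hL : G.IsAssociative ι o) : G.normalSections ι →ₗ[ℝ] G.normalSections ι where
  toFun V := ⟨G.linearizationAt ι V.1, contMDiff_linearizationAt hι hL V.2.1, fun x v => by
    obtain ⟨e, he⟩ := G.exists_isOrientedOrthonormal ι hι o x
    exact (hasDerivAt_deformationMap_of_mem hL V.2.1 (mem_extChartAt_source x) he
      (mem_extChartAt_source _)).1 v⟩
  map_add' V W := by
    refine Subtype.ext (funext fun x => ?_)
    have h := G.chartLinearization_smul_add_smul V.2.1 W.2.1 (Z := (V + W).1) (c := 1) (d := 1)
      (fun x => by simp) (mem_extChartAt_target (I := 𝓡 3) x) (x₀ := ι x)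
      (by rw [extChartAt_to_inv]; exact mem_extChartAt_source _)
    rw [one_smul, one_smul] at h
    exact (congrArg (ofChart (ι x) (chartMap ι (ι x) x)) h).trans (map_add _ _ _)
  map_smul' c V := by
    refine Subtype.ext (funext fun x => ?_)
    have h := G.chartLinearization_smul_add_smul V.2.1 V.2.1 (Z := (c • V).1) (c := c) (d := 0)
      (fun x => by simp) (mem_extChartAt_target (I := 𝓡 3) x) (x₀ := ι x)
      (by rw [extChartAt_to_inv]; exact mem_extChartAt_source _)
    rw [zero_smul, add_zero] at h
    exact (congrArg (ofChart (ι x) (chartMap ι (ι x) x)) h).trans (map_smul _ _ _)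

theorem isLinearization_linearization [T2Space M] (hι : Manifold.IsImmersion (𝓡 3) (𝓡 7) ∞ ι)
    (hL : G.IsAssociative ι o) : G.IsLinearization ι o (G.linearization ι hι hL) := by
  intro V x e he
  exact (hasDerivAt_deformationMap_of_mem hL V.2.1 (mem_extChartAt_source x) he
      (mem_extChartAt_source _)).2

end

end G2Structure

/-! ### The divergence identity -/

section Swap

variable (b : R7 [⋀^Fin 4]→L[ℝ] ℝ) (x y z w : R7)

theorem map_swap_zero_one : b ![y, x, z, w] = -b ![x, y, z, w] := by
  have h := b.toAlternatingMap.map_swap ![x, y, z, w] (i := 0) (j := 1) (by decide)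
  have e : ![x, y, z, w] ∘ Equiv.swap (0 : Fin 4) 1 = ![y, x, z, w] := by
    funext i; fin_cases i <;> rfl
  rw [e] at h
  exact h

theorem map_swap_one_two : b ![x, z, y, w] = -b ![x, y, z, w] := by
  have h := b.toAlternatingMap.map_swap ![x, y, z, w] (i := 1) (j := 2) (by decide)
  have e : ![x, y, z, w] ∘ Equiv.swap (1 : Fin 4) 2 = ![x, z, y, w] := by
    funext i; fin_cases i <;> rfl
  rw [e] at h
  exact h

theorem map_swap_two_three : b ![x, y, w, z] = -b ![x, y, z, w] := by
  have h := b.toAlternatingMap.map_swap ![x, y, z, w] (i := 2) (j := 3) (by decide)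
  have e : ![x, y, z, w] ∘ Equiv.swap (2 : Fin 4) 3 = ![x, y, w, z] := by
    funext i; fin_cases i <;> rfl
  rw [e] at h
  exact h

end Swap

theorem fderiv_apply_vec4 {E : Type*} [NormedAddCommGroup E] [NormedSpace ℝ E]
    {ψ : R7 → R7 [⋀^Fin 4]→L[ℝ] ℝ} {f p q r s : E → R7} {η : E}
    (hψ : DifferentiableAt ℝ ψ (f η)) (hf : DifferentiableAt ℝ f η) (hp : DifferentiableAt ℝ p η)
    (hq : DifferentiableAt ℝ q η) (hr : DifferentiableAt ℝ r η) (hs : DifferentiableAt ℝ s η)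
    (v : E) :
    fderiv ℝ (fun x => ψ (f x) ![p x, q x, r x, s x]) η v =
      fderiv ℝ ψ (f η) (fderiv ℝ f η v) ![p η, q η, r η, s η] +
      (ψ (f η) ![fderiv ℝ p η v, q η, r η, s η] + ψ (f η) ![p η, fderiv ℝ q η v, r η, s η] +
        ψ (f η) ![p η, q η, fderiv ℝ r η v, s η] + ψ (f η) ![p η, q η, r η, fderiv ℝ s η v]) := by
  have hg : ∀ i, DifferentiableAt ℝ (![p, q, r, s] i) η := by
    intro i; fin_cases i <;> assumption
  have e1 : ∀ x, (fun i => ![p, q, r, s] i x) = ![p x, q x, r x, s x] := by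
    intro x; funext i; fin_cases i <;> rfl
  have h := fderiv_continuousAlternatingMap_apply_apply
    (f := fun x => ψ (f x)) (hψ.comp η hf) hg v
  simp only [e1] at h
  have h2 : fderiv ℝ (fun x => ψ (f x)) η v = fderiv ℝ ψ (f η) (fderiv ℝ f η v) := by
    have := fderiv_comp η hψ hf
    exact congrArg (fun A : E →L[ℝ] R7 [⋀^Fin 4]→L[ℝ] ℝ => A v) this
  rw [h, h2, Fin.sum_univ_four]
  congr 1
  have u0 : ∀ c : R7, Function.update ![p η, q η, r η, s η] 0 c = ![c, q η, r η, s η] := by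
    intro c; funext i; fin_cases i <;> rfl
  have u1 : ∀ c : R7, Function.update ![p η, q η, r η, s η] 1 c = ![p η, c, r η, s η] := by
    intro c; funext i; fin_cases i <;> rfl
  have u2 : ∀ c : R7, Function.update ![p η, q η, r η, s η] 2 c = ![p η, q η, c, s η] := by
    intro c; funext i; fin_cases i <;> rfl
  have u3 : ∀ c : R7, Function.update ![p η, q η, r η, s η] 3 c = ![p η, q η, r η, c] := by
    intro c; funext i; fin_cases i <;> rfl
  rw [u0, u1, u2, u3]
  rfl

theorem firstVar_eq_vec4 (ψ : R7 → R7 [⋀^Fin 4]→L[ℝ] ℝ) (y a : R7) (B H : Fin 3 → R7) (w : R7) :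
    firstVar ψ y a B H w = fderiv ℝ ψ y a ![w, B 0, B 1, B 2] +
      (ψ y ![w, H 0, B 1, B 2] + ψ y ![w, B 0, H 1, B 2] + ψ y ![w, B 0, B 1, H 2]) := by
  have e : Matrix.vecCons w B = ![w, B 0, B 1, B 2] := by funext i; fin_cases i <;> rfl
  have u0 : Matrix.vecCons w (Function.update B 0 (H 0)) = ![w, H 0, B 1, B 2] := by
    funext i; fin_cases i <;> rfl
  have u1 : Matrix.vecCons w (Function.update B 1 (H 1)) = ![w, B 0, H 1, B 2] := by
    funext i; fin_cases i <;> rfl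
  have u2 : Matrix.vecCons w (Function.update B 2 (H 2)) = ![w, B 0, B 1, H 2] := by
    funext i; fin_cases i <;> rfl
  rw [firstVar, Fin.sum_univ_three, e, u0, u1, u2]

theorem extDeriv_apply_vec5 {ψ : R7 → R7 [⋀^Fin 4]→L[ℝ] ℝ} {y : R7} (h : extDeriv ψ y = 0)
    (a b c d e : R7) :
    fderiv ℝ ψ y a ![b, c, d, e] - fderiv ℝ ψ y b ![a, c, d, e] + fderiv ℝ ψ y c ![a, b, d, e]
      - fderiv ℝ ψ y d ![a, b, c, e] + fderiv ℝ ψ y e ![a, b, c, d] = 0 := by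
  have h1 : ContinuousAlternatingMap.alternatizeUncurryFin (fderiv ℝ ψ y) ![a, b, c, d, e] = 0 := by
    have := congrArg (fun A : R7 [⋀^Fin 5]→L[ℝ] ℝ => A ![a, b, c, d, e]) h
    exact this
  rw [ContinuousAlternatingMap.alternatizeUncurryFin_apply, Fin.sum_univ_five] at h1
  have e0 : Fin.removeNth 0 ![a, b, c, d, e] = ![b, c, d, e] := by
    funext i; fin_cases i <;> rfl
  have e1 : Fin.removeNth 1 ![a, b, c, d, e] = ![a, c, d, e] := by
    funext i; fin_cases i <;> rfl
  have e2 : Fin.removeNth 2 ![a, b, c, d, e] = ![a, b, d, e] := by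
    funext i; fin_cases i <;> rfl
  have e3 : Fin.removeNth 3 ![a, b, c, d, e] = ![a, b, c, e] := by
    funext i; fin_cases i <;> rfl
  have e4 : Fin.removeNth 4 ![a, b, c, d, e] = ![a, b, c, d] := by
    funext i; fin_cases i <;> rfl
  rw [e0, e1, e2, e3, e4] at h1
  simp only [Fin.val_zero, Fin.val_one, Fin.val_two, pow_zero, pow_one, one_smul, neg_smul] at h1
  have p2 : ((-1 : ℤ)) ^ 2 = 1 := by norm_num
  have p3 : ((-1 : ℤ)) ^ ((3 : Fin 5) : ℕ) = -1 := by decide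
  have p4 : ((-1 : ℤ)) ^ ((4 : Fin 5) : ℕ) = 1 := by decide
  rw [p2, p3, p4] at h1
  simp only [one_smul, neg_smul] at h1
  change fderiv ℝ ψ y a ![b, c, d, e] + -fderiv ℝ ψ y b ![a, c, d, e] +
    fderiv ℝ ψ y c ![a, b, d, e] + -fderiv ℝ ψ y d ![a, b, c, e] +
    fderiv ℝ ψ y e ![a, b, c, d] = 0 at h1
  linarith

/-- The vector field on `ℝ³` whose divergence is the difference of two first variations: its
components are the values of `ψ` on `k` and the derivatives of `f`, one of which is replaced by
`h`. -/
def variationField (ψ : R7 → R7 [⋀^Fin 4]→L[ℝ] ℝ) (f h k : R3 → R7) (i : Fin 3) (η : R3) : ℝ :=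
  ψ (f η) (Matrix.vecCons (k η) (Function.update (fun j => fderiv ℝ f η (e3 j)) i (h η)))

/-- If `ψ` is closed, the difference between the first variation in the direction `h`, evaluated
on `k`, and the one with `h` and `k` exchanged is a divergence. -/
theorem firstVar_sub_firstVar {ψ : R7 → R7 [⋀^Fin 4]→L[ℝ] ℝ} {f h k : R3 → R7} {η : R3}
    (hψ : DifferentiableAt ℝ ψ (f η)) (hψ0 : extDeriv ψ (f η) = 0) (hf : ContDiffAt ℝ ∞ f η)
    (hh : DifferentiableAt ℝ h η) (hk : DifferentiableAt ℝ k η) :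
    firstVar ψ (f η) (h η) (fun j => fderiv ℝ f η (e3 j)) (fun j => fderiv ℝ h η (e3 j)) (k η) -
      firstVar ψ (f η) (k η) (fun j => fderiv ℝ f η (e3 j)) (fun j => fderiv ℝ k η (e3 j)) (h η) =
    ∑ i, fderiv ℝ (variationField ψ f h k i) η (e3 i) := by
  have hf1 : DifferentiableAt ℝ f η := hf.differentiableAt (by simp)
  have hd : ∀ j, DifferentiableAt ℝ (fun x => fderiv ℝ f x (e3 j)) η := fun j =>
    (((hf.fderiv_right (m := ∞) (by decide)).clm_apply contDiffAt_const)).differentiableAt (by simp)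
  have hsymm : ∀ i j, fderiv ℝ (fun x => fderiv ℝ f x (e3 j)) η (e3 i) =
      fderiv ℝ (fun x => fderiv ℝ f x (e3 i)) η (e3 j) := by
    have h1 : ∀ i j, fderiv ℝ (fun x => fderiv ℝ f x (e3 j)) η (e3 i) =
        fderiv ℝ (fderiv ℝ f) η (e3 i) (e3 j) := by
      intro i j
      have h2 : DifferentiableAt ℝ (fderiv ℝ f) η :=
        (hf.fderiv_right (m := ∞) (by decide)).differentiableAt (by simp)
      have h3 := (h2.hasFDerivAt.clm_apply (hasFDerivAt_const (e3 j) η)).fderiv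
      rw [h3]
      simp
    intro i j
    rw [h1, h1]
    exact (hf.isSymmSndFDerivAt (by simpa using (by decide : (2 : ℕ∞ω) ≤ ∞))) (e3 i) (e3 j)
  have g0 : variationField ψ f h k 0 = fun x =>
      ψ (f x) ![k x, h x, fderiv ℝ f x (e3 1), fderiv ℝ f x (e3 2)] := by
    funext x; unfold variationField; congr 1; funext i; fin_cases i <;> rfl
  have g1 : variationField ψ f h k 1 = fun x =>
      ψ (f x) ![k x, fderiv ℝ f x (e3 0), h x, fderiv ℝ f x (e3 2)] := by
    funext x; unfold variationField; congr 1; funext i; fin_cases i <;> rfl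
  have g2 : variationField ψ f h k 2 = fun x =>
      ψ (f x) ![k x, fderiv ℝ f x (e3 0), fderiv ℝ f x (e3 1), h x] := by
    funext x; unfold variationField; congr 1; funext i; fin_cases i <;> rfl
  rw [Fin.sum_univ_three, g0, g1, g2, fderiv_apply_vec4 hψ hf1 hk hh (hd 1) (hd 2),
    fderiv_apply_vec4 hψ hf1 hk (hd 0) hh (hd 2), fderiv_apply_vec4 hψ hf1 hk (hd 0) (hd 1) hh,
    firstVar_eq_vec4, firstVar_eq_vec4, hsymm 1 0, hsymm 2 0, hsymm 2 1]
  have hclosed := extDeriv_apply_vec5 hψ0 (h η) (k η) (fderiv ℝ f η (e3 0)) (fderiv ℝ f η (e3 1))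
    (fderiv ℝ f η (e3 2))
  -- With the derivatives replaced by variables, the identity is linear in the values of `T` and `b`;
  -- the swaps below bring equal values into the same form, `hclosed` accounts for the terms in `T`,
  -- and the second derivatives of `f` cancel in pairs.
  generalize fderiv ℝ ψ (f η) = T at *
  generalize ψ (f η) = b at *
  generalize fderiv ℝ (fun x => fderiv ℝ f x (e3 1)) η (e3 0) = S01
  generalize fderiv ℝ (fun x => fderiv ℝ f x (e3 2)) η (e3 0) = S02
  generalize fderiv ℝ (fun x => fderiv ℝ f x (e3 2)) η (e3 1) = S12
  generalize fderiv ℝ f η (e3 0) = B0 at *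
  generalize fderiv ℝ f η (e3 1) = B1 at *
  generalize fderiv ℝ f η (e3 2) = B2 at *
  generalize fderiv ℝ h η (e3 0) = h0
  generalize fderiv ℝ h η (e3 1) = h1
  generalize fderiv ℝ h η (e3 2) = h2
  generalize fderiv ℝ k η (e3 0) = k0
  generalize fderiv ℝ k η (e3 1) = k1
  generalize fderiv ℝ k η (e3 2) = k2
  generalize h η = hv at *
  generalize k η = kv at *
  have t0 := map_swap_zero_one (T B0) hv kv B1 B2
  have t1 := map_swap_zero_one (T B1) hv kv B0 B2
  have t1' := map_swap_one_two (T B1) kv hv B0 B2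
  have t2 := map_swap_zero_one (T B2) hv kv B0 B1
  have t2' := map_swap_one_two (T B2) kv hv B0 B1
  have t2'' := map_swap_two_three (T B2) kv B0 hv B1
  have r0 := map_swap_zero_one b hv k0 B1 B2
  have r1 := map_swap_zero_one b hv B0 k1 B2
  have r1' := map_swap_one_two b B0 hv k1 B2
  have r1'' := map_swap_zero_one b B0 k1 hv B2
  have r2 := map_swap_zero_one b hv B0 B1 k2
  have r2' := map_swap_one_two b B0 hv B1 k2
  have r2'' := map_swap_two_three b B0 B1 hv k2
  have r2a := map_swap_one_two b B0 B1 k2 hv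
  have r2b := map_swap_zero_one b B0 k2 B1 hv
  have s01 := map_swap_one_two b kv hv S01 B2
  have s02 := map_swap_one_two b kv hv B1 S02
  have s02' := map_swap_two_three b kv B1 hv S02
  have s02'' := map_swap_one_two b kv B1 S02 hv
  have s12 := map_swap_two_three b kv B0 hv S12
  linarith

/-! ### The Riemannian measure -/

open MeasureTheory

/-- The Gram determinant under a change of vectors. -/
theorem det_gram_of_eq_sum {E : Type*} [NormedAddCommGroup E] [InnerProductSpace ℝ E] {k : ℕ}
    {u v : Fin k → E} (P : Matrix (Fin k) (Fin k) ℝ) (h : ∀ i, u i = ∑ j, P j i • v j) :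
    Matrix.det (Matrix.of fun i j => inner ℝ (u i) (u j)) =
      P.det ^ 2 * Matrix.det (Matrix.of fun i j => inner ℝ (v i) (v j)) := by
  have h1 : (Matrix.of fun i j => inner ℝ (u i) (u j) : Matrix (Fin k) (Fin k) ℝ) =
      P.transpose * (Matrix.of fun i j => inner ℝ (v i) (v j)) * P := by
    ext i j
    simp only [Matrix.of_apply, Matrix.mul_apply, Matrix.transpose_apply, h, sum_inner, inner_sum,
      real_inner_smul_left, real_inner_smul_right, Finset.sum_mul]
    refine Finset.sum_congr rfl fun a _ => Finset.sum_congr rfl fun b _ => ?_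
    rw [real_inner_comm]
    ring
  rw [h1, Matrix.det_mul, Matrix.det_mul, Matrix.det_transpose]
  ring

theorem measurableSet_inter_preimage_of_continuousOn {X Y : Type*} [TopologicalSpace X]
    [MeasurableSpace X] [BorelSpace X] [TopologicalSpace Y] [MeasurableSpace Y] [BorelSpace Y]
    {f : X → Y} {s : Set X} (hs : MeasurableSet s) (hf : ContinuousOn f s) {A : Set Y}
    (hA : MeasurableSet A) : MeasurableSet (s ∩ f ⁻¹' A) := by
  have h1 : MeasurableSet (s.domRestrict f ⁻¹' A) :=
    (continuousOn_iff_continuous_domRestrict.1 hf).measurable hA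
  have h2 := hs.subtype_image h1
  convert h2 using 1
  ext x
  simp [and_comm]

namespace G2Structure

variable {M : Type*} [TopologicalSpace M] [ChartedSpace R7 M] (G : G2Structure M)
  {L : Type*} [TopologicalSpace L] [ChartedSpace R3 L] [IsManifold (𝓡 7) ∞ M]
  [IsManifold (𝓡 3) ∞ L]

/-- The density of the Riemannian measure in the chart around `x₀`. -/
def chartDensity (ι : L → M) (x₀ : L) (y : R3) : ℝ :=
  Real.sqrt (Matrix.det (Matrix.of fun i j : Fin 3 =>
    G.metric (ι ((extChartAt (𝓡 3) x₀).symm y))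
      (mfderiv 𝓘(ℝ, R3) (𝓡 7) (ι ∘ (extChartAt (𝓡 3) x₀).symm) y (e3 i))
      (mfderiv 𝓘(ℝ, R3) (𝓡 7) (ι ∘ (extChartAt (𝓡 3) x₀).symm) y (e3 j))))

/-- The Riemannian measure of the domain of the chart around `x₀`. -/
def chartMeasure [MeasurableSpace L] (ι : L → M) (x₀ : L) : Measure L :=
  Measure.map (extChartAt (𝓡 3) x₀).symm
    ((volume.restrict (extChartAt (𝓡 3) x₀).target).withDensity fun y =>
      ENNReal.ofReal (G.chartDensity ι x₀ y))

theorem volumeMeasure_eq [MeasurableSpace L] (ι : L → M) :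
    G.volumeMeasure ι = ⨆ x₀, G.chartMeasure ι x₀ := rfl

theorem mfderiv_comp_symm (ι : C^∞⟮𝓡 3, L; 𝓡 7, M⟯) {x₁ : L} {η : R3}
    (hη : η ∈ (extChartAt (𝓡 3) x₁).target) (i : Fin 3) :
    mfderiv 𝓘(ℝ, R3) (𝓡 7) (ι ∘ (extChartAt (𝓡 3) x₁).symm) η (e3 i) =
      mfderiv (𝓡 3) (𝓡 7) ι ((extChartAt (𝓡 3) x₁).symm η) (coordBasis hη i) := by
  have h := mfderiv_comp η ((ι.contMDiff ((extChartAt (𝓡 3) x₁).symm η)).mdifferentiableAt (by simp))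
    (mdifferentiableAt_symm₃ hη)
  rw [coordBasis_apply]
  exact congrArg (fun A : R3 →L[ℝ] R7 => A (e3 i)) h

/-- On an associative submanifold the density is the absolute value of `φ` on the coordinate
vector fields. -/
theorem chartDensity_eq_abs_chartForm {ι : C^∞⟮𝓡 3, L; 𝓡 7, M⟯}
    {o : ∀ x : L, Orientation ℝ (TangentSpace (𝓡 3) x) (Fin 3)} (hL : G.IsAssociative ι o)
    (hι : Manifold.IsImmersion (𝓡 3) (𝓡 7) ∞ ι) {x₁ : L} {η : R3}
    (hη : η ∈ (extChartAt (𝓡 3) x₁).target) {x₀ : M}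
    (hx : ι ((extChartAt (𝓡 3) x₁).symm η) ∈ (extChartAt (𝓡 7) x₀).source) :
    G.chartDensity ι x₁ η = |G.chartForm ι x₀ x₁ η| := by
  obtain ⟨e', he'⟩ := G.exists_isOrientedOrthonormal ι hι o ((extChartAt (𝓡 3) x₁).symm η)
  obtain ⟨e, rfl⟩ : ∃ e : Module.Basis (Fin 3) ℝ R3, e = e' := ⟨e', rfl⟩
  rw [(variationVector_eq_chartLinearization hL (contMDiff_zero_lift ι.contMDiff) hη he' hx).1]
  set x := (extChartAt (𝓡 3) x₁).symm η with hxdef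
  let A : R3 →L[ℝ] R7 := (show R7 →L[ℝ] R7 from (G.frame (ι x) : TangentSpace (𝓡 7) (ι x) →L[ℝ] R7)).comp
    (show R3 →L[ℝ] R7 from mfderiv (𝓡 3) (𝓡 7) ι x)
  have h1 := det_gram_of_eq_sum (u := fun i => A (coordBasis hη i)) (v := fun i => A (e i))
    (e.toMatrix (coordBasis hη)) (fun i => by
      have h2 := e.sum_toMatrix_smul_self (coordBasis hη) i
      simp only [← map_smul, ← map_sum, h2])
  have h2 : (Matrix.of fun i j => inner ℝ (A (e i)) (A (e j)) : Matrix (Fin 3) (Fin 3) ℝ) = 1 := by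
    ext i j
    rw [Matrix.one_apply]
    exact he'.1 i j
  rw [h2, Matrix.det_one, mul_one] at h1
  have h3 : G.chartDensity ι x₁ η =
      Real.sqrt (Matrix.det (Matrix.of fun i j => inner ℝ (A (coordBasis hη i))
        (A (coordBasis hη j)) : Matrix (Fin 3) (Fin 3) ℝ)) := by
    unfold chartDensity
    simp only [mfderiv_comp_symm ι hη]
    rfl
  rw [h3, h1, Real.sqrt_sq_eq_abs]
  rfl

/-- The transition map between two charts of `L`. -/
def transition₃ (x₀ x₁ : L) (y : R3) : R3 := extChartAt (𝓡 3) x₁ ((extChartAt (𝓡 3) x₀).symm y)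

/-- The part of the target of the chart of `L` around `x₀` that lies in the chart around `x₁`. -/
def overlap₃ (x₀ x₁ : L) : Set R3 :=
  (extChartAt (𝓡 3) x₀).target ∩ (extChartAt (𝓡 3) x₀).symm ⁻¹' (extChartAt (𝓡 3) x₁).source

theorem isOpen_overlap₃ (x₀ x₁ : L) : IsOpen (overlap₃ x₀ x₁) :=
  (continuousOn_extChartAt_symm x₀).isOpen_inter_preimage (isOpen_extChartAt_target x₀)
    (isOpen_extChartAt_source x₁)

theorem differentiableAt_transition₃ {x₀ x₁ : L} {y : R3} (hy : y ∈ overlap₃ x₀ x₁) :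
    DifferentiableAt ℝ (transition₃ x₀ x₁) y := by
  have h := contDiffOn_ext_coord_change (I := 𝓡 3) (n := ∞) x₁ x₀
  rw [PartialEquiv.trans_source, PartialEquiv.symm_source] at h
  exact (h.contDiffAt ((isOpen_overlap₃ x₀ x₁).mem_nhds hy)).differentiableAt (by simp)

/-- The density transforms by the Jacobian of the transition map. -/
theorem chartDensity_transition (ι : C^∞⟮𝓡 3, L; 𝓡 7, M⟯) {x₀ x₁ : L} {y : R3}
    (hy : y ∈ overlap₃ x₀ x₁) :
    G.chartDensity ι x₀ y =
      |(fderiv ℝ (transition₃ x₀ x₁) y).det| * G.chartDensity ι x₁ (transition₃ x₀ x₁ y) := by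
  have hz : transition₃ x₀ x₁ y ∈ (extChartAt (𝓡 3) x₁).target :=
    (extChartAt (𝓡 3) x₁).map_source hy.2
  have hsymm : ∀ y ∈ overlap₃ x₀ x₁, (extChartAt (𝓡 3) x₁).symm (transition₃ x₀ x₁ y) =
      (extChartAt (𝓡 3) x₀).symm y := fun y hy => (extChartAt (𝓡 3) x₁).left_inv hy.2
  have hd : ∀ {x₁ : L} {η : R3}, η ∈ (extChartAt (𝓡 3) x₁).target →
      MDifferentiableAt 𝓘(ℝ, R3) (𝓡 7) (ι ∘ (extChartAt (𝓡 3) x₁).symm) η := fun {x₁ η} hη =>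
    MDifferentiableAt.comp η ((ι.contMDiff _).mdifferentiableAt (by simp)) (mdifferentiableAt_symm₃ hη)
  obtain ⟨T, hT⟩ : ∃ T : R3 →L[ℝ] R3, T = fderiv ℝ (transition₃ x₀ x₁) y := ⟨_, rfl⟩
  have hmf : ∀ v : R3, (mfderiv 𝓘(ℝ, R3) (𝓡 7) (ι ∘ (extChartAt (𝓡 3) x₀).symm) y v : R7) =
      mfderiv 𝓘(ℝ, R3) (𝓡 7) (ι ∘ (extChartAt (𝓡 3) x₁).symm) (transition₃ x₀ x₁ y) (T v) := by
    intro v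
    have h1 := ((hd hz).hasMFDerivAt.comp y
      (differentiableAt_transition₃ hy).hasFDerivAt.hasMFDerivAt).congr_of_eventuallyEq
      (f₁ := ι ∘ (extChartAt (𝓡 3) x₀).symm) (by
        filter_upwards [(isOpen_overlap₃ x₀ x₁).mem_nhds hy] with y' hy'
        exact (congrArg ι (hsymm y' hy')).symm)
    rw [hT]
    exact congrArg (fun A : R3 →L[ℝ] R7 => A v) h1.mfderiv
  set p := ι ((extChartAt (𝓡 3) x₀).symm y) with hp
  have hp1 : ι ((extChartAt (𝓡 3) x₁).symm (transition₃ x₀ x₁ y)) = p := congrArg ι (hsymm y hy)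
  let u : R7 →L[ℝ] R7 := (show R7 →L[ℝ] R7 from (G.frame p : TangentSpace (𝓡 7) p →L[ℝ] R7))
  let B : R3 →L[ℝ] R7 := u.comp (show R3 →L[ℝ] R7 from
    mfderiv 𝓘(ℝ, R3) (𝓡 7) (ι ∘ (extChartAt (𝓡 3) x₁).symm) (transition₃ x₀ x₁ y))
  have h0 : G.chartDensity ι x₀ y = Real.sqrt (Matrix.det (Matrix.of fun i j =>
      inner ℝ (B (T (e3 i))) (B (T (e3 j))) : Matrix (Fin 3) (Fin 3) ℝ)) := by
    have h2 : ∀ i, u (mfderiv 𝓘(ℝ, R3) (𝓡 7) (ι ∘ (extChartAt (𝓡 3) x₀).symm) y (e3 i)) =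
      B (T (e3 i)) := fun i => congrArg u (hmf (e3 i))
    simp only [← h2]
    rfl
  have h1 : G.chartDensity ι x₁ (transition₃ x₀ x₁ y) = Real.sqrt (Matrix.det (Matrix.of fun i j =>
      inner ℝ (B (e3 i)) (B (e3 j)) : Matrix (Fin 3) (Fin 3) ℝ)) := by
    have h2 : ∀ (q : M) (a b : R7), q = p → G.metric q a b = inner ℝ (u a) (u b) := by
      rintro q a b rfl; rfl
    unfold chartDensity
    congr 3
    funext i j
    exact h2 _ _ _ hp1
  have h2 := det_gram_of_eq_sum (u := fun i => B (T (e3 i))) (v := fun i => B (e3 i))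
    (LinearMap.toMatrix (EuclideanSpace.basisFun (Fin 3) ℝ).toBasis
      (EuclideanSpace.basisFun (Fin 3) ℝ).toBasis T.toLinearMap) (fun i => by
      simp only [← map_smul, ← map_sum]
      congr 1
      have h3 := (EuclideanSpace.basisFun (Fin 3) ℝ).toBasis.sum_repr (T (e3 i))
      rw [← h3]
      refine Finset.sum_congr rfl fun j _ => ?_
      rw [LinearMap.toMatrix_apply]
      simp)
  rw [LinearMap.det_toMatrix] at h2
  rw [h0, h1, h2, Real.sqrt_mul (sq_nonneg _), Real.sqrt_sq_eq_abs, ← hT]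

end G2Structure

namespace G2Structure

variable {M : Type*} [TopologicalSpace M] [ChartedSpace R7 M] (G : G2Structure M)
  {L : Type*} [TopologicalSpace L] [ChartedSpace R3 L] [IsManifold (𝓡 7) ∞ M]
  [IsManifold (𝓡 3) ∞ L]

theorem measurableSet_target₃ (x₀ : L) : MeasurableSet (extChartAt (𝓡 3) x₀).target :=
  (isOpen_extChartAt_target x₀).measurableSet

theorem aemeasurable_symm₃ [MeasurableSpace L] [BorelSpace L] (x₀ : L) (ρ : R3 → ENNReal) :
    AEMeasurable (extChartAt (𝓡 3) x₀).symm
      ((volume.restrict (extChartAt (𝓡 3) x₀).target).withDensity ρ) :=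
  ((continuousOn_extChartAt_symm x₀).aemeasurable (measurableSet_target₃ x₀)).mono_ac
    (withDensity_absolutelyContinuous _ _)

theorem chartMeasure_apply [MeasurableSpace L] [BorelSpace L] (ι : L → M) (x₀ : L) {A : Set L}
    (hA : MeasurableSet A) :
    G.chartMeasure ι x₀ A =
      ∫⁻ y in (extChartAt (𝓡 3) x₀).target ∩ (extChartAt (𝓡 3) x₀).symm ⁻¹' A,
        ENNReal.ofReal (G.chartDensity ι x₀ y) := by
  rw [chartMeasure, Measure.map_apply_of_aemeasurable (aemeasurable_symm₃ x₀ _) hA,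
    withDensity_apply', Measure.restrict_restrict' (measurableSet_target₃ x₀), Set.inter_comm]

/-- By the change of variables formula, the measures of two charts agree on the overlap; only one
inequality is needed. -/
theorem chartMeasure_le_chartMeasure [MeasurableSpace L] [BorelSpace L] (ι : C^∞⟮𝓡 3, L; 𝓡 7, M⟯)
    (x₀ x₁ : L) {A : Set L} (hA : MeasurableSet A) (hAs : A ⊆ (extChartAt (𝓡 3) x₁).source) :
    G.chartMeasure ι x₀ A ≤ G.chartMeasure ι x₁ A := by
  rw [chartMeasure_apply G ι x₀ hA, chartMeasure_apply G ι x₁ hA]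
  set S := (extChartAt (𝓡 3) x₀).target ∩ (extChartAt (𝓡 3) x₀).symm ⁻¹' A with hS
  have hSm : MeasurableSet S := measurableSet_inter_preimage_of_continuousOn
    (measurableSet_target₃ x₀) (continuousOn_extChartAt_symm x₀) hA
  have hSo : ∀ y ∈ S, y ∈ overlap₃ x₀ x₁ := fun y hy => ⟨hy.1, hAs hy.2⟩
  have hsymm : ∀ y ∈ S, (extChartAt (𝓡 3) x₁).symm (transition₃ x₀ x₁ y) =
      (extChartAt (𝓡 3) x₀).symm y := fun y hy =>
    (extChartAt (𝓡 3) x₁).left_inv (hSo y hy).2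
  have hinj : Set.InjOn (transition₃ x₀ x₁) S := by
    intro y hy y' hy' h
    have h1 : (extChartAt (𝓡 3) x₀).symm y = (extChartAt (𝓡 3) x₀).symm y' := by
      rw [← hsymm y hy, ← hsymm y' hy', h]
    rw [← (extChartAt (𝓡 3) x₀).right_inv hy.1, ← (extChartAt (𝓡 3) x₀).right_inv hy'.1, h1]
  have himage : transition₃ x₀ x₁ '' S ⊆
      (extChartAt (𝓡 3) x₁).target ∩ (extChartAt (𝓡 3) x₁).symm ⁻¹' A := by
    rintro _ ⟨y, hy, rfl⟩
    refine ⟨(extChartAt (𝓡 3) x₁).map_source (hSo y hy).2, ?_⟩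
    rw [Set.mem_preimage, hsymm y hy]
    exact hy.2
  refine le_trans (le_of_eq ?_) (lintegral_mono_set himage)
  rw [lintegral_image_eq_lintegral_abs_det_fderiv_mul volume hSm
    (fun y hy => (differentiableAt_transition₃ (hSo y hy)).hasFDerivAt.hasFDerivWithinAt) hinj]
  refine setLIntegral_congr_fun hSm fun y hy => ?_
  rw [G.chartDensity_transition ι (hSo y hy), ENNReal.ofReal_mul (abs_nonneg _)]

/-- On the domain of a chart, the supremum of the measures of all charts is the measure of that chart:
each of them is at most `chartMeasure ι x₁` on the domain and at most `volumeMeasure ι` off it. -/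
theorem volumeMeasure_apply_of_subset_source [MeasurableSpace L] [BorelSpace L]
    (ι : C^∞⟮𝓡 3, L; 𝓡 7, M⟯) (x₁ : L) {A : Set L}
    (hAs : A ⊆ (extChartAt (𝓡 3) x₁).source) :
    G.volumeMeasure ι A = G.chartMeasure ι x₁ A := by
  have hU : MeasurableSet (extChartAt (𝓡 3) x₁).source := (isOpen_extChartAt_source x₁).measurableSet
  have hle : ∀ x₀, G.chartMeasure ι x₀ ≤ G.volumeMeasure ι := fun x₀ => by
    rw [volumeMeasure_eq]
    exact le_iSup (G.chartMeasure ι) x₀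
  refine le_antisymm ?_ (hle x₁ A)
  have h : G.volumeMeasure ι ≤ G.chartMeasure ι x₁ +
      (G.volumeMeasure ι).restrict (extChartAt (𝓡 3) x₁).sourceᶜ := by
    conv_lhs => rw [volumeMeasure_eq]
    refine iSup_le fun x₀ => Measure.le_iff.2 fun B hB => ?_
    rw [← measure_inter_add_sdiff B hU, Measure.add_apply,
      Measure.restrict_apply' hU.compl, ← Set.sdiff_eq]
    refine add_le_add ?_ (hle x₀ _)
    exact (G.chartMeasure_le_chartMeasure ι x₀ x₁ (hB.inter hU) Set.inter_subset_right).trans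
      (measure_mono Set.inter_subset_left)
  refine (h A).trans (le_of_eq ?_)
  rw [Measure.add_apply, Measure.restrict_apply' hU.compl, ← Set.sdiff_eq,
    Set.sdiff_eq_empty.2 hAs, measure_empty, add_zero]

theorem continuousOn_chartDensity {ι : C^∞⟮𝓡 3, L; 𝓡 7, M⟯}
    {o : ∀ x : L, Orientation ℝ (TangentSpace (𝓡 3) x) (Fin 3)} (hL : G.IsAssociative ι o)
    (hι : Manifold.IsImmersion (𝓡 3) (𝓡 7) ∞ ι) (x₁ : L) :
    ContinuousOn (G.chartDensity ι x₁) (extChartAt (𝓡 3) x₁).target := by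
  intro η hη
  refine ContinuousAt.continuousWithinAt ?_
  have hx := mem_extChartAt_source (I := 𝓡 7) (ι ((extChartAt (𝓡 3) x₁).symm η))
  refine (G.contDiffAt_chartForm ι hη hx).continuousAt.abs.congr ?_
  have h1 : ContinuousAt (fun η' => ι ((extChartAt (𝓡 3) x₁).symm η')) η :=
    (ι.contMDiff.continuous.continuousAt).comp (continuousAt_extChartAt_symm'' hη)
  filter_upwards [(isOpen_extChartAt_target x₁).mem_nhds hη,
    h1.preimage_mem_nhds ((isOpen_extChartAt_source _).mem_nhds hx)] with η' h2 h3
  exact (G.chartDensity_eq_abs_chartForm hL hι h2 h3).symm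

/-- The integral of a function supported in a chart domain. -/
theorem integral_volumeMeasure_eq [MeasurableSpace L] [BorelSpace L] {ι : C^∞⟮𝓡 3, L; 𝓡 7, M⟯}
    {o : ∀ x : L, Orientation ℝ (TangentSpace (𝓡 3) x) (Fin 3)} (hL : G.IsAssociative ι o)
    (hι : Manifold.IsImmersion (𝓡 3) (𝓡 7) ∞ ι) (x₁ : L) {F : L → ℝ} (hF : Continuous F)
    (h0 : ∀ x ∉ (extChartAt (𝓡 3) x₁).source, F x = 0) :
    ∫ x, F x ∂(G.volumeMeasure ι) = ∫ y in (extChartAt (𝓡 3) x₁).target,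
      G.chartDensity ι x₁ y * F ((extChartAt (𝓡 3) x₁).symm y) := by
  have hU : MeasurableSet (extChartAt (𝓡 3) x₁).source := (isOpen_extChartAt_source x₁).measurableSet
  have h1 : (G.volumeMeasure ι).restrict (extChartAt (𝓡 3) x₁).source =
      (G.chartMeasure ι x₁).restrict (extChartAt (𝓡 3) x₁).source := by
    ext A hA
    rw [Measure.restrict_apply hA, Measure.restrict_apply hA]
    exact G.volumeMeasure_apply_of_subset_source ι x₁ Set.inter_subset_right
  rw [← setIntegral_eq_integral_of_forall_compl_eq_zero h0, h1,
    setIntegral_eq_integral_of_forall_compl_eq_zero h0, chartMeasure,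
    integral_map (aemeasurable_symm₃ x₁ _) hF.measurable.aestronglyMeasurable,
    integral_withDensity_eq_integral_toReal_smul₀
      (((G.continuousOn_chartDensity hL hι x₁).aemeasurable (measurableSet_target₃ x₁)).ennreal_ofReal)
      (Filter.Eventually.of_forall fun _ => ENNReal.ofReal_lt_top)]
  refine integral_congr_ae (Filter.Eventually.of_forall fun y => ?_)
  exact congrArg (· * F ((extChartAt (𝓡 3) x₁).symm y)) (ENNReal.toReal_ofReal (Real.sqrt_nonneg _))

/-- The density is continuous, so the measure is locally finite. -/
theorem isFiniteMeasure_volumeMeasure [MeasurableSpace L] [BorelSpace L] [CompactSpace L]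
    {ι : C^∞⟮𝓡 3, L; 𝓡 7, M⟯}
    {o : ∀ x : L, Orientation ℝ (TangentSpace (𝓡 3) x) (Fin 3)} (hL : G.IsAssociative ι o)
    (hι : Manifold.IsImmersion (𝓡 3) (𝓡 7) ∞ ι) : IsFiniteMeasure (G.volumeMeasure ι) := by
  have : IsLocallyFiniteMeasure (G.volumeMeasure ι) := by
    refine ⟨fun x₁ => ?_⟩
    obtain ⟨r, hr, hball⟩ := Metric.nhds_basis_closedBall.mem_iff.1
      (extChartAt_target_mem_nhds (I := 𝓡 3) x₁)
    have ho : IsOpen ((extChartAt (𝓡 3) x₁).source ∩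
        extChartAt (𝓡 3) x₁ ⁻¹' Metric.ball (extChartAt (𝓡 3) x₁ x₁) r) :=
      (continuousOn_extChartAt x₁).isOpen_inter_preimage (isOpen_extChartAt_source x₁)
        Metric.isOpen_ball
    refine ⟨_, ho.mem_nhds ⟨mem_extChartAt_source x₁, Metric.mem_ball_self hr⟩, ?_⟩
    rw [G.volumeMeasure_apply_of_subset_source ι x₁ Set.inter_subset_left,
      G.chartMeasure_apply ι x₁ ho.measurableSet]
    refine lt_of_le_of_lt (lintegral_mono_set (t := Metric.closedBall (extChartAt (𝓡 3) x₁ x₁) r)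
      ?_) ?_
    · rintro y ⟨hy, -, hy2⟩
      rw [Set.mem_preimage, (extChartAt (𝓡 3) x₁).right_inv hy] at hy2
      exact Metric.ball_subset_closedBall hy2
    · exact (((G.continuousOn_chartDensity hL hι x₁).mono hball).integrableOn_compact
        (isCompact_closedBall _ _)).lintegral_lt_top
  infer_instance

end G2Structure

/-! ### Integrals of divergences -/

theorem integral_fderiv_apply_eq_zero {E : Type*} [NormedAddCommGroup E] [NormedSpace ℝ E]
    [FiniteDimensional ℝ E] [MeasurableSpace E] [BorelSpace E] (μ : Measure E) [μ.IsAddHaarMeasure]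
    {g : E → ℝ} (hg : ContDiff ℝ 1 g) (hc : HasCompactSupport g) (v : E) :
    ∫ y, fderiv ℝ g y v ∂μ = 0 := by
  have h1 : Continuous fun y => fderiv ℝ g y v :=
    (hg.continuous_fderiv (by simp)).clm_apply continuous_const
  have h := integral_mul_fderiv_eq_neg_fderiv_mul_of_integrable (μ := μ) (𝕜 := ℝ)
    (f := fun _ : E => (1 : ℝ)) (g := g) (v := v) (by simp)
    (by simpa using h1.integrable_of_hasCompactSupport (hc.fderiv_apply ℝ v))
    (by simpa using hg.continuous.integrable_of_hasCompactSupport hc)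
    (fun _ _ => differentiableAt_const _) (fun x _ => hg.differentiable (by simp) x)
  simpa using h

/-- The integral of the divergence of a vector field, defined on an open set and vanishing off a
compact subset, is zero. -/
theorem setIntegral_sum_fderiv_eq_zero {O K T : Set R3} (hO : IsOpen O) (hK : IsCompact K)
    (hT : MeasurableSet T) (hKO : K ⊆ O) (hOT : O ⊆ T) {X : Fin 3 → R3 → ℝ}
    (hX : ∀ i, ∀ y ∈ O, ContDiffAt ℝ 1 (X i) y) (hX0 : ∀ i, ∀ y ∈ O \ K, X i y = 0) {Φ : R3 → ℝ}
    (hΦ : ∀ y ∈ O, Φ y = ∑ i, fderiv ℝ (X i) y (e3 i)) (hΦ0 : ∀ y ∈ T \ K, Φ y = 0) :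
    ∫ y in T, Φ y = 0 := by
  classical
  set Y : Fin 3 → R3 → ℝ := fun i => O.indicator (X i) with hY
  have hY1 : ∀ i, ∀ y ∈ O, Y i =ᶠ[𝓝 y] X i := fun i y hy => by
    filter_upwards [hO.mem_nhds hy] with z hz
    exact Set.indicator_of_mem hz _
  have hYK : ∀ i, ∀ y ∉ K, Y i y = 0 := fun i y hy => by
    by_cases h : y ∈ O
    · rw [hY]
      exact (Set.indicator_of_mem h _).trans (hX0 i y ⟨h, hy⟩)
    · exact Set.indicator_of_notMem h _
  have hY0 : ∀ i, ∀ y ∉ O, Y i =ᶠ[𝓝 y] fun _ => 0 := fun i y hy => by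
    filter_upwards [hK.isClosed.isOpen_compl.mem_nhds fun h => hy (hKO h)] with z hz
    exact hYK i z hz
  have hYd : ∀ i, ContDiff ℝ 1 (Y i) := fun i => contDiff_iff_contDiffAt.2 fun y => by
    by_cases h : y ∈ O
    · exact (hX i y h).congr_of_eventuallyEq (hY1 i y h)
    · exact contDiffAt_const.congr_of_eventuallyEq (hY0 i y h)
  have hYc : ∀ i, HasCompactSupport (Y i) := fun i =>
    HasCompactSupport.intro hK fun y hy => hYK i y hy
  have h1 : ∀ y, T.indicator Φ y = ∑ i, fderiv ℝ (Y i) y (e3 i) := fun y => by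
    by_cases h : y ∈ O
    · rw [Set.indicator_of_mem (hOT h), hΦ y h]
      simp only [(hY1 _ y h).fderiv_eq]
    · have h2 : T.indicator Φ y = 0 := by
        by_cases hy : y ∈ T
        · rw [Set.indicator_of_mem hy, hΦ0 y ⟨hy, fun h' => h (hKO h')⟩]
        · exact Set.indicator_of_notMem hy _
      rw [h2]
      simp [(hY0 _ y h).fderiv_eq]
  have h2 : ∀ i, Integrable fun y => fderiv ℝ (Y i) y (e3 i) := fun i =>
    (((hYd i).continuous_fderiv (by simp)).clm_apply
      continuous_const).integrable_of_hasCompactSupport ((hYc i).fderiv_apply ℝ (e3 i))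
  rw [← integral_indicator hT]
  simp only [h1]
  rw [integral_finsetSum _ fun i _ => h2 i]
  exact Finset.sum_eq_zero fun i _ => integral_fderiv_apply_eq_zero volume (hYd i) (hYc i) (e3 i)

/-- The sign of a nonvanishing continuous function is locally constant. -/
theorem abs_mul_inv_eventuallyEq {X : Type*} [TopologicalSpace X] {c : X → ℝ} {x : X}
    (hc : ContinuousAt c x) (h : c x ≠ 0) :
    (fun x' => |c x'| * (c x')⁻¹) =ᶠ[𝓝 x] fun _ => |c x| * (c x)⁻¹ := by
  rcases lt_or_gt_of_ne h with h | h
  · filter_upwards [hc.eventually_lt_const h] with x' hx'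
    rw [abs_of_neg hx', abs_of_neg h, neg_mul, neg_mul, mul_inv_cancel₀ hx'.ne, mul_inv_cancel₀ h.ne]
  · filter_upwards [hc.eventually_const_lt h] with x' hx'
    rw [abs_of_pos hx', abs_of_pos h, mul_inv_cancel₀ hx'.ne', mul_inv_cancel₀ h.ne']

/-! ### The linearization and the metric in charts -/

namespace G2Structure

variable {M : Type*} [TopologicalSpace M] [ChartedSpace R7 M] (G : G2Structure M)
  {L : Type*} [TopologicalSpace L] [ChartedSpace R3 L] [IsManifold (𝓡 7) ∞ M]
  [IsManifold (𝓡 3) ∞ L]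

theorem metric_comm (p : M) (v w : TangentSpace (𝓡 7) p) : G.metric p v w = G.metric p w v :=
  real_inner_comm _ _

theorem continuous_metric {ι : C^∞⟮𝓡 3, L; 𝓡 7, M⟯} {V W : ∀ x : L, TangentSpace (𝓡 7) (ι x)}
    (hV : ContMDiff (𝓡 3) (𝓡 7).tangent ∞ (fun x => (⟨ι x, V x⟩ : TangentBundle (𝓡 7) M)))
    (hW : ContMDiff (𝓡 3) (𝓡 7).tangent ∞ (fun x => (⟨ι x, W x⟩ : TangentBundle (𝓡 7) M))) :
    Continuous fun x => G.metric (ι x) (V x) (W x) := by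
  rw [continuous_iff_continuousAt]
  intro x
  have hx := mem_extChartAt_source (I := 𝓡 7) (ι x)
  have h1 := (contMDiffAt_chartField hV hx).continuousAt
  have h2 := (contMDiffAt_chartField hW hx).continuousAt
  have h3 := (contMDiffAt_chartMap ι hx).continuousAt
  have hyt : chartMap ι (ι x) x ∈ (extChartAt (𝓡 7) (ι x)).target :=
    (extChartAt (𝓡 7) (ι x)).map_source hx
  have h4 : ContinuousAt (G.metricOp (ι x)) (chartMap ι (ι x) x) :=
    (G.contDiffOn_metricOp (ι x)).continuousOn.continuousAt ((isOpen_chart_target _).mem_nhds hyt)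
  have h5 := ((h4.comp h3).clm_apply h1).inner (𝕜 := ℝ) h2
  refine h5.congr ?_
  filter_upwards [ι.contMDiff.continuous.continuousAt.preimage_mem_nhds
    ((isOpen_extChartAt_source (ι x)).mem_nhds hx)] with x' hx'
  exact (G.inner_metricOp ((extChartAt (𝓡 7) (ι x)).map_source hx') _ _).trans
    (G.metric_eq_metricInChart hx' _ _).symm

theorem metricInChart_smul_left {x₀ : M} {y : R7} (c : ℝ) (v w : R7) :
    G.metricInChart x₀ y (c • v) w = c * G.metricInChart x₀ y v w := by
  let A : R7 →L[ℝ] R7 := (show R7 →L[ℝ] R7 from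
    (G.frame ((extChartAt (𝓡 7) x₀).symm y) :
      TangentSpace (𝓡 7) ((extChartAt (𝓡 7) x₀).symm y) →L[ℝ] R7)).comp (ofChart x₀ y)
  change inner ℝ (A (c • v)) (A w) = c * inner ℝ (A v) (A w)
  rw [map_smul, real_inner_smul_left]

/-- The integrand of `⟨DV, W⟩` in charts: up to a sign, the first variation of `*φ` on the coordinate
vector fields, because the density cancels `chartForm` up to sign. -/
theorem chartDensity_mul_metric_linearizationAt [T2Space M] {ι : C^∞⟮𝓡 3, L; 𝓡 7, M⟯}
    {o : ∀ x : L, Orientation ℝ (TangentSpace (𝓡 3) x) (Fin 3)}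
    (hι : Manifold.IsImmersion (𝓡 3) (𝓡 7) ∞ ι) (hL : G.IsAssociative ι o)
    {V W : ∀ x : L, TangentSpace (𝓡 7) (ι x)}
    (hV : ContMDiff (𝓡 3) (𝓡 7).tangent ∞ (fun x => (⟨ι x, V x⟩ : TangentBundle (𝓡 7) M)))
    {x₀ : M} {x₁ : L} {η : R3} (hη : η ∈ (extChartAt (𝓡 3) x₁).target)
    (hx : ι ((extChartAt (𝓡 3) x₁).symm η) ∈ (extChartAt (𝓡 7) x₀).source) :
    G.chartDensity ι x₁ η * G.metric (ι ((extChartAt (𝓡 3) x₁).symm η))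
        (G.linearizationAt ι V ((extChartAt (𝓡 3) x₁).symm η)) (W ((extChartAt (𝓡 3) x₁).symm η)) =
      -(|G.chartForm ι x₀ x₁ η| * (G.chartForm ι x₀ x₁ η)⁻¹) *
        firstVar (formInChart G.starForm x₀) (inChart (chartMap ι x₀) x₁ η)
          (inChart (chartField ι V x₀) x₁ η)
          (fun i => fderiv ℝ (inChart (chartMap ι x₀) x₁) η (e3 i))
          (fun i => fderiv ℝ (inChart (chartField ι V x₀) x₁) η (e3 i))
          (inChart (chartField ι W x₀) x₁ η) := by
  have hs := (extChartAt (𝓡 3) x₁).map_target hη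
  have h1 : toChart x₀ (ι ((extChartAt (𝓡 3) x₁).symm η))
      (G.linearizationAt ι V ((extChartAt (𝓡 3) x₁).symm η)) = G.chartLinearization ι V x₀ x₁ η := by
    rw [linearizationAt_eq hι hL hV hs hx, (extChartAt (𝓡 3) x₁).right_inv hη]
    exact toChart_ofChart' hx _
  have h2 := G.metric_eq_metricInChart hx (G.linearizationAt ι V ((extChartAt (𝓡 3) x₁).symm η))
    (W ((extChartAt (𝓡 3) x₁).symm η))
  rw [h1] at h2
  have h3 : inChart (chartMap ι x₀) x₁ η ∈ (extChartAt (𝓡 7) x₀).target :=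
    (extChartAt (𝓡 7) x₀).map_source hx
  have h4 := h2.trans ((G.metricInChart_smul_left _ _ _).trans
    (congrArg ((G.chartForm ι x₀ x₁ η)⁻¹ * ·) (G.metricInChart_variationVector h3
      (inChart (chartField ι V x₀) x₁ η) _ _ (inChart (chartField ι W x₀) x₁ η))))
  refine (congrArg₂ (· * ·) (G.chartDensity_eq_abs_chartForm hL hι hη hx) h4).trans ?_
  ring

/-- The linearization is a differential operator, hence local. -/
theorem linearizationAt_eq_zero [T2Space M] {ι : C^∞⟮𝓡 3, L; 𝓡 7, M⟯}
    {V : ∀ x : L, TangentSpace (𝓡 7) (ι x)} {x : L} (h : ∀ᶠ x' in 𝓝 x, V x' = 0) :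
    G.linearizationAt ι V x = 0 := by
  have hη := mem_extChartAt_target (I := 𝓡 3) x
  have h1 : inChart (chartField ι V (ι x)) x =ᶠ[𝓝 (extChartAt (𝓡 3) x x)] fun _ => 0 := by
    have h2 : ContinuousAt (extChartAt (𝓡 3) x).symm (extChartAt (𝓡 3) x x) :=
      continuousAt_extChartAt_symm x
    have h3 : ∀ᶠ x' in 𝓝 ((extChartAt (𝓡 3) x).symm (extChartAt (𝓡 3) x x)), V x' = 0 := by
      rwa [extChartAt_to_inv]
    filter_upwards [h2.eventually h3] with η hη
    change toChart _ _ (V _) = 0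
    rw [hη]
    exact map_zero _
  have h4 : inChart (chartField ι V (ι x)) x (extChartAt (𝓡 3) x x) = 0 := h1.eq_of_nhds
  have h5 : ∀ (y : R7) (B : Fin 3 → R7), G.variationVector (ι x) y 0 B (fun _ => 0) = 0 := fun y B => by
    have h6 := G.variationVector_smul_add_smul (x₀ := ι x) y 0 0 B (fun _ => 0) (fun _ => 0) 0 0
    simpa using h6
  unfold linearizationAt chartLinearization
  simp only [h4, h1.fderiv_eq]
  simp [h5]
  rfl

end G2Structure

/-! ### Self-adjointness -/

namespace G2Structure

variable {M : Type*} [TopologicalSpace M] [ChartedSpace R7 M] (G : G2Structure M)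
  {L : Type*} [TopologicalSpace L] [ChartedSpace R3 L] [IsManifold (𝓡 7) ∞ M]
  [IsManifold (𝓡 3) ∞ L]

/-- The vector field whose divergence, in charts around `x₀` and `x₁`, is the difference of the two
sides in the self-adjointness of the linearization. The first factor is the sign of the chart around
`x₁` with respect to the orientation. -/
def boundaryField (ι : L → M) (V W : ∀ x : L, TangentSpace (𝓡 7) (ι x)) (x₀ : M) (x₁ : L)
    (i : Fin 3) (η : R3) : ℝ :=
  -(|G.chartForm ι x₀ x₁ η| * (G.chartForm ι x₀ x₁ η)⁻¹) *
    variationField (formInChart G.starForm x₀) (inChart (chartMap ι x₀) x₁)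
      (inChart (chartField ι V x₀) x₁) (inChart (chartField ι W x₀) x₁) i η

theorem contDiffAt_variationField {ψ : R7 → R7 [⋀^Fin 4]→L[ℝ] ℝ} {f h k : R3 → R7} {η : R3}
    (hψ : ContDiffAt ℝ ∞ ψ (f η)) (hf : ContDiffAt ℝ ∞ f η) (hh : ContDiffAt ℝ ∞ h η)
    (hk : ContDiffAt ℝ ∞ k η) (i : Fin 3) : ContDiffAt ℝ ∞ (variationField ψ f h k i) η := by
  refine contDiffAt_cons (v := fun j η => Function.update (fun j => fderiv ℝ f η (e3 j)) i (h η) j)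
    (hψ.comp η hf) hk fun j => ?_
  by_cases hj : j = i
  · subst hj
    simpa using hh
  · simp only [Function.update_of_ne hj]
    exact (hf.fderiv_right (m := ∞) (by decide)).clm_apply contDiffAt_const

section

variable [T2Space M] {ι : C^∞⟮𝓡 3, L; 𝓡 7, M⟯} {V W : ∀ x : L, TangentSpace (𝓡 7) (ι x)}
  (hV : ContMDiff (𝓡 3) (𝓡 7).tangent ∞ (fun x => (⟨ι x, V x⟩ : TangentBundle (𝓡 7) M)))
  (hW : ContMDiff (𝓡 3) (𝓡 7).tangent ∞ (fun x => (⟨ι x, W x⟩ : TangentBundle (𝓡 7) M)))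
  {o : ∀ x : L, Orientation ℝ (TangentSpace (𝓡 3) x) (Fin 3)}
  (hι : Manifold.IsImmersion (𝓡 3) (𝓡 7) ∞ ι) (hL : G.IsAssociative ι o)

include hV hW in
theorem contDiffAt_variationField_chart {x₀ : M} {x₁ : L} {η : R3}
    (hη : η ∈ (extChartAt (𝓡 3) x₁).target)
    (hx : ι ((extChartAt (𝓡 3) x₁).symm η) ∈ (extChartAt (𝓡 7) x₀).source) (i : Fin 3) :
    ContDiffAt ℝ ∞ (variationField (formInChart G.starForm x₀) (inChart (chartMap ι x₀) x₁)
      (inChart (chartField ι V x₀) x₁) (inChart (chartField ι W x₀) x₁) i) η :=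
  contDiffAt_variationField (((G.contDiffOn_formInChart_starForm x₀).contDiffAt
    ((isOpen_chart_target x₀).mem_nhds ((extChartAt (𝓡 7) x₀).map_source hx))))
    (contDiffAt_inChart hη (contMDiffAt_chartMap ι hx))
    (contDiffAt_inChart hη (contMDiffAt_chartField hV hx))
    (contDiffAt_inChart hη (contMDiffAt_chartField hW hx)) i

include hV hW hι hL in
/-- The divergence identity for the integrands in charts. -/
theorem chartDensity_mul_eq_sum_fderiv (hG : G.IsCoclosed) {x₀ : M} {x₁ : L} {η : R3}
    (hη : η ∈ (extChartAt (𝓡 3) x₁).target)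
    (hx : ι ((extChartAt (𝓡 3) x₁).symm η) ∈ (extChartAt (𝓡 7) x₀).source) :
    G.chartDensity ι x₁ η * (G.metric (ι ((extChartAt (𝓡 3) x₁).symm η))
          (G.linearizationAt ι V ((extChartAt (𝓡 3) x₁).symm η)) (W ((extChartAt (𝓡 3) x₁).symm η)) -
        G.metric (ι ((extChartAt (𝓡 3) x₁).symm η))
          (G.linearizationAt ι W ((extChartAt (𝓡 3) x₁).symm η)) (V ((extChartAt (𝓡 3) x₁).symm η))) =
      ∑ i, fderiv ℝ (G.boundaryField ι V W x₀ x₁ i) η (e3 i) := by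
  have hy : inChart (chartMap ι x₀) x₁ η ∈ (extChartAt (𝓡 7) x₀).target :=
    (extChartAt (𝓡 7) x₀).map_source hx
  have h1 := firstVar_sub_firstVar (G.differentiableAt_formInChart_starForm hy) (hG x₀ _ hy)
    (contDiffAt_inChart hη (contMDiffAt_chartMap ι hx))
    ((contDiffAt_inChart hη (contMDiffAt_chartField hV hx)).differentiableAt (by simp))
    ((contDiffAt_inChart hη (contMDiffAt_chartField hW hx)).differentiableAt (by simp))
  rw [mul_sub, G.chartDensity_mul_metric_linearizationAt hι hL hV hη hx,
    G.chartDensity_mul_metric_linearizationAt hι hL hW hη hx, ← mul_sub, h1, Finset.mul_sum]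
  refine Finset.sum_congr rfl fun i _ => ?_
  -- the sign is locally constant, so the derivative does not see it
  have h2 : G.boundaryField ι V W x₀ x₁ i =ᶠ[𝓝 η] fun η' =>
      -(|G.chartForm ι x₀ x₁ η| * (G.chartForm ι x₀ x₁ η)⁻¹) *
        variationField (formInChart G.starForm x₀) (inChart (chartMap ι x₀) x₁)
          (inChart (chartField ι V x₀) x₁) (inChart (chartField ι W x₀) x₁) i η' := by
    filter_upwards [abs_mul_inv_eventuallyEq (G.contDiffAt_chartForm ι hη hx).continuousAt
      (chartForm_ne_zero hL hι hη hx)] with η' hη'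
    rw [boundaryField, hη']
  rw [h2.fderiv_eq, fderiv_const_mul
    ((G.contDiffAt_variationField_chart hV hW hη hx i).differentiableAt (by simp))]
  rfl

include hV hW hι hL in
theorem contDiffAt_boundaryField {x₀ : M} {x₁ : L} {η : R3}
    (hη : η ∈ (extChartAt (𝓡 3) x₁).target)
    (hx : ι ((extChartAt (𝓡 3) x₁).symm η) ∈ (extChartAt (𝓡 7) x₀).source) (i : Fin 3) :
    ContDiffAt ℝ 1 (G.boundaryField ι V W x₀ x₁ i) η := by
  have h : ContDiffAt ℝ ∞ (G.boundaryField ι V W x₀ x₁ i) η := by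
    refine ContDiffAt.mul ?_ (G.contDiffAt_variationField_chart hV hW hη hx i)
    refine (contDiffAt_const (c := |G.chartForm ι x₀ x₁ η| *
      (G.chartForm ι x₀ x₁ η)⁻¹)).neg.congr_of_eventuallyEq ?_
    filter_upwards [abs_mul_inv_eventuallyEq (G.contDiffAt_chartForm ι hη hx).continuousAt
      (chartForm_ne_zero hL hι hη hx)] with η' hη'
    rw [hη']
  exact h.of_le (by decide)

include hV hW hι hL in
/-- Self-adjointness for sections supported in a coordinate chart, in integrated form: the
difference of the two sides is the integral of a divergence. -/
theorem integral_metric_linearizationAt_sub [MeasurableSpace L] [BorelSpace L] (hG : G.IsCoclosed)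
    {x₁ : L} {x₀ : M} {C : Set L} (hC : IsCompact C) (hC' : IsClosed C)
    (hCs : C ⊆ (extChartAt (𝓡 3) x₁).source ∩ ι ⁻¹' (extChartAt (𝓡 7) x₀).source)
    (hV0 : ∀ x ∉ C, V x = 0) :
    ∫ x, (G.metric (ι x) (G.linearizationAt ι V x) (W x) -
      G.metric (ι x) (G.linearizationAt ι W x) (V x)) ∂(G.volumeMeasure ι) = 0 := by
  have hzero : ∀ x ∉ C, G.metric (ι x) (G.linearizationAt ι V x) (W x) -
      G.metric (ι x) (G.linearizationAt ι W x) (V x) = 0 := fun x hx => by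
    have h1 : G.linearizationAt ι V x = 0 := linearizationAt_eq_zero G
      (by filter_upwards [hC'.isOpen_compl.mem_nhds hx] with x' hx' using hV0 x' hx')
    rw [h1, hV0 x hx]
    simp [metric]
  refine (G.integral_volumeMeasure_eq hL hι x₁
    ((G.continuous_metric (contMDiff_linearizationAt hι hL hV) hW).sub
      (G.continuous_metric (contMDiff_linearizationAt hι hL hW) hV))
    fun x hx => hzero x fun h => hx (hCs h).1).trans ?_
  set O := (extChartAt (𝓡 3) x₁).target ∩
    (extChartAt (𝓡 3) x₁).symm ⁻¹' (ι ⁻¹' (extChartAt (𝓡 7) x₀).source) with hO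
  have hOo : IsOpen O := (continuousOn_extChartAt_symm x₁).isOpen_inter_preimage
    (isOpen_extChartAt_target x₁)
    ((isOpen_extChartAt_source x₀).preimage ι.contMDiff.continuous)
  have hK : IsCompact (extChartAt (𝓡 3) x₁ '' C) :=
    hC.image_of_continuousOn ((continuousOn_extChartAt x₁).mono fun x hx => (hCs hx).1)
  have hsymm : ∀ y ∈ (extChartAt (𝓡 3) x₁).target \ extChartAt (𝓡 3) x₁ '' C,
      (extChartAt (𝓡 3) x₁).symm y ∉ C := fun y hy h =>
    hy.2 ⟨_, h, (extChartAt (𝓡 3) x₁).right_inv hy.1⟩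
  refine setIntegral_sum_fderiv_eq_zero hOo hK (measurableSet_target₃ x₁) ?_ (fun y hy => hy.1)
    (X := G.boundaryField ι V W x₀ x₁)
    (fun i y hy => G.contDiffAt_boundaryField hV hW hι hL hy.1 hy.2 i) (fun i y hy => ?_)
    (fun y hy => G.chartDensity_mul_eq_sum_fderiv hV hW hι hL hG hy.1 hy.2) fun y hy => ?_
  · rintro _ ⟨x, hx, rfl⟩
    refine ⟨(extChartAt (𝓡 3) x₁).map_source (hCs hx).1, ?_⟩
    rw [Set.mem_preimage, (extChartAt (𝓡 3) x₁).left_inv (hCs hx).1]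
    exact (hCs hx).2
  · have h1 : inChart (chartField ι V x₀) x₁ y = 0 := by
      change toChart _ _ (V _) = 0
      rw [hV0 _ (hsymm y ⟨hy.1.1, hy.2⟩)]
      exact map_zero _
    rw [boundaryField, variationField, h1, ContinuousAlternatingMap.map_coord_zero _ i.succ (by simp),
      mul_zero]
  · exact mul_eq_zero_of_right _ (hzero _ (hsymm y hy))

end

/-! ### Partition of unity -/

theorem contMDiff_smul_lift {ι : C^∞⟮𝓡 3, L; 𝓡 7, M⟯} {V : ∀ x : L, TangentSpace (𝓡 7) (ι x)}
    (hV : ContMDiff (𝓡 3) (𝓡 7).tangent ∞ (fun x => (⟨ι x, V x⟩ : TangentBundle (𝓡 7) M)))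
    {ρ : L → ℝ} (hρ : ContMDiff (𝓡 3) 𝓘(ℝ, ℝ) ∞ ρ) :
    ContMDiff (𝓡 3) (𝓡 7).tangent ∞ (fun x => (⟨ι x, ρ x • V x⟩ : TangentBundle (𝓡 7) M)) := by
  intro x
  have hx := mem_extChartAt_source (I := 𝓡 7) (ι x)
  refine (contMDiffAt_tangent_iff (f := fun x => (⟨ι x, ρ x • V x⟩ : TangentBundle (𝓡 7) M))
    hx).2 ⟨ι.contMDiff x, ?_⟩
  refine ((hρ x).smul (contMDiffAt_chartField hV hx)).congr_of_eventuallyEq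
    (Filter.Eventually.of_forall fun x' => ?_)
  exact map_smul (toChart (ι x) (ι x')) (ρ x') (V x')

/-- A normal section multiplied by a smooth function. -/
def smulSection {ι : C^∞⟮𝓡 3, L; 𝓡 7, M⟯} (ρ : C^∞⟮𝓡 3, L; 𝓘(ℝ, ℝ), ℝ⟯) (V : G.normalSections ι) :
    G.normalSections ι :=
  ⟨fun x => ρ x • V.1 x, contMDiff_smul_lift V.2.1 ρ.contMDiff, fun x v => by
    have h := V.2.2 x v
    simp only [metric, map_smul, real_inner_smul_left] at h ⊢
    rw [h, mul_zero]⟩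

section

variable [T2Space M] [CompactSpace L] [MeasurableSpace L] [BorelSpace L]
  {ι : C^∞⟮𝓡 3, L; 𝓡 7, M⟯} {o : ∀ x : L, Orientation ℝ (TangentSpace (𝓡 3) x) (Fin 3)}
  (hι : Manifold.IsImmersion (𝓡 3) (𝓡 7) ∞ ι) (hL : G.IsAssociative ι o)

include hι hL in
theorem integrable_metric (V W : G.normalSections ι) :
    Integrable (fun x => G.metric (ι x) (V.1 x) (W.1 x)) (G.volumeMeasure ι) := by
  have := G.isFiniteMeasure_volumeMeasure hL hι
  exact (G.continuous_metric V.2.1 W.2.1).integrable_of_hasCompactSupport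
    (HasCompactSupport.of_compactSpace _)

theorem l2Inner_comm (V W : G.normalSections ι) : G.l2Inner ι V W = G.l2Inner ι W V := by
  unfold l2Inner
  simp only [G.metric_comm]

include hι hL in
theorem l2Inner_sum_left {κ : Type*} (s : Finset κ) (V : κ → G.normalSections ι)
    (W : G.normalSections ι) :
    G.l2Inner ι (∑ i ∈ s, V i) W = ∑ i ∈ s, G.l2Inner ι (V i) W := by
  unfold l2Inner
  rw [← integral_finsetSum _ fun i _ => G.integrable_metric hι hL (V i) W]
  refine integral_congr_ae (Filter.Eventually.of_forall fun x => ?_)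
  simp [metric, sum_inner]

theorem l2Inner_linearization_of_support (hG : G.IsCoclosed) (V W : G.normalSections ι)
    {x₁ : L} {x₀ : M} {C : Set L} (hC : IsClosed C)
    (hCs : C ⊆ (extChartAt (𝓡 3) x₁).source ∩ ι ⁻¹' (extChartAt (𝓡 7) x₀).source)
    (hV0 : ∀ x ∉ C, V.1 x = 0) :
    G.l2Inner ι (G.linearization ι hι hL V) W = G.l2Inner ι V (G.linearization ι hι hL W) := by
  rw [G.l2Inner_comm V]
  have h := G.integral_metric_linearizationAt_sub V.2.1 W.2.1 hι hL hG hC.isCompact hC hCs hV0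
  exact sub_eq_zero.1 ((integral_sub (G.integrable_metric hι hL (G.linearization ι hι hL V) W)
    (G.integrable_metric hι hL (G.linearization ι hι hL W) V)).symm.trans h)

/-- Self-adjointness for arbitrary sections: only `V` has to be cut off by a partition of unity, since
both sides are additive in `V`. -/
theorem l2Inner_linearization [T2Space L] (hG : G.IsCoclosed) (V W : G.normalSections ι) :
    G.l2Inner ι (G.linearization ι hι hL V) W = G.l2Inner ι V (G.linearization ι hι hL W) := by
  set U : L → Set L := fun x =>
    (extChartAt (𝓡 3) x).source ∩ ι ⁻¹' (extChartAt (𝓡 7) (ι x)).source with hU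
  have hUo : ∀ x, IsOpen (U x) := fun x => (isOpen_extChartAt_source x).inter
    ((isOpen_extChartAt_source (ι x)).preimage ι.contMDiff.continuous)
  obtain ⟨t, ht⟩ := CompactSpace.elim_nhds_subcover U fun x =>
    (hUo x).mem_nhds ⟨mem_extChartAt_source x, mem_extChartAt_source (ι x)⟩
  obtain ⟨ρ, hρ⟩ := SmoothPartitionOfUnity.exists_isSubordinate (𝓡 3) isClosed_univ
    (fun x : t => U x) (fun x => hUo x) (fun x _ => by
      have h1 : x ∈ ⋃ y ∈ t, U y := by rw [ht]; trivial
      simpa using h1)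
  have hsum : V = ∑ i, G.smulSection (ρ i) V := by
    ext1
    funext x
    have h1 := ρ.sum_eq_one (Set.mem_univ x)
    rw [finsum_eq_sum_of_fintype] at h1
    rw [AddSubmonoidClass.coe_finsetSum, Finset.sum_apply]
    change V.1 x = ∑ i, ρ i x • V.1 x
    rw [← Finset.sum_smul, h1, one_smul]
  rw [hsum, map_sum, G.l2Inner_sum_left hι hL, G.l2Inner_sum_left hι hL]
  refine Finset.sum_congr rfl fun i _ => ?_
  refine G.l2Inner_linearization_of_support hι hL hG _ W (isClosed_tsupport (ρ i)) (hρ i)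
    fun x hx => ?_
  change ρ i x • V.1 x = 0
  rw [image_eq_zero_of_notMem_tsupport hx, zero_smul]

end

/-! ### Torsion-free and nearly parallel structures -/

theorem formInChart_smul {k : ℕ} (c : ℝ) (α : ∀ p : M, TangentSpace (𝓡 7) p [⋀^Fin k]→L[ℝ] ℝ)
    (x₀ : M) (y : R7) : formInChart (fun p => c • α p) x₀ y = c • formInChart α x₀ y :=
  rfl

/-- For a nearly parallel structure `*φ` is exact: `d(φ / 4) = *φ`. -/
theorem IsNearlyParallel.isCoclosed (hG : G.IsNearlyParallel) : G.IsCoclosed := by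
  intro x₀ y hy
  have h1 : formInChart G.starForm x₀ =ᶠ[𝓝 y]
      (1 / 4 : ℝ) • extDeriv (formInChart G.form x₀) := by
    filter_upwards [(isOpen_chart_target x₀).mem_nhds hy] with z hz
    rw [Pi.smul_apply, hG x₀ z hz, formInChart_smul, smul_smul]
    norm_num
  have h2 : ContDiffAt ℝ ∞ (formInChart G.form x₀) y :=
    (G.smooth x₀).contDiffAt ((isOpen_chart_target x₀).mem_nhds hy)
  rw [h1.extDeriv_eq, extDeriv_smul, extDeriv_extDeriv_apply h2 (by simp; decide), smul_zero]
  rfl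

end G2Structure

theorem lemma3 {M : Type*} [TopologicalSpace M] [T2Space M] [ChartedSpace R7 M]
    [IsManifold (𝓡 7) ∞ M] (G : G2Structure M)
    {L : Type*} [TopologicalSpace L] [CompactSpace L] [MeasurableSpace L] [BorelSpace L]
    [ChartedSpace R3 L] [IsManifold (𝓡 3) ∞ L]
    (ι : C^∞⟮𝓡 3, L; 𝓡 7, M⟯) (hι : Manifold.IsSmoothEmbedding (𝓡 3) (𝓡 7) ∞ ι)
    (o : ∀ x : L, Orientation ℝ (TangentSpace (𝓡 3) x) (Fin 3))
    (hL : G.IsAssociative ι o) :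
    (G.IsCoclosed → G.HasSelfAdjointLinearization ι o) ∧
    (G.IsTorsionFree → G.HasSelfAdjointLinearization ι o) ∧
    (G.IsNearlyParallel → G.HasSelfAdjointLinearization ι o) := by
  have : T2Space L := hι.isEmbedding.t2Space
  have h : G.IsCoclosed → G.HasSelfAdjointLinearization ι o := fun hG =>
    ⟨G.linearization ι hι.isImmersion hL, G2Structure.isLinearization_linearization hι.isImmersion hL,
      G.l2Inner_linearization hι.isImmersion hL hG⟩
  exact ⟨h, fun hG => h hG.2, fun hG => h hG.isCoclosed⟩
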